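/- Theorem 5.5. Let $\Omega\subset\mathbb{R}^2$ be an open, bounded, simply connected set with smooth boundary, and let $G=[G_{ij}]_{i,j=1,2,3}:\bar\Omega\to\mathbb{R}^{3\times3}$ be a smooth field of symmetric positive definite matrices, regarded as the metric $G(x',x_3)=G(x')$ on $\Omega\times(-\frac h2,\frac h2)$, which does not depend on $x_3$. Write $[G^{ij}]=G^{-1}$ and $$\Gamma^i_{kl}=\tfrac12\sum_{m=1}^3G^{im}(\partial_lG_{mk}+\partial_kG_{ml}-\partial_mG_{kl}),\qquad R_{sijk}=\sum_{m=1}^3G_{sm}R^m_{ijk},$$ $$R^s_{ijk}=\partial_j\Gamma^s_{ik}-\partial_k\Gamma^s_{ij}+\sum_{m=1}^3\Gamma^s_{jm}\Gamma^m_{ik}-\sum_{m=1}^3\Gamma^s_{km}\Gamma^m_{ij},$$ with $\partial_3G=0$. For a $3\times 3$ matrix $F$ let $F_{2\times2}$ be its upper left $2\times2$ block. Let $W:\mathbb{R}^{3\times3}\to[0,\infty]$ be finite and $\mathcal{C}^2$ in a neighborhood of $SO(3)$, with $W(R)=0$ and $W(RF)=W(F)$ for all $R\in SO(3)$, $F\in\mathbb{R}^{3\times3}$,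 and $W(F)\ge c\,\mathrm{dist}^2(F,SO(3))$ for all $F$ with some constant $c>0$, the distance being taken in the norm $|F|=(\mathrm{tr}(F^TF))^{1/2}$. Put $\mathcal{Q}_3(F)=D^2W(\mathrm{Id})(F,F)$ and $$\mathcal{Q}_2(x',F_{2\times2})=\min\{\mathcal{Q}_3(\sqrt{G(x')}^{-1}\tilde F\sqrt{G(x')}^{-1}):\ \tilde F\in\mathbb{R}^{3\times3},\ \tilde F_{2\times2}=F_{2\times2}\}.$$ A $W^{2,2}$ isometric immersion of $G_{2\times2}$ is a map $y\in W^{2,2}(\Omega,\mathbb{R}^3)$ with $(\nabla y)^T\nabla y=G_{2\times2}$ a.e. in $\Omega$. For such $y$ let $$\vec N=\frac{\partial_1y\times\partial_2y}{|\partial_1y\times\partial_2y|},\qquad \vec b=(\nabla y)(G_{2\times2})^{-1}\begin{bmatrix}G_{13}\\G_{23}\end{bmatrix}+\frac{\sqrt{\det G}}{\sqrt{\det G_{2\times2}}}\vec N,\qquad \Pi=(\nabla y)^T\nabla\vec N,$$ $$\mathcal{I}_G(y)=\frac1{24}\int_\Omega\mathcal{Q}_2\big(x',(\nabla y)^T\nabla\vec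 b\big)\,dx'.$$ Then the following four conditions are equivalent: (i) $\min\mathcal{I}_G=0$, where the minimum is taken over the $W^{2,2}$ isometric immersions of $G_{2\times2}$ in $\mathbb{R}^3$ (that is, there is such an immersion $y$ with $\mathcal{I}_G(y)=0$); (ii) there is a $W^{2,2}$ isometric immersion $y$ of $G_{2\times2}$ such that $\mathrm{sym}\big((\nabla y)^T\nabla\vec b\big)=0$ a.e. in $\Omega$, where $\vec b\in W^{1,2}(\Omega,\mathbb{R}^3)$ is uniquely defined a.e. by $\det Q>0$ and $Q^TQ=G$ for the matrix field $Q$ with columns $\partial_1y,\partial_2y,\vec b$; (iii) there is a $W^{2,2}$ isometric immersion of $G_{2\times2}$ whose second fundamental form satisfies $\Pi_{ij}=-\frac{1}{\sqrt{G^{33}}}\Gamma^3_{ij}$ a.e. in $\Omega$ for $i,j\in\{1,2\}$; (iv) $R^3_{112}=R^3_{221}=R_{1212}=0$ in $\Omega$. -/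

import Mathlib

open Set MeasureTheory
open scoped Matrix ENNReal ContDiff

namespace PrestrainedPlate

noncomputable section

/-- The plane `ℝ²`, with its Euclidean norm and Lebesgue measure. -/
abbrev Plane : Type := EuclideanSpace ℝ (Fin 2)

/-- The coordinate vector `e i` of the plane. -/
def e (i : Fin 2) : Plane := EuclideanSpace.single i 1

/-! ### Smooth planar domains -/

/-- `Ω` has a smooth boundary: near each boundary point it is the negativity set of a smooth
function whose differential does not vanish at that point. -/
def HasSmoothBoundary (Ω : Set Plane) : Prop :=
  ∀ p ∈ frontier Ω, ∃ U : Set Plane, IsOpen U ∧ p ∈ U ∧ ∃ ρ : Plane → ℝ,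
    ContDiffOn ℝ ∞ ρ U ∧ fderiv ℝ ρ p ≠ 0 ∧ Ω ∩ U = {x ∈ U | ρ x < 0}

/-- An open, bounded, smooth and simply connected set (simply connected includes nonempty and
path connected). -/
structure IsMidplate (Ω : Set Plane) : Prop where
  isOpen : IsOpen Ω
  isBounded : Bornology.IsBounded Ω
  smooth : HasSmoothBoundary Ω
  simplyConnected : IsSimplyConnected Ω

/-- `G` is a smooth (up to the boundary) field of symmetric positive definite `3 × 3` matrices on
the closure of `Ω`. -/
structure IsPlateMetric (Ω : Set Plane) (G : Plane → Matrix (Fin 3) (Fin 3) ℝ) : Prop where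
  smooth : ∀ i j, ContDiffOn ℝ ∞ (fun x => G x i j) (closure Ω)
  posDef : ∀ x ∈ closure Ω, (G x).PosDef

/-! ### Weak derivatives and Sobolev functions -/

/-- `g` is the weak partial derivative `∂ᵢ f` on `Ω`. -/
def IsWeakPartial (Ω : Set Plane) (i : Fin 2) (f g : Plane → ℝ) : Prop :=
  LocallyIntegrableOn f Ω ∧ LocallyIntegrableOn g Ω ∧
    ∀ φ : Plane → ℝ, ContDiff ℝ ∞ φ → HasCompactSupport φ → tsupport φ ⊆ Ω →
      ∫ x in Ω, f x * fderiv ℝ φ x (e i) = -∫ x in Ω, g x * φ x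

/-- The Sobolev space `W^{1,2}(Ω)`. -/
def MemW12 (Ω : Set Plane) (f : Plane → ℝ) : Prop :=
  MemLp f 2 (volume.restrict Ω) ∧
    ∀ i, ∃ g, MemLp g 2 (volume.restrict Ω) ∧ IsWeakPartial Ω i f g

/-- The Sobolev space `W^{2,2}(Ω)`. -/
def MemW22 (Ω : Set Plane) (f : Plane → ℝ) : Prop :=
  MemLp f 2 (volume.restrict Ω) ∧
    ∀ i, ∃ g, MemW12 Ω g ∧ IsWeakPartial Ω i f g

open Classical in
/-- A representative of the weak partial derivative `∂ᵢ f` on `Ω`. It is unique up to equality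
almost everywhere on `Ω`. The value `0` is a convention when there is no weak derivative. -/
def weakPartial (Ω : Set Plane) (i : Fin 2) (f : Plane → ℝ) : Plane → ℝ :=
  if h : ∃ g, IsWeakPartial Ω i f g then h.choose else 0

/-- The `3 × 2` matrix field `∇u`, with columns `∂₁u`, `∂₂u`, of a field `u : Ω → ℝ³`. -/
def grad (Ω : Set Plane) (u : Plane → Fin 3 → ℝ) (x : Plane) : Matrix (Fin 3) (Fin 2) ℝ :=
  Matrix.of fun k i => weakPartial Ω i (fun z => u z k) x

/-! ### Isometric immersions of the midplate metric -/

/-- The principal `2 × 2` minor of a `3 × 3` matrix. -/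
def minor22 (F : Matrix (Fin 3) (Fin 3) ℝ) : Matrix (Fin 2) (Fin 2) ℝ :=
  F.submatrix Fin.castSucc Fin.castSucc

/-- `y ∈ W^{2,2}(Ω, ℝ³)` and `(∇y)ᵀ∇y = G_{2×2}` almost everywhere in `Ω`. -/
def IsIsometricImmersion (Ω : Set Plane) (G : Plane → Matrix (Fin 3) (Fin 3) ℝ)
    (y : Plane → Fin 3 → ℝ) : Prop :=
  (∀ k, MemW22 Ω fun x => y x k) ∧
    ∀ᵐ x ∂volume.restrict Ω, (grad Ω y x)ᵀ * grad Ω y x = minor22 (G x)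

/-- The unit normal `N = (∂₁y × ∂₂y) / |∂₁y × ∂₂y|`. -/
def unitNormal (Ω : Set Plane) (y : Plane → Fin 3 → ℝ) (x : Plane) : Fin 3 → ℝ :=
  let n := crossProduct ((grad Ω y x)ᵀ 0) ((grad Ω y x)ᵀ 1)
  (Real.sqrt (n ⬝ᵥ n))⁻¹ • n

/-- The Cosserat vector
`b = (∇y) (G_{2×2})⁻¹ (G₁₃, G₂₃)ᵀ + (√(det G) / √(det G_{2×2})) N`. -/
def cosserat (Ω : Set Plane) (G : Plane → Matrix (Fin 3) (Fin 3) ℝ)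
    (y : Plane → Fin 3 → ℝ) (x : Plane) : Fin 3 → ℝ :=
  grad Ω y x *ᵥ ((minor22 (G x))⁻¹ *ᵥ ![G x 0 2, G x 1 2]) +
    (Real.sqrt (G x).det / Real.sqrt (minor22 (G x)).det) • unitNormal Ω y x

/-- The second fundamental form `Π = (∇y)ᵀ∇N`. (For a `W^{2,2}` isometric immersion `y` of a
smooth metric the normal `N` lies in `W^{1,2}`.) -/
def secondForm (Ω : Set Plane) (y : Plane → Fin 3 → ℝ) (x : Plane) : Matrix (Fin 2) (Fin 2) ℝ :=
  (grad Ω y x)ᵀ * grad Ω (unitNormal Ω y) x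

/-! ### The elastic energy density and the bending energy -/

open scoped MatrixOrder in
/-- The symmetric positive semidefinite square root `√P` of a positive semidefinite matrix. -/
def matrixSqrt (P : Matrix (Fin 3) (Fin 3) ℝ) : Matrix (Fin 3) (Fin 3) ℝ := CFC.sqrt P

/-- The set `SO(3)`. -/
def SO3 : Set (Matrix (Fin 3) (Fin 3) ℝ) := Matrix.specialOrthogonalGroup (Fin 3) ℝ

/- Matrices carry the norm `|F| = (tr (FᵀF))^{1/2}`. -/
attribute [local instance] Matrix.frobeniusNormedAddCommGroup Matrix.frobeniusNormedSpace

/-- An elastic energy density `W : ℝ^{3×3} → [0, ∞]`: finite and `C²` in a neighbourhood of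
`SO(3)`, normalized, frame indifferent and nondegenerate. -/
structure IsEnergyDensity (W : Matrix (Fin 3) (Fin 3) ℝ → ℝ≥0∞) : Prop where
  regular : ∃ U : Set (Matrix (Fin 3) (Fin 3) ℝ), IsOpen U ∧ SO3 ⊆ U ∧
    (∀ F ∈ U, W F ≠ ⊤) ∧ ContDiffOn ℝ 2 (fun F => (W F).toReal) U
  normalized : ∀ R ∈ SO3, W R = 0
  frameIndifferent : ∀ F, ∀ R ∈ SO3, W (R * F) = W F
  nondegenerate : ∃ c : ℝ, 0 < c ∧ ∀ F, ENNReal.ofReal (c * Metric.infDist F SO3 ^ 2) ≤ W F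

/-- The quadratic form `Q₃(F) = D²W(Id)(F, F)`. -/
def Q3 (W : Matrix (Fin 3) (Fin 3) ℝ → ℝ≥0∞) (F : Matrix (Fin 3) (Fin 3) ℝ) : ℝ :=
  iteratedFDeriv ℝ 2 (fun F' => (W F').toReal) 1 ![F, F]

/-- The quadratic form `Q₂(F) = min {Q₃(√P⁻¹ F' √P⁻¹) : F'_{2×2} = F}` at a point where the
metric has the value `P`. (The minimum of a nonnegative quadratic form on an affine space is
attained, so that it is the infimum.) -/
def Q2 (W : Matrix (Fin 3) (Fin 3) ℝ → ℝ≥0∞) (P : Matrix (Fin 3) (Fin 3) ℝ)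
    (F : Matrix (Fin 2) (Fin 2) ℝ) : ℝ :=
  sInf {q | ∃ F' : Matrix (Fin 3) (Fin 3) ℝ, minor22 F' = F ∧
    q = Q3 W ((matrixSqrt P)⁻¹ * F' * (matrixSqrt P)⁻¹)}

/-- The bending energy `I_G(y) = (1/24) ∫_Ω Q₂(x', (∇y)ᵀ∇b) dx'` of an isometric immersion `y`,
the integral of a nonnegative function. (For a `W^{2,2}` isometric immersion `y` of a smooth
metric the Cosserat vector `b` lies in `W^{1,2}`.) -/
def bendingEnergy (W : Matrix (Fin 3) (Fin 3) ℝ → ℝ≥0∞) (Ω : Set Plane)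
    (G : Plane → Matrix (Fin 3) (Fin 3) ℝ) (y : Plane → Fin 3 → ℝ) : ℝ≥0∞ :=
  24⁻¹ * ∫⁻ x in Ω,
    ENNReal.ofReal (Q2 W (G x) ((grad Ω y x)ᵀ * grad Ω (cosserat Ω G y) x))

/-! ### Christoffel symbols and curvatures of the three-dimensional metric

The metric `G(x', x₃) = G(x')` lives on `Ω × (-h/2, h/2)` and does not depend on `x₃`. Indices
`1, 2, 3` of the mathematics are `0, 1, 2` below. -/

/-- The partial derivative `∂ₖ f`, `k = 1, 2, 3`, at `(x', x₃)` of the function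
`(x', x₃) ↦ f x'`; in particular `∂₃ f = 0`. -/
def partial3 (k : Fin 3) (f : Plane → ℝ) (x : Plane) : ℝ :=
  ![fderiv ℝ f x (e 0), fderiv ℝ f x (e 1), 0] k

/-- `Γ^i_{kl} = ½ ∑ₘ G^{im} (∂ₗ G_{mk} + ∂ₖ G_{ml} - ∂ₘ G_{kl})`. -/
def christoffel (G : Plane → Matrix (Fin 3) (Fin 3) ℝ) (i k l : Fin 3) (x : Plane) : ℝ :=
  (1 / 2) * ∑ m, (G x)⁻¹ i m *
    (partial3 l (fun z => G z m k) x + partial3 k (fun z => G z m l) x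
      - partial3 m (fun z => G z k l) x)

/-- `R^s_{ijk} = ∂ⱼ Γ^s_{ik} - ∂ₖ Γ^s_{ij} + ∑ₘ Γ^s_{jm} Γ^m_{ik} - ∑ₘ Γ^s_{km} Γ^m_{ij}`. -/
def riemann (G : Plane → Matrix (Fin 3) (Fin 3) ℝ) (s i j k : Fin 3) (x : Plane) : ℝ :=
  partial3 j (christoffel G s i k) x - partial3 k (christoffel G s i j) x
    + ∑ m, christoffel G s j m x * christoffel G m i k x
    - ∑ m, christoffel G s k m x * christoffel G m i j x

/-- `R_{sijk} = ∑ₘ G_{sm} R^m_{ijk}`. -/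
def riemannLow (G : Plane → Matrix (Fin 3) (Fin 3) ℝ) (s i j k : Fin 3) (x : Plane) : ℝ :=
  ∑ m, G x s m * riemann G m i j k x

/-! ### The four conditions -/

/-- `min I_G = 0`, the minimum being taken over the `W^{2,2}` isometric immersions of
`G_{2×2}` in `ℝ³` (and being attained). -/
def MinBendingEnergyZero (W : Matrix (Fin 3) (Fin 3) ℝ → ℝ≥0∞) (Ω : Set Plane)
    (G : Plane → Matrix (Fin 3) (Fin 3) ℝ) : Prop :=
  IsLeast (bendingEnergy W Ω G '' {y | IsIsometricImmersion Ω G y}) 0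

/-- There is a `W^{2,2}` isometric immersion `y` of `G_{2×2}` with `sym ((∇y)ᵀ∇b) = 0` almost
everywhere, where `b ∈ W^{1,2}` is determined almost everywhere by `det Q > 0` and `QᵀQ = G` for
the matrix `Q` with the columns `∂₁y, ∂₂y, b`. -/
def HasSymFreeImmersion (Ω : Set Plane) (G : Plane → Matrix (Fin 3) (Fin 3) ℝ) : Prop :=
  ∃ y, IsIsometricImmersion Ω G y ∧ ∃ b : Plane → Fin 3 → ℝ,
    (∀ k, MemW12 Ω fun x => b x k) ∧
    (∀ᵐ x ∂volume.restrict Ω,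
      let Q : Matrix (Fin 3) (Fin 3) ℝ :=
        (Matrix.of ![(grad Ω y x)ᵀ 0, (grad Ω y x)ᵀ 1, b x])ᵀ
      0 < Q.det ∧ Qᵀ * Q = G x) ∧
    ∀ᵐ x ∂volume.restrict Ω,
      (1 / 2 : ℝ) • ((grad Ω y x)ᵀ * grad Ω b x + ((grad Ω y x)ᵀ * grad Ω b x)ᵀ) = 0

/-- There is a `W^{2,2}` isometric immersion of `G_{2×2}` whose second fundamental form is
`Π_{ij} = -Γ³_{ij} / √(G^{33})`, `i, j ∈ {1, 2}`. -/
def HasChristoffelImmersion (Ω : Set Plane) (G : Plane → Matrix (Fin 3) (Fin 3) ℝ) : Prop :=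
  ∃ y, IsIsometricImmersion Ω G y ∧ ∀ᵐ x ∂volume.restrict Ω, ∀ i j : Fin 2,
    secondForm Ω y x i j
      = -(1 / Real.sqrt ((G x)⁻¹ 2 2)) * christoffel G 2 i.castSucc j.castSucc x

/-- `R³₁₁₂ = R³₂₂₁ = R₁₂₁₂ = 0` in `Ω`. -/
def CurvaturesVanish (Ω : Set Plane) (G : Plane → Matrix (Fin 3) (Fin 3) ℝ) : Prop :=
  ∀ x ∈ Ω, riemann G 2 0 0 1 x = 0 ∧ riemann G 2 1 1 0 x = 0 ∧ riemannLow G 0 1 0 1 x = 0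

end

end PrestrainedPlate

/-! ### Frobenius theorem for flat linear systems on simply connected sets -/

section FlatSystem

open Metric Filter Topology

variable {E : Type*} [NormedAddCommGroup E] [NormedSpace ℝ E]
  {𝔸 : Type*} [NormedRing 𝔸] [NormedAlgebra ℝ 𝔸]

/-! Write `Γ_i` for the matrix `[Γ^k_{ij}]_{k,j}`, `i = 1, 2`, and let `Q` be the frame with columns
`∂₁y, ∂₂y, b`, so that `QᵀQ = G`. The first three conditions all say that some isometric immersion
has a parallel frame, `∂_i Q = Q Γ_i` (`IsParallel`), and the fourth is the integrability condition
of this system.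

For an immersion `y`, consider the defect `E_i = Qᵀ∂_i Q - GΓ_i`. It is skew, since both terms have
symmetric part `½ ∂_i G`; and column `j` of `E_i` is column `i` of `E_j`, since `∂_i∂_j y = ∂_j∂_i
y` and the Christoffel symbols are symmetric (`IsFrame.defect_spec`). As in the uniqueness proof for
the Levi-Civita connection, the two symmetries kill the upper left `2 × 2` block of `E_i`, and only
the three numbers `(E_i)_{3j} = (E_j)_{3i}` remain. Because `G` does not depend on `x₃`,
`(GΓ_i)_{j3}` is skew in `i, j`, so these numbers are the entries of `-sym((∇y)ᵀ∇b)`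
(`isParallel_frame_iff`). Up to the factor `-√G³³` they are also the entries of `Π + Γ³/√G³³`
(`IsIsometricImmersion.secondForm_eq_iff`). Finally `Q₂(F) = 0` exactly when `sym F = 0`:
nondegeneracy of `W` bounds `D²W(Id)` below by the symmetric part, and frame indifference enters
through the vanishing of `W` on all rotations, which makes `D²W(Id)` vanish on skew matrices. So for
each `y` the three conditions agree.

If the frame is parallel, commuting the second weak derivatives of `Q` gives `Q · curv = 0` a.e.,
hence `curv = 0` everywhere by continuity (`IsFrame.curv_eq_zero`). The matrix `G · curv` is skew,
so its three independent entries are controlled by the three listed curvatures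
(`IsPlateMetric.curvaturesVanish_iff`).

Conversely, if `curv = 0`, the system `∂_i Q = QΓ_i`, `∂_i y = Q e_i` is flat and is solved on the
simply connected set `Ω` by `exists_solution_of_flat`. The product `Q G⁻¹ Qᵀ` is then constant, so
`QᵀQ = G` propagates from one point. Smoothness of `G` up to the boundary and regularity of `∂Ω`
give the bounds that put `y` in `W^{2,2}` (`exists_parallel_immersion`). -/

/-- `Z` solves the linear total differential system `dZ = Z A` at `x`. -/
def SolvesAt (A : E → E →L[ℝ] 𝔸) (Z : E → 𝔸) (x : E) : Prop :=
  HasFDerivAt Z ((ContinuousLinearMap.mul ℝ 𝔸 (Z x)).comp (A x)) x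

/-- The integrability condition of `dZ = Z A` at `x`. -/
def FlatAt (A : E → E →L[ℝ] 𝔸) (x : E) : Prop :=
  ∀ u v, fderiv ℝ A x u v - fderiv ℝ A x v u + A x u * A x v - A x v * A x u = 0

/-- Picard iteration in the ball of radius `1/2` about `1`: the smallness of `r` keeps the speed
below `1/2`, so the solution survives until time one. The norm of `1` appears because it is not
assumed to be one. -/
lemma exists_ray_solution [CompleteSpace 𝔸] {A : E → E →L[ℝ] 𝔸} {p : E} {r M : ℝ}
    (hM : 0 ≤ M) (hrM : (‖(1 : 𝔸)‖ + 1 / 2) * M * r ≤ 1 / 2)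
    (hA : ∀ x ∈ ball p r, ‖A x‖ ≤ M) (hc : ContinuousOn A (ball p r))
    {ξ : E} (hξ : ‖ξ‖ < r) :
    ∃ z : ℝ → 𝔸, z 0 = 1 ∧ ∀ t ∈ Icc (0 : ℝ) 1, ‖z t - 1‖ ≤ 1 / 2 ∧
      HasDerivWithinAt z (z t * A (p + t • ξ) ξ) (Icc 0 1) t := by
  have hr : 0 < r := (norm_nonneg _).trans_lt hξ
  have hmem : ∀ t ∈ Icc (0 : ℝ) 1, p + t • ξ ∈ ball p r := fun t ht ↦ by
    rw [mem_ball_iff_norm, add_sub_cancel_left, norm_smul, Real.norm_of_nonneg ht.1]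
    nlinarith [ht.2, norm_nonneg ξ]
  have hfb : ∀ t ∈ Icc (0 : ℝ) 1, ‖A (p + t • ξ) ξ‖ ≤ M * r := fun t ht ↦
    ((A _).le_opNorm ξ).trans (mul_le_mul (hA _ (hmem t ht)) hξ.le (norm_nonneg _) hM)
  have hzb : ∀ z ∈ closedBall (1 : 𝔸) (1 / 2), ‖z‖ ≤ ‖(1 : 𝔸)‖ + 1 / 2 := fun z hz ↦ by
    have := norm_sub_norm_le z 1
    rw [mem_closedBall_iff_norm] at hz
    linarith
  have h1 : (0 : ℝ) ≤ ‖(1 : 𝔸)‖ := norm_nonneg _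
  have hPL : IsPicardLindelof (fun t (z : 𝔸) ↦ z * A (p + t • ξ) ξ)
      (⟨0, by simp⟩ : Icc (0 : ℝ) 1) 1 (1 / 2) 0 (1 / 2) (M * r).toNNReal := by
    constructor
    · intro t ht
      refine LipschitzOnWith.of_dist_le_mul fun x _ y _ ↦ ?_
      rw [dist_eq_norm, dist_eq_norm, ← sub_mul, mul_comm,
        Real.coe_toNNReal _ (by positivity)]
      exact (norm_mul_le _ _).trans (mul_comm (M * r) _ ▸
        mul_le_mul_of_nonneg_left (hfb t ht) (norm_nonneg _)) |>.trans (by rw [mul_comm])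
    · intro z _
      refine continuousOn_const.mul ?_
      refine ContinuousOn.clm_apply (hc.comp (by fun_prop) hmem) continuousOn_const
    · intro t ht z hz
      have hz' := hzb z (by simpa using hz)
      calc ‖z * A (p + t • ξ) ξ‖ ≤ ‖z‖ * ‖A (p + t • ξ) ξ‖ := norm_mul_le _ _
        _ ≤ (‖(1 : 𝔸)‖ + 1 / 2) * (M * r) :=
          mul_le_mul hz' (hfb t ht) (norm_nonneg _) (by positivity)
        _ ≤ _ := by simpa [mul_assoc] using hrM
    · simp
  -- Working with the fixed point itself, not just an existence statement, retains the bound `‖z -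
  -- 1‖ ≤ 1/2`.
  obtain ⟨α, hα⟩ := ODE.FunSpace.exists_isFixedPt_next hPL (mem_closedBall_self le_rfl)
  have hball : ∀ t, α.compProj t ∈ closedBall (1 : 𝔸) (1 / 2) := fun t ↦ by
    simpa using α.compProj_mem_closedBall hPL.mul_max_le (t := t)
  refine ⟨α.compProj, ?_, fun t ht ↦ ⟨mem_closedBall_iff_norm.1 (hball t), ?_⟩⟩
  · have := ODE.FunSpace.compProj_val (α := α) (t := ⟨0, by simp⟩)
    rw [← hα, ODE.FunSpace.next_apply₀] at this
    rwa [← hα]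
  apply ODE.hasDerivWithinAt_picard_Icc (t₀ := 0) (by simp) hPL.continuousOn_uncurry
    α.continuous_compProj.continuousOn
    (fun _ _ ↦ α.compProj_mem_closedBall hPL.mul_max_le) 1 ht |>.congr_of_mem _ ht
  intro t' ht'
  nth_rw 1 [← hα]
  rw [ODE.FunSpace.compProj_of_mem ht', ODE.FunSpace.next_apply]

/-- Here `a`, `k` stand for `A ξ`, `A k`, and `dξk` for `A'(ξ) k`, and so on. Flatness trades `A'(k)
ξ` for `A'(ξ) k` plus a commutator, which cancels every term of first order in the displacement. -/
lemma ray_remainder_eq (z a k a' k' dξk dkξ dkk x y ρ : 𝔸) (t : ℝ)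
    (hflat : dkξ - dξk + k * a - a * k = 0)
    (hx : x = a + k + t • dkξ + t • dkk + ρ)
    (ha' : a' = z * a) (hk' : k' = z * k) (hy : y = x - a) :
    (z + t • k') * x - a' - (k' + t • (a' * k + z * dξk)) =
      t • (z * dkk) + t • (k' * y) + z * ρ := by
  subst ha' hk' hy
  have h : dkξ = dξk - k * a + a * k := by
    rw [← sub_eq_zero, ← hflat]; abel
  have h2 : (z + t • (z * k)) * x = z * x + t • (z * k * a) + t • (z * k * (x - a)) := by
    rw [add_mul, smul_mul_assoc, add_assoc, ← smul_add, ← mul_add, add_sub_cancel]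
  rw [h2]
  have h3 : z * x = z * a + z * k + t • (z * (dξk - k * a + a * k)) + t • (z * dkk) + z * ρ := by
    rw [hx, h]; simp only [mul_add, mul_smul_comm]
  rw [h3]
  simp only [mul_add, mul_sub, smul_add, smul_sub, mul_assoc]
  abel

/-- Second order estimate for the solutions along two neighbouring rays of a flat system. -/
lemma ray_solutions_close {A : E → E →L[ℝ] 𝔸} {p : E} {r M C : ℝ}
    (hr1 : r ≤ 1) (hM : 0 ≤ M) (hA : ∀ x ∈ ball p r, ‖A x‖ ≤ M)
    (hA' : ∀ x ∈ ball p r, ‖fderiv ℝ A x‖ ≤ M)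
    (hd : ∀ x ∈ ball p r, DifferentiableAt ℝ A x) (hflat : ∀ x ∈ ball p r, FlatAt A x)
    (hL : ∀ x ∈ ball p r, ∀ y ∈ ball p r, ‖fderiv ℝ A x - fderiv ℝ A y‖ ≤ M * ‖x - y‖)
    {ξ k : E} (hξ : ‖ξ‖ < r) (hξk : ‖ξ + k‖ < r) {z₀ z₁ : ℝ → 𝔸} (h00 : z₀ 0 = z₁ 0)
    (hC : ∀ t ∈ Icc (0 : ℝ) 1, ‖z₀ t‖ ≤ C)
    (h0 : ∀ t ∈ Icc (0 : ℝ) 1, HasDerivWithinAt z₀ (z₀ t * A (p + t • ξ) ξ) (Icc 0 1) t)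
    (h1 : ∀ t ∈ Icc (0 : ℝ) 1,
      HasDerivWithinAt z₁ (z₁ t * A (p + t • (ξ + k)) (ξ + k)) (Icc 0 1) t) :
    ‖z₁ 1 - z₀ 1 - z₀ 1 * A (p + ξ) k‖ ≤
      C * (2 * M + 2 * M ^ 2) / (M + 1) * (Real.exp (M + 1) - 1) * ‖k‖ ^ 2 := by
  have hC0 : 0 ≤ C := (norm_nonneg _).trans (hC 0 (by simp))
  have hmem : ∀ η : E, ‖η‖ < r → ∀ t ∈ Icc (0 : ℝ) 1, p + t • η ∈ ball p r := fun η hη t ht ↦ by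
    rw [mem_ball_iff_norm, add_sub_cancel_left, norm_smul, Real.norm_of_nonneg ht.1]
    nlinarith [ht.2, norm_nonneg η]
  let A' := fderiv ℝ A
  let γ : ℝ → E := fun t ↦ p + t • ξ
  -- `t • (z₀ A k)` is the expected first variation of the ray solution; `D` is the error. It solves
  -- the same linear equation with a forcing term `R` that flatness makes quadratic in `k`.
  let D : ℝ → 𝔸 := fun t ↦ z₁ t - z₀ t - t • (z₀ t * A (γ t) k)
  let R : ℝ → 𝔸 := fun t ↦ (z₀ t + t • (z₀ t * A (γ t) k)) * A (p + t • (ξ + k)) (ξ + k)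
    - z₀ t * A (γ t) ξ
    - (z₀ t * A (γ t) k + t • (z₀ t * A (γ t) ξ * A (γ t) k + z₀ t * A' (γ t) ξ k))
  have hDderiv : ∀ t ∈ Icc (0 : ℝ) 1,
      HasDerivWithinAt D (D t * A (p + t • (ξ + k)) (ξ + k) + R t) (Icc 0 1) t := by
    intro t ht
    have hγ : HasDerivAt γ ξ t :=
      (((hasDerivAt_id t).smul_const ξ).const_add p).congr_deriv (one_smul _ _)
    have hAγ : HasDerivAt (fun t ↦ A (γ t)) (A' (γ t) ξ) t :=
      (hd _ (hmem ξ hξ t ht)).hasFDerivAt.comp_hasDerivAt t hγ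
    have hAk : HasDerivAt (fun t ↦ A (γ t) k) (A' (γ t) ξ k) t := by
      simpa using hAγ.clm_apply (hasDerivAt_const t k)
    have hz := (h0 t ht).mul hAk.hasDerivWithinAt
    have := ((h1 t ht).sub (h0 t ht)).sub ((hasDerivAt_id t).hasDerivWithinAt.smul hz)
    refine this.congr_deriv ?_
    simp only [D, R, id, one_smul, Pi.mul_apply, γ, sub_mul, add_mul]
    abel
  have hR : ∀ t ∈ Icc (0 : ℝ) 1, ‖R t‖ ≤ C * (2 * M + 2 * M ^ 2) * ‖k‖ ^ 2 := by
    intro t ht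
    have hγm := hmem ξ hξ t ht
    have hγm' := hmem _ hξk t ht
    have htk : ‖t • k‖ ≤ ‖k‖ := by
      rw [norm_smul, Real.norm_of_nonneg ht.1]
      nlinarith [ht.2, norm_nonneg k]
    have hsub : p + t • (ξ + k) - γ t = t • k := by simp [γ]
    have hseg : segment ℝ (γ t) (p + t • (ξ + k)) ⊆ ball p r :=
      (convex_ball p r).segment_subset hγm hγm'
    have hρ : ‖A (p + t • (ξ + k)) - A (γ t) - A' (γ t) (t • k)‖ ≤ M * ‖k‖ ^ 2 := by
      have := Convex.norm_image_sub_le_of_norm_hasFDerivWithin_le' (f := A) (f' := A')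
        (φ := A' (γ t)) (C := M * ‖k‖) (s := segment ℝ (γ t) (p + t • (ξ + k)))
        (fun x hx ↦ (hd x (hseg hx)).hasFDerivAt.hasFDerivWithinAt)
        (fun x hx ↦ (hL x (hseg hx) _ hγm).trans <| mul_le_mul_of_nonneg_left ?_ hM)
        (convex_segment _ _) (left_mem_segment _ _ _) (right_mem_segment _ _ _)
      · rw [hsub] at this
        refine this.trans ?_
        rw [pow_two, ← mul_assoc]
        gcongr
      · obtain ⟨s, hs, rfl⟩ := (segment_eq_image' ℝ (γ t) (p + t • (ξ + k))) ▸ hx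
        rw [add_sub_cancel_left, hsub, norm_smul, Real.norm_of_nonneg hs.1]
        nlinarith [hs.2, norm_nonneg (t • k)]
    have hdiff : ‖A (p + t • (ξ + k)) - A (γ t)‖ ≤ M * ‖k‖ := by
      have := (convex_ball p r).norm_image_sub_le_of_norm_fderiv_le hd hA' hγm hγm'
      rw [hsub] at this
      exact this.trans (by gcongr)
    set ρ := A (p + t • (ξ + k)) - A (γ t) - A' (γ t) (t • k) with hρdef
    have hx : A (p + t • (ξ + k)) = A (γ t) + t • A' (γ t) k + ρ := by
      rw [hρdef, map_smul]; abel
    have hRt : R t = t • (z₀ t * A' (γ t) k k) + t • (z₀ t * A (γ t) k *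
        (A (p + t • (ξ + k)) (ξ + k) - A (γ t) ξ)) + z₀ t * ρ (ξ + k) := by
      refine ray_remainder_eq (z₀ t) (A (γ t) ξ) (A (γ t) k) _ _ (A' (γ t) ξ k) (A' (γ t) k ξ)
        (A' (γ t) k k) _ _ (ρ (ξ + k)) t ?_ ?_ rfl rfl rfl
      · exact hflat _ hγm k ξ
      · rw [hx]
        simp only [add_apply, FunLike.coe_smul, Pi.smul_apply, map_add]
        abel
    have ht1 : ‖t‖ ≤ 1 := by rw [Real.norm_of_nonneg ht.1]; exact ht.2
    have e1 : ‖A' (γ t) k k‖ ≤ M * ‖k‖ * ‖k‖ :=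
      ((A' (γ t)).le_opNorm₂ k k).trans (by gcongr; exact hA' _ hγm)
    have e2 : ‖A (p + t • (ξ + k)) (ξ + k) - A (γ t) ξ‖ ≤ 2 * M * ‖k‖ := by
      have : A (p + t • (ξ + k)) (ξ + k) - A (γ t) ξ =
          (A (p + t • (ξ + k)) - A (γ t)) (ξ + k) + A (γ t) k := by
        rw [sub_apply, map_add (A (γ t))]; abel
      rw [this]
      have i1 := (A (p + t • (ξ + k)) - A (γ t)).le_opNorm (ξ + k)
      have i2 := (A (γ t)).le_opNorm k
      have i3 : ‖A (p + t • (ξ + k)) - A (γ t)‖ * ‖ξ + k‖ ≤ M * ‖k‖ * 1 :=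
        mul_le_mul hdiff (hξk.le.trans hr1) (norm_nonneg _) (by positivity)
      have i4 : ‖A (γ t)‖ * ‖k‖ ≤ M * ‖k‖ := by gcongr; exact hA _ hγm
      linarith [norm_add_le ((A (p + t • (ξ + k)) - A (γ t)) (ξ + k)) (A (γ t) k)]
    have e3 : ‖ρ (ξ + k)‖ ≤ M * ‖k‖ ^ 2 * 1 :=
      (ρ.le_opNorm _).trans (mul_le_mul hρ (hξk.le.trans hr1) (norm_nonneg _) (by positivity))
    have e4 : ‖A (γ t) k‖ ≤ M * ‖k‖ := ((A _).le_opNorm k).trans (by gcongr; exact hA _ hγm)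
    have e5 := hC t ht
    have f1 : ‖t • (z₀ t * A' (γ t) k k)‖ ≤ C * (M * ‖k‖ * ‖k‖) := by
      rw [norm_smul, ← one_mul (C * _)]
      refine mul_le_mul ht1 ((norm_mul_le _ _).trans ?_) (norm_nonneg _) zero_le_one
      gcongr
    have f2 : ‖t • (z₀ t * A (γ t) k * (A (p + t • (ξ + k)) (ξ + k) - A (γ t) ξ))‖ ≤
        C * (M * ‖k‖) * (2 * M * ‖k‖) := by
      rw [norm_smul, ← one_mul (C * _ * _)]
      refine mul_le_mul ht1 ((norm_mul_le _ _).trans ?_) (norm_nonneg _) zero_le_one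
      refine mul_le_mul ((norm_mul_le _ _).trans ?_) e2 (norm_nonneg _) (by positivity)
      gcongr
    have f3 : ‖z₀ t * ρ (ξ + k)‖ ≤ C * (M * ‖k‖ ^ 2 * 1) :=
      (norm_mul_le _ _).trans (by gcongr)
    rw [hRt]
    refine (norm_add₃_le).trans ((add_le_add_three f1 f2 f3).trans (le_of_eq ?_))
    ring
  -- The rate `M + 1` instead of `M` is nonzero, which selects the exponential form of the Grönwall
  -- bound.
  have hgron := norm_le_gronwallBound_of_norm_deriv_right_le (f := D)
    (f' := fun t ↦ D t * A (p + t • (ξ + k)) (ξ + k) + R t) (δ := 0) (K := M + 1)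
    (ε := C * (2 * M + 2 * M ^ 2) * ‖k‖ ^ 2) (a := 0) (b := 1)
    (fun t ht ↦ (hDderiv t ht).continuousWithinAt)
    (fun t ht ↦ (hDderiv t ⟨ht.1, ht.2.le⟩).mono_of_mem_nhdsWithin
      (mem_of_superset (Icc_mem_nhdsGE ht.2) (Icc_subset_Icc ht.1 le_rfl)))
    (by simp [D, h00])
    (fun t ht ↦ by
      have ht' : t ∈ Icc (0 : ℝ) 1 := ⟨ht.1, ht.2.le⟩
      refine (norm_add_le _ _).trans (add_le_add ?_ (hR t ht'))
      refine (norm_mul_le _ _).trans ?_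
      rw [mul_comm]
      refine mul_le_mul_of_nonneg_right ?_ (norm_nonneg _)
      refine ((A _).le_opNorm _).trans ?_
      have := mul_le_mul (hA _ (hmem _ hξk t ht')) (hξk.le.trans hr1) (norm_nonneg _) hM
      linarith) 1 (by simp)
  rw [gronwallBound_of_K_ne_0 (by positivity)] at hgron
  simp only [D, γ, one_smul, sub_zero, mul_one, zero_mul, zero_add] at hgron
  refine hgron.trans (le_of_eq ?_)
  ring

/-- The value at `x` is the time-one value of the solution along the ray from `p` to `x`. The second
order estimate identifies its differential, and being within `1/2` of `1` makes it a unit by the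
Neumann series. `C²` regularity supplies the Lipschitz bound on the derivative of `A`. -/
lemma exists_local_solution [CompleteSpace 𝔸] {A : E → E →L[ℝ] 𝔸} {p : E}
    (hA : ContDiffAt ℝ 2 A p) (hflat : ∀ᶠ x in 𝓝 p, FlatAt A x) :
    ∃ r > 0, ∃ Φ : E → 𝔸, ∀ x ∈ ball p r, SolvesAt A Φ x ∧ IsUnit (Φ x) := by
  have hA1 : ContDiffAt ℝ 1 (fderiv ℝ A) p := hA.fderiv_right (by norm_num)
  obtain ⟨L, s, hs, hL⟩ := hA1.exists_lipschitzOnWith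
  have b1 : ∀ᶠ x in 𝓝 p, ‖A x‖ < ‖A p‖ + 1 :=
    hA.continuousAt.norm.eventually_lt continuousAt_const (lt_add_one _)
  have b2 : ∀ᶠ x in 𝓝 p, ‖fderiv ℝ A x‖ < ‖fderiv ℝ A p‖ + 1 := by
    have hc : ContinuousAt (fderiv ℝ A) p := hA1.continuousAt
    exact (ContinuousAt.norm (E := E →L[ℝ] E →L[ℝ] 𝔸) hc).eventually_lt continuousAt_const
      (lt_add_one _)
  have b3 : ∀ᶠ x in 𝓝 p, DifferentiableAt ℝ A x :=
    (hA.eventually (by norm_cast)).mono fun x hx ↦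
      hx.differentiableAt (by norm_num)
  obtain ⟨r₀, hr₀, hball⟩ := Metric.eventually_nhds_iff_ball.1
    (b1.and (b2.and (b3.and (hflat.and (eventually_mem_set.2 hs)))))
  set M : ℝ := ‖A p‖ + 1 + (‖fderiv ℝ A p‖ + 1) + L with hMdef
  have hM : 0 ≤ M := by positivity
  set N : ℝ := (‖(1 : 𝔸)‖ + 1 / 2) * M with hN
  have hN0 : 0 ≤ N := by positivity
  set r := min r₀ (min 1 (1 / (2 * (N + 1)))) with hrdef
  have hr : 0 < r := by positivity
  have hr1 : r ≤ 1 := (min_le_right _ _).trans (min_le_left _ _)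
  have hrN : N * r ≤ 1 / 2 := by
    have : r ≤ 1 / (2 * (N + 1)) := (min_le_right _ _).trans (min_le_right _ _)
    rw [le_div_iff₀ (by positivity)] at this
    nlinarith
  have hsub : ball p r ⊆ ball p r₀ := ball_subset_ball (min_le_left _ _)
  have hL0 : (0 : ℝ) ≤ L := L.2
  have hAM : ∀ x ∈ ball p r, ‖A x‖ ≤ M := fun x hx ↦ by
    have := (hball x (hsub hx)).1; rw [hMdef]; linarith [norm_nonneg (fderiv ℝ A p)]
  have hA'M : ∀ x ∈ ball p r, ‖fderiv ℝ A x‖ ≤ M := fun x hx ↦ by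
    have := (hball x (hsub hx)).2.1; rw [hMdef]; linarith [norm_nonneg (A p)]
  have hd : ∀ x ∈ ball p r, DifferentiableAt ℝ A x := fun x hx ↦ (hball x (hsub hx)).2.2.1
  have hfl : ∀ x ∈ ball p r, FlatAt A x := fun x hx ↦ (hball x (hsub hx)).2.2.2.1
  have hLM : ∀ x ∈ ball p r, ∀ y ∈ ball p r,
      ‖fderiv ℝ A x - fderiv ℝ A y‖ ≤ M * ‖x - y‖ := fun x hx y hy ↦ by
    have := hL.dist_le_mul x (hball x (hsub hx)).2.2.2.2 y (hball y (hsub hy)).2.2.2.2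
    rw [dist_eq_norm, dist_eq_norm] at this
    refine this.trans ?_
    gcongr
    rw [hMdef]; linarith [norm_nonneg (A p), norm_nonneg (fderiv ℝ A p)]
  have hc : ContinuousOn A (ball p r) := fun x hx ↦ (hd x hx).continuousAt.continuousWithinAt
  have hray : ∀ ξ : E, ∃ z : ℝ → 𝔸, ‖ξ‖ < r → z 0 = 1 ∧ ∀ t ∈ Icc (0 : ℝ) 1,
      ‖z t - 1‖ ≤ 1 / 2 ∧ HasDerivWithinAt z (z t * A (p + t • ξ) ξ) (Icc 0 1) t := fun ξ ↦ by
    by_cases hξ : ‖ξ‖ < r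
    · obtain ⟨z, hz⟩ := exists_ray_solution hM hrN hAM hc hξ
      exact ⟨z, fun _ ↦ hz⟩
    · exact ⟨0, fun h ↦ absurd h hξ⟩
  choose z hz using hray
  refine ⟨r, hr, fun x ↦ z (x - p) 1, fun x hx ↦ ⟨?_, ?_⟩⟩
  · have hξ : ‖x - p‖ < r := mem_ball_iff_norm.1 hx
    obtain ⟨C, hCdef⟩ : ∃ C, C = ‖(1 : 𝔸)‖ + 1 / 2 := ⟨_, rfl⟩
    have hC : ∀ t ∈ Icc (0 : ℝ) 1, ‖z (x - p) t‖ ≤ C := fun t ht ↦ by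
      linarith [norm_sub_norm_le (z (x - p) t) 1, ((hz _ hξ).2 t ht).1]
    rw [SolvesAt, hasFDerivAt_iff_isLittleO_nhds_zero]
    refine Asymptotics.IsBigO.trans_isLittleO (g := fun k : E ↦ ‖k‖ ^ 2) ?_
      (by simpa using Asymptotics.isLittleO_norm_pow_id (one_lt_two))
    refine Asymptotics.IsBigO.of_bound
      (C * (2 * M + 2 * M ^ 2) / (M + 1) * (Real.exp (M + 1) - 1)) ?_
    have hev : ∀ᶠ k in 𝓝 (0 : E), ‖x - p + k‖ < r := by
      have : ContinuousAt (fun k : E ↦ ‖x - p + k‖) 0 := by fun_prop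
      exact this.eventually_lt continuousAt_const (by simpa using hξ)
    filter_upwards [hev] with k hk
    have := ray_solutions_close hr1 hM hAM hA'M hd hfl hLM hξ hk
      ((hz _ hξ).1.trans (hz _ hk).1.symm) hC (fun t ht ↦ ((hz _ hξ).2 t ht).2)
      (fun t ht ↦ ((hz _ hk).2 t ht).2)
    rw [add_sub_right_comm, norm_pow, norm_norm]
    simpa using this
  · have := ((hz _ (mem_ball_iff_norm.1 hx)).2 1 (by simp)).1
    have hlt : ‖1 - z (x - p) 1‖ < 1 := by rw [norm_sub_rev]; linarith
    simpa using (Units.oneSub _ hlt).isUnit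

lemma SolvesAt.const_mul {A : E → E →L[ℝ] 𝔸} {Z : E → 𝔸} {x : E} (h : SolvesAt A Z x) (c : 𝔸) :
    SolvesAt A (fun y ↦ c * Z y) x := by
  refine (HasFDerivAt.const_mul h c).congr_fderiv ?_
  ext v
  simp [mul_assoc]

/-- The quotient of two solutions is locally constant. -/
lemma fderiv_mul_inverse_eq_zero [CompleteSpace 𝔸] {A : E → E →L[ℝ] 𝔸} {Z Y : E → 𝔸} {x : E}
    (hZ : SolvesAt A Z x) (hY : SolvesAt A Y x) (hu : IsUnit (Y x)) :
    HasFDerivAt (fun y ↦ Z y * Ring.inverse (Y y)) (0 : E →L[ℝ] 𝔸) x := by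
  obtain ⟨u, hu⟩ := hu
  have h1 : HasFDerivAt (fun y ↦ Ring.inverse (Y y)) _ x :=
    (hu ▸ hasFDerivAt_ringInverse (𝕜 := ℝ) u : HasFDerivAt Ring.inverse _ (Y x)).comp x hY
  refine (HasFDerivAt.mul' hZ h1).congr_fderiv ?_
  ext v
  simp [← hu, mul_assoc]

/-- The type `F` with the discrete topology. -/
structure DiscreteFiber (F : Type*) where
  /-- The underlying element. -/
  val : F

instance (F : Type*) : TopologicalSpace (DiscreteFiber F) := ⊥

instance (F : Type*) : DiscreteTopology (DiscreteFiber F) := ⟨rfl⟩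

/-- The bundle of germs of solutions of a linear total differential system, given local
fundamental solutions `Φ p` on the balls `ball p (r p)`. -/
noncomputable def solutionBundle [CompleteSpace 𝔸] {A : E → E →L[ℝ] 𝔸} {U : Set E} {r : U → ℝ}
    (hr : ∀ p, 0 < r p) {Φ : U → E → 𝔸}
    (hΦ : ∀ p : U, ∀ x ∈ ball (p : E) (r p), SolvesAt A (Φ p) x ∧ IsUnit (Φ p x)) :
    FiberBundleCore U U (DiscreteFiber 𝔸) where
  baseSet p := Subtype.val ⁻¹' ball (p : E) (r p)
  isOpen_baseSet p := isOpen_ball.preimage continuous_subtype_val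
  indexAt := id
  mem_baseSet_at p := mem_ball_self (hr p)
  -- The coordinate `c` at `p` denotes the germ `c Φ_p`; rewriting it as a multiple of `Φ_q` gives
  -- this factor, which is constant on the convex intersection of the two balls. This makes the
  -- change continuous for the discrete topology on the fiber.
  coordChange p q x c := ⟨c.val * (Φ p x * Ring.inverse (Φ q x))⟩
  coordChange_self p x hx c := by
    have := (hΦ p x hx).2
    rw [Ring.mul_inverse_cancel _ this, mul_one]
  continuousOn_coordChange p q := by
    have hd : ∀ x ∈ ball (p : E) (r p) ∩ ball (q : E) (r q),
        HasFDerivAt (fun y ↦ Φ p y * Ring.inverse (Φ q y)) (0 : E →L[ℝ] 𝔸) x := fun x hx ↦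
      fderiv_mul_inverse_eq_zero (hΦ p x hx.1).1 (hΦ q x hx.2).1 (hΦ q x hx.2).2
    obtain ⟨K, hK⟩ := (isOpen_ball.inter isOpen_ball).exists_is_const_of_fderiv_eq_zero
      ((convex_ball (p : E) (r p)).inter (convex_ball (q : E) (r q))).isPreconnected
      (fun x hx ↦ (hd x hx).differentiableAt.differentiableWithinAt)
      (fun x hx ↦ (hd x hx).fderiv)
    have hcont : Continuous (fun c : DiscreteFiber 𝔸 ↦ (⟨c.val * K⟩ : DiscreteFiber 𝔸)) :=
      continuous_of_discreteTopology
    refine (hcont.comp continuous_snd).continuousOn.congr fun x hx ↦ ?_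
    simp only [Function.comp_apply, hK x.1 hx.1]
  coordChange_comp p q s x hx c := by
    have := (hΦ q x hx.1.2).2
    rw [mul_assoc, mul_assoc (Φ p x), Ring.inverse_mul_cancel_left _ _ this]

/-- **Frobenius theorem** for flat linear systems on simply connected open sets. -/
theorem exists_solution_of_flat [CompleteSpace 𝔸] {A : E → E →L[ℝ] 𝔸} {U : Set E}
    (hU : IsOpen U) (hsc : IsSimplyConnected U) (hA : ContDiffOn ℝ 2 A U)
    (hflat : ∀ x ∈ U, FlatAt A x) {x₀ : E} (hx₀ : x₀ ∈ U) (Z₀ : 𝔸) :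
    ∃ Z : E → 𝔸, Z x₀ = Z₀ ∧ ∀ x ∈ U, SolvesAt A Z x := by
  have hloc : ∀ p : U, ∃ r > 0, ∃ Φ : E → 𝔸,
      ∀ x ∈ ball (p : E) r, SolvesAt A Φ x ∧ IsUnit (Φ x) := fun p ↦
    exists_local_solution (hA.contDiffAt (hU.mem_nhds p.2))
      (eventually_of_mem (hU.mem_nhds p.2) hflat)
  choose r hr Φ hΦ using hloc
  have := hsc.simplyConnectedSpace
  have := hU.locallyPathConnectedSpace
  let B := solutionBundle hr hΦ
  have hunit : ∀ p : U, IsUnit (Φ p p) := fun p ↦ (hΦ p p (mem_ball_self (hr p))).2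
  have hcov : IsCoveringMap (Bundle.TotalSpace.proj : B.TotalSpace → U) :=
    IsFiberBundle.isCoveringMap fun x ↦ ⟨B.localTriv x, B.mem_baseSet_at x⟩
  -- A bundle with discrete fiber is a covering, so over a simply connected base the identity lifts
  -- through the prescribed initial germ: this section is the global solution.
  obtain ⟨s, ⟨hs0, hs⟩, -⟩ := hcov.existsUnique_continuousMap_lifts (ContinuousMap.id U)
    ⟨x₀, hx₀⟩ ⟨⟨x₀, hx₀⟩, DiscreteFiber.mk (Z₀ * Ring.inverse (Φ ⟨x₀, hx₀⟩ x₀))⟩ rfl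
  have hsp : ∀ x, (s x).proj = x := fun x ↦ congrFun hs x
  let val : B.TotalSpace → 𝔸 := fun q ↦ DiscreteFiber.val q.2 * Φ q.1 q.1
  classical
  let Z : E → 𝔸 := fun x ↦ if hx : x ∈ U then val (s ⟨x, hx⟩) else 0
  refine ⟨Z, ?_, fun p hp ↦ ?_⟩
  · have hval : Z x₀ = val (s ⟨x₀, hx₀⟩) := dif_pos hx₀
    rw [hval, hs0]
    exact Ring.inverse_mul_cancel_right _ _ (hunit ⟨x₀, hx₀⟩)
  let P : U := ⟨p, hp⟩
  have hPs : s P ∈ (B.localTriv P).source := by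
    rw [FiberBundleCore.mem_localTriv_source, hsp]
    exact B.mem_baseSet_at P
  -- Continuity into a discrete fiber means that the coordinate is locally constant, so near `P` the
  -- section is a constant multiple of `Φ P`.
  let c : U → DiscreteFiber 𝔸 := fun x ↦ (B.localTriv P (s x)).2
  have hc : ContinuousAt c P := continuous_snd.continuousAt.comp
    (((B.localTriv P).continuousAt hPs).comp s.continuous.continuousAt)
  have hev : ∀ᶠ x in 𝓝 P, c x = c P :=
    hc (show {y | y = c P} ∈ 𝓝 (c P) by rw [nhds_discrete]; exact mem_pure.2 rfl)
  have hev2 : ∀ᶠ x : U in 𝓝 P, Z x = (c P).val * Φ P x := by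
    filter_upwards [hev, (B.isOpen_baseSet P).mem_nhds (B.mem_baseSet_at P)] with x hx hxb
    rw [← hx]
    have hval : Z x = val (s x) := by simp [Z]
    rw [hval]
    have hproj : (s x).1 = x := hsp x
    have hcx : (c x).val = DiscreteFiber.val (s x).2 * (Φ (s x).1 ((s x).1 : E) *
        Ring.inverse (Φ P ((s x).1 : E))) := rfl
    rw [hcx]
    simp only [val]
    rw [hproj, ← mul_assoc, Ring.inverse_mul_cancel_right _ _ (hΦ P x hxb).2]
  have hev3 : ∀ᶠ x in 𝓝 p, Z x = (c P).val * Φ P x := by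
    rw [← map_nhds_subtype_coe_eq_nhds hp (hU.mem_nhds hp)]
    exact hev2
  have hsol := (hΦ P p (mem_ball_self (hr P))).1.const_mul (c P).val
  have := HasFDerivAt.congr_of_eventuallyEq hsol hev3
  rw [SolvesAt, hev3.self_of_nhds]
  exact this

end FlatSystem

namespace PrestrainedPlate

/-! ### Mollification and integration by parts for weak derivatives -/

section Mollify

open Filter Topology ContinuousLinearMap

/-- `φ` is a test function on `Ω`. -/
structure IsTest (Ω : Set Plane) (φ : Plane → ℝ) : Prop where
  contDiff : ContDiff ℝ ∞ φ
  hasCompactSupport : HasCompactSupport φ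
  tsupport_subset : tsupport φ ⊆ Ω

/-- Convolution with the normalized bump function `η`. -/
noncomputable def mollify (η : ContDiffBump (0 : Plane)) (f : Plane → ℝ) : Plane → ℝ :=
  convolution (η.normed volume) f (lsmul ℝ ℝ) volume

lemma mollify_apply (η : ContDiffBump (0 : Plane)) (f : Plane → ℝ) (x : Plane) :
    mollify η f x = ∫ t, η.normed volume (x - t) * f t := by
  rw [mollify, convolution_eq_swap]; rfl

lemma abs_mollify_le (η : ContDiffBump (0 : Plane)) {f : Plane → ℝ} {C : ℝ}
    (hC : ∀ᵐ x, |f x| ≤ C) (x : Plane) : |mollify η f x| ≤ C := by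
  rw [mollify_apply, ← Real.norm_eq_abs]
  have hint : Integrable (fun t ↦ η.normed volume (x - t) * C) :=
    ((η.integrable_normed (μ := volume)).comp_sub_left x).mul_const C
  refine (norm_integral_le_of_norm_le hint ?_).trans (le_of_eq ?_)
  · filter_upwards [hC] with t ht
    rw [norm_mul, Real.norm_of_nonneg (η.nonneg_normed _)]
    exact mul_le_mul_of_nonneg_left ht (η.nonneg_normed _)
  · rw [integral_mul_const, integral_sub_left_eq_self (fun t ↦ η.normed volume t) volume x,
      η.integral_normed, one_mul]

/-- Fubini, together with the evenness of the bump. -/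
lemma integral_mul_mollify (η : ContDiffBump (0 : Plane)) {f g : Plane → ℝ}
    (hf : Integrable f) (hg : Integrable g) :
    ∫ x, f x * mollify η g x = ∫ x, mollify η f x * g x := by
  have hint : Integrable (Function.uncurry fun x t ↦ f x * (η.normed volume (x - t) * g t))
      (volume.prod volume) := by
    obtain ⟨C, hC⟩ := (η.continuous_normed (μ := volume)).bounded_above_of_compact_support
      η.hasCompactSupport_normed
    refine ((hf.mul_prod hg).bdd_mul (f := fun z : Plane × Plane ↦ η.normed volume (z.1 - z.2))
      (c := C) ?_ (Eventually.of_forall fun z ↦ hC _)).congr (Eventually.of_forall fun z ↦ ?_)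
    · exact (η.continuous_normed.comp (continuous_fst.sub continuous_snd)).aestronglyMeasurable
    · simp only [Function.uncurry]; ring
  calc ∫ x, f x * mollify η g x = ∫ x, ∫ t, f x * (η.normed volume (x - t) * g t) := by
        simp_rw [mollify_apply, integral_const_mul]
    _ = ∫ t, ∫ x, f x * (η.normed volume (x - t) * g t) := integral_integral_swap hint
    _ = ∫ t, mollify η f t * g t := by
        refine integral_congr_ae (Eventually.of_forall fun t ↦ ?_)
        simp only
        rw [mollify_apply, ← integral_mul_const]
        refine integral_congr_ae (Eventually.of_forall fun x ↦ ?_)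
        simp only
        rw [← η.normed_neg (t - x), neg_sub]
        ring

/-- `g` is the weak derivative of `f` in direction `v` in the whole plane. -/
def IsGlobalWeakDeriv (v : Plane) (f g : Plane → ℝ) : Prop :=
  ∀ ψ : Plane → ℝ, ContDiff ℝ ∞ ψ → HasCompactSupport ψ →
    ∫ x, f x * fderiv ℝ ψ x v = -∫ x, g x * ψ x

lemma contDiff_mollify (η : ContDiffBump (0 : Plane)) {f : Plane → ℝ} (hf : Integrable f) :
    ContDiff ℝ ∞ (mollify η f) :=
  η.hasCompactSupport_normed.contDiff_convolution_left _ η.contDiff_normed hf.locallyIntegrable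

/-- The reflected and translated bump `t ↦ η (x - t)` is itself an admissible test function. -/
lemma fderiv_mollify (η : ContDiffBump (0 : Plane)) {f g : Plane → ℝ} {v : Plane}
    (hf : Integrable f) (h : IsGlobalWeakDeriv v f g) (x : Plane) :
    fderiv ℝ (mollify η f) x v = mollify η g x := by
  have hd := (η.hasCompactSupport_normed (μ := volume)).hasFDerivAt_convolution_left
    (lsmul ℝ ℝ) (η.contDiff_normed (n := 1)) hf.locallyIntegrable x
  have h1 := h (fun t ↦ η.normed volume (x - t))
    (η.contDiff_normed.comp (contDiff_const.sub contDiff_id))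
    ((η.hasCompactSupport_normed (μ := volume)).comp_homeomorph (Homeomorph.subLeft x))
  have h2 : ∀ t, fderiv ℝ (fun t ↦ η.normed volume (x - t)) t v =
      -fderiv ℝ (η.normed volume) (x - t) v := fun t ↦ by
    have a1 : HasFDerivAt (η.normed volume) (fderiv ℝ (η.normed volume) (x - t)) (x - t) :=
      ((η.contDiff_normed (n := 1)).differentiable (by norm_num) _).hasFDerivAt
    have a2 : HasFDerivAt (fun t : Plane ↦ x - t) (-ContinuousLinearMap.id ℝ Plane) t :=
      (hasFDerivAt_id t).const_sub x
    have := (a1.comp t a2).fderiv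
    simp only [Function.comp_def] at this
    rw [this]; simp
  rw [mollify, hd.fderiv, convolution_eq_swap, mollify_apply]
  have hint : Integrable fun t ↦ (lsmul ℝ ℝ).precompL Plane
      (fderiv ℝ (η.normed volume) (x - t)) (f t) := by
    have hc : Continuous (fderiv ℝ (η.normed volume)) :=
      (η.contDiff_normed (n := 1)).continuous_fderiv one_ne_zero
    have := (((η.hasCompactSupport_normed (μ := volume)).fderiv ℝ).convolutionExists_left
      ((lsmul ℝ ℝ).precompL Plane) hc hf.locallyIntegrable x)
    exact this.integrable_swap
  rw [ContinuousLinearMap.integral_apply hint]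
  simp only [h2, mul_neg, integral_neg, neg_inj] at h1
  simp_rw [mul_comm (η.normed volume _), ← h1]
  refine integral_congr_ae (Eventually.of_forall fun t ↦ ?_)
  simp [precompL_apply, mul_comm]

/-- The derivative of `F` is tested against a mollification of `F₁`, and the mollifier is then moved
onto `F`. The sup bounds survive mollification, so dominated convergence applies although `H` and
`H₁` are merely integrable. -/
lemma integral_mul_add_mul_eq_zero {F H F₁ H₁ : Plane → ℝ} {v : Plane} {C C₁ : ℝ}
    (hF : Integrable F) (hH : Integrable H) (hF₁ : Integrable F₁) (hH₁ : Integrable H₁)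
    (hsupp : HasCompactSupport F₁) (hC : ∀ᵐ x, |F x| ≤ C) (hC₁ : ∀ᵐ x, |F₁ x| ≤ C₁)
    (hw : IsGlobalWeakDeriv v F H) (hw₁ : IsGlobalWeakDeriv v F₁ H₁) :
    ∫ x, F x * H₁ x + H x * F₁ x = 0 := by
  -- A bounded ratio of outer to inner radius is what gives convergence at almost every point.
  let η : ℕ → ContDiffBump (0 : Plane) := fun n ↦
    { rIn := 1 / (n + 1), rOut := 2 * (1 / (n + 1)), rIn_pos := by positivity,
      rIn_lt_rOut := by
        have : (0 : ℝ) < 1 / (n + 1) := by positivity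
        linarith }
  have hη : Tendsto (fun n ↦ (η n).rOut) atTop (𝓝 0) := by
    have := (tendsto_one_div_add_atTop_nhds_zero_nat (𝕜 := ℝ)).const_mul (2 : ℝ)
    rwa [mul_zero] at this
  have hη' : ∀ᶠ n in atTop, (η n).rOut ≤ 2 * (η n).rIn := Eventually.of_forall fun n ↦ le_rfl
  have hconv : ∀ {f : Plane → ℝ}, Integrable f → ∀ᵐ x,
      Tendsto (fun n ↦ mollify (η n) f x) atTop (𝓝 (f x)) := fun hf ↦
    ContDiffBump.ae_convolution_tendsto_right_of_locallyIntegrable hη hη' hf.locallyIntegrable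
  have hmeas : ∀ {f : Plane → ℝ}, Integrable f → ∀ n,
      AEStronglyMeasurable (mollify (η n) f) := fun hf n ↦
    (contDiff_mollify _ hf).continuous.aestronglyMeasurable
  have hident : ∀ n, ∫ x, mollify (η n) F x * H₁ x = -∫ x, H x * mollify (η n) F₁ x := fun n ↦ by
    have := hw (mollify (η n) F₁) (contDiff_mollify _ hF₁)
      (HasCompactSupport.convolution _ (η n).hasCompactSupport_normed hsupp)
    rw [← this, ← integral_mul_mollify _ hF hH₁]
    simp_rw [fderiv_mollify _ hF₁ hw₁]
  have l1 : Tendsto (fun n ↦ ∫ x, mollify (η n) F x * H₁ x) atTop (𝓝 (∫ x, F x * H₁ x)) := by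
    refine tendsto_integral_of_dominated_convergence (fun x ↦ C * |H₁ x|)
      (fun n ↦ (hmeas hF n).mul hH₁.1) (hH₁.abs.const_mul C)
      (fun n ↦ Eventually.of_forall fun x ↦ ?_) ?_
    · rw [norm_mul]
      exact mul_le_mul_of_nonneg_right (abs_mollify_le _ hC x) (norm_nonneg _)
    · filter_upwards [hconv hF] with x hx using hx.mul_const _
  have l2 : Tendsto (fun n ↦ ∫ x, H x * mollify (η n) F₁ x) atTop (𝓝 (∫ x, H x * F₁ x)) := by
    refine tendsto_integral_of_dominated_convergence (fun x ↦ |H x| * C₁)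
      (fun n ↦ hH.1.mul (hmeas hF₁ n)) (hH.abs.mul_const C₁)
      (fun n ↦ Eventually.of_forall fun x ↦ ?_) ?_
    · rw [norm_mul]
      exact mul_le_mul_of_nonneg_left (abs_mollify_le _ hC₁ x) (norm_nonneg _)
    · filter_upwards [hconv hF₁] with x hx using hx.const_mul _
  have := tendsto_nhds_unique l1 ((l2.neg).congr fun n ↦ (hident n).symm)
  rw [integral_add, this, neg_add_cancel]
  · exact hH₁.bdd_mul hF.1 hC
  · exact hH.mul_bdd hF₁.1 hC₁

end Mollify

/-! ### Calculus of weak partial derivatives and of bounded `W^{1,2}` functions -/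

section WeakPartial

open Filter Topology

variable {Ω : Set Plane} {i j : Fin 2} {f g f₁ g₁ φ : Plane → ℝ}

lemma integrable_mul_of_tsupport_subset (hf : LocallyIntegrableOn f Ω) (hφ : Continuous φ)
    (hc : HasCompactSupport φ) (hs : tsupport φ ⊆ Ω) : Integrable fun x ↦ f x * φ x := by
  have h1 : IntegrableOn f (tsupport φ) := hf.integrableOn_compact_subset hs hc
  have h2 : IntegrableOn (fun x ↦ f x * φ x) (tsupport φ) :=
    h1.mul_continuousOn hφ.continuousOn hc
  refine (integrableOn_iff_integrable_of_support_subset fun x hx ↦ ?_).1 h2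
  exact subset_tsupport _ (right_ne_zero_of_mul hx)

lemma setIntegral_mul_of_tsupport_subset (hs : tsupport φ ⊆ Ω) :
    ∫ x in Ω, f x * φ x = ∫ x, f x * φ x :=
  setIntegral_eq_integral_of_forall_compl_eq_zero fun x hx ↦ by
    rw [image_eq_zero_of_notMem_tsupport fun h ↦ hx (hs h), mul_zero]

lemma IsTest.continuous (h : IsTest Ω φ) : Continuous φ := h.contDiff.continuous

lemma IsTest.partial (h : IsTest Ω φ) (v : Plane) : IsTest Ω fun x ↦ fderiv ℝ φ x v where
  contDiff := (h.contDiff.fderiv_right (m := ∞) (by simp)).clm_apply contDiff_const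
  hasCompactSupport := h.hasCompactSupport.fderiv_apply ℝ v
  tsupport_subset := (tsupport_fderiv_apply_subset ℝ v).trans h.tsupport_subset

lemma IsTest.mul_contDiff (h : IsTest Ω φ) {ψ : Plane → ℝ} (hψ : ContDiff ℝ ∞ ψ) :
    IsTest Ω fun x ↦ φ x * ψ x where
  contDiff := h.contDiff.mul hψ
  hasCompactSupport := h.hasCompactSupport.mul_right
  tsupport_subset := (tsupport_mul_subset_left).trans h.tsupport_subset

lemma IsTest.integrable (h : IsTest Ω φ) (hf : LocallyIntegrableOn f Ω) :
    Integrable fun x ↦ f x * φ x :=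
  integrable_mul_of_tsupport_subset hf h.continuous h.hasCompactSupport h.tsupport_subset

lemma isWeakPartial_iff : IsWeakPartial Ω i f g ↔ LocallyIntegrableOn f Ω ∧
    LocallyIntegrableOn g Ω ∧ ∀ φ, IsTest Ω φ →
      ∫ x, f x * fderiv ℝ φ x (e i) = -∫ x, g x * φ x := by
  refine and_congr_right fun _ ↦ and_congr_right fun _ ↦
    ⟨fun h φ hφ ↦ ?_, fun h φ h1 h2 h3 ↦ ?_⟩
  · rw [← setIntegral_mul_of_tsupport_subset hφ.tsupport_subset,
      ← setIntegral_mul_of_tsupport_subset (hφ.partial (e i)).tsupport_subset]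
    exact h φ hφ.1 hφ.2 hφ.3
  · have hφ : IsTest Ω φ := ⟨h1, h2, h3⟩
    rw [setIntegral_mul_of_tsupport_subset hφ.tsupport_subset,
      setIntegral_mul_of_tsupport_subset (hφ.partial (e i)).tsupport_subset]
    exact h φ hφ

lemma IsWeakPartial.integral_eq (h : IsWeakPartial Ω i f g) (hφ : IsTest Ω φ) :
    ∫ x, f x * fderiv ℝ φ x (e i) = -∫ x, g x * φ x :=
  (isWeakPartial_iff.1 h).2.2 φ hφ

/-- A weakly differentiable function times a test function. -/
lemma IsWeakPartial.isGlobalWeakDeriv_mul (h : IsWeakPartial Ω i f g) (hφ : IsTest Ω φ) :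
    IsGlobalWeakDeriv (e i) (fun x ↦ f x * φ x)
      (fun x ↦ g x * φ x + f x * fderiv ℝ φ x (e i)) := by
  intro ψ hψ _
  have h1 := h.integral_eq (hφ.mul_contDiff hψ)
  have h2 : ∀ x, fderiv ℝ (fun x ↦ φ x * ψ x) x (e i) =
      φ x * fderiv ℝ ψ x (e i) + fderiv ℝ φ x (e i) * ψ x := fun x ↦ by
    rw [fderiv_fun_mul (hφ.contDiff.differentiable (by simp) x)
      (hψ.differentiable (by simp) x)]
    simp [mul_comm]
  have i1 : Integrable fun x ↦ f x * φ x * fderiv ℝ ψ x (e i) := by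
    simpa [mul_assoc] using (hφ.mul_contDiff (ψ := fun x ↦ fderiv ℝ ψ x (e i))
      ((hψ.fderiv_right (m := ∞) (by simp)).clm_apply contDiff_const)).integrable h.1
  have i2 : Integrable fun x ↦ f x * fderiv ℝ φ x (e i) * ψ x := by
    simpa [mul_assoc] using ((hφ.partial (e i)).mul_contDiff hψ).integrable h.1
  have i3 : Integrable fun x ↦ g x * φ x * ψ x := by
    simpa [mul_assoc] using (hφ.mul_contDiff hψ).integrable h.2.1
  simp only [h2, mul_add, ← mul_assoc] at h1
  rw [integral_add i1 i2] at h1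
  simp only [add_mul]
  rw [integral_add i3 i2]
  linarith

/-- Local essential boundedness. -/
def LocBdd (Ω : Set Plane) (f : Plane → ℝ) : Prop :=
  ∀ K ⊆ Ω, IsCompact K → ∃ C, ∀ᵐ x ∂volume.restrict K, |f x| ≤ C

lemma exists_cutoff (hΩ : IsOpen Ω) {K : Set Plane} (hK : IsCompact K) (hKΩ : K ⊆ Ω) :
    ∃ χ, IsTest Ω χ ∧ ∀ x ∈ K, χ x = 1 := by
  obtain ⟨L, hL, hKL, hLΩ⟩ := exists_compact_between hK hΩ hKΩ
  obtain ⟨χ, hχ, -, hsupp, hone⟩ := exists_contMDiff_support_eq_eq_one_iff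
    (modelWithCornersSelf ℝ Plane) isOpen_interior hK.isClosed hKL (n := (⊤ : ℕ∞))
  have hts : tsupport χ ⊆ L := closure_minimal (hsupp.trans_subset interior_subset) hL.isClosed
  exact ⟨χ, ⟨hχ.contDiff, hL.of_isClosed_subset (isClosed_tsupport χ) hts, hts.trans hLΩ⟩,
    fun x hx ↦ (hone x).1 hx⟩

lemma LocBdd.exists_bound_mul_test (hf : LocBdd Ω f) (hφ : IsTest Ω φ) :
    ∃ C, ∀ᵐ x, |f x * φ x| ≤ C := by
  obtain ⟨C, hC⟩ := hf _ hφ.tsupport_subset hφ.hasCompactSupport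
  obtain ⟨D, hD⟩ := hφ.continuous.bounded_above_of_compact_support hφ.hasCompactSupport
  refine ⟨|C| * D, ?_⟩
  filter_upwards [(ae_restrict_iff' (isClosed_tsupport φ).measurableSet).1 hC] with x hx
  by_cases hxs : x ∈ tsupport φ
  · rw [abs_mul]
    exact mul_le_mul ((hx hxs).trans (le_abs_self C)) (hD x) (abs_nonneg _) (abs_nonneg _)
  · rw [image_eq_zero_of_notMem_tsupport hxs, mul_zero, abs_zero]
    exact mul_nonneg (abs_nonneg _) ((norm_nonneg _).trans (hD x))

lemma LocBdd.mul_locallyIntegrableOn (hΩ : IsOpen Ω) (hf : LocBdd Ω f)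
    (hfi : LocallyIntegrableOn f Ω) (hg : LocallyIntegrableOn g Ω) :
    LocallyIntegrableOn (fun x ↦ f x * g x) Ω := by
  rw [locallyIntegrableOn_iff hΩ.isLocallyClosed] at hfi hg ⊢
  intro K hKΩ hK
  obtain ⟨C, hC⟩ := hf K hKΩ hK
  exact (hg K hKΩ hK).bdd_mul (hfi K hKΩ hK).1 hC

/-- Product rule for weak derivatives of locally bounded functions. -/
lemma IsWeakPartial.mul (hΩ : IsOpen Ω) (hf : LocBdd Ω f) (hf₁ : LocBdd Ω f₁)
    (h : IsWeakPartial Ω i f g) (h₁ : IsWeakPartial Ω i f₁ g₁) :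
    IsWeakPartial Ω i (fun x ↦ f x * f₁ x) (fun x ↦ f x * g₁ x + g x * f₁ x) := by
  have l1 := hf.mul_locallyIntegrableOn hΩ h.1 h₁.2.1
  have l2 : LocallyIntegrableOn (fun x ↦ g x * f₁ x) Ω := by
    simpa only [mul_comm] using hf₁.mul_locallyIntegrableOn hΩ h₁.1 h.2.1
  have l3 := hf.mul_locallyIntegrableOn hΩ h.1 h₁.1
  refine isWeakPartial_iff.2 ⟨l3, l1.add l2, fun φ hφ ↦ ?_⟩
  -- The cutoff turns `f` into the globally defined `f χ`. Since `χ = 1` near every point where `φ ≠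
  -- 0`, its gradient never meets `φ`.
  obtain ⟨χ, hχ, hone⟩ := exists_cutoff hΩ hφ.hasCompactSupport hφ.tsupport_subset
  obtain ⟨C, hC⟩ := hf.exists_bound_mul_test hχ
  obtain ⟨C₁, hC₁⟩ := hf₁.exists_bound_mul_test hφ
  have key := integral_mul_add_mul_eq_zero (hχ.integrable h.1)
    ((hχ.integrable h.2.1).add ((hχ.partial (e i)).integrable h.1))
    (hφ.integrable h₁.1) ((hφ.integrable h₁.2.1).add ((hφ.partial (e i)).integrable h₁.1))
    hφ.hasCompactSupport.mul_left hC hC₁ (h.isGlobalWeakDeriv_mul hχ)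
    (h₁.isGlobalWeakDeriv_mul hφ)
  have hpt : ∀ x, f x * χ x * (g₁ x * φ x + f₁ x * fderiv ℝ φ x (e i)) +
      (g x * χ x + f x * fderiv ℝ χ x (e i)) * (f₁ x * φ x) =
      f x * f₁ x * fderiv ℝ φ x (e i) + (f x * g₁ x + g x * f₁ x) * φ x := fun x ↦ by
    by_cases hx : x ∈ tsupport φ
    · rw [hone x hx]
      by_cases hφx : φ x = 0
      · rw [hφx]; ring
      · have hev : χ =ᶠ[𝓝 x] fun _ ↦ 1 := by
          filter_upwards [hφ.continuous.continuousAt.eventually_ne hφx] with y hy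
          exact hone y (subset_tsupport _ hy)
        rw [hev.fderiv_eq]
        simp; ring
    · rw [image_eq_zero_of_notMem_tsupport hx, image_eq_zero_of_notMem_tsupport
        (f := fun x ↦ fderiv ℝ φ x (e i))
        (fun h ↦ hx (tsupport_fderiv_apply_subset ℝ (e i) h))]
      ring
  have l4 : LocallyIntegrableOn (fun x ↦ f x * g₁ x + g x * f₁ x) Ω := l1.add l2
  simp only [Pi.add_apply, hpt] at key
  rw [integral_add ((hφ.partial (e i)).integrable l3) (hφ.integrable l4)] at key
  linarith

lemma IsWeakPartial.congr (h : IsWeakPartial Ω i f g) (hf : f =ᵐ[volume.restrict Ω] f₁)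
    (hg : g =ᵐ[volume.restrict Ω] g₁) : IsWeakPartial Ω i f₁ g₁ := by
  refine ⟨h.1.congr hf, h.2.1.congr hg, fun φ h1 h2 h3 ↦ ?_⟩
  have e1 : ∫ x in Ω, f x * fderiv ℝ φ x (e i) = ∫ x in Ω, f₁ x * fderiv ℝ φ x (e i) :=
    integral_congr_ae (hf.mono fun x hx ↦ by simp only [hx])
  have e2 : ∫ x in Ω, g x * φ x = ∫ x in Ω, g₁ x * φ x :=
    integral_congr_ae (hg.mono fun x hx ↦ by simp only [hx])
  rw [← e1, h.2.2 φ h1 h2 h3, e2]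

lemma ae_eq_zero_of_forall_test (hΩ : IsOpen Ω) (hf : LocallyIntegrableOn f Ω)
    (h : ∀ φ, IsTest Ω φ → ∫ x, f x * φ x = 0) : f =ᵐ[volume.restrict Ω] 0 := by
  have := hΩ.ae_eq_zero_of_integral_contDiff_smul_eq_zero hf fun φ h1 h2 h3 ↦ by
    simpa [mul_comm] using h φ ⟨h1, h2, h3⟩
  exact (ae_restrict_iff' hΩ.measurableSet).2 this

lemma ae_eq_of_forall_test (hΩ : IsOpen Ω) (hf : LocallyIntegrableOn f Ω)
    (hg : LocallyIntegrableOn g Ω)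
    (h : ∀ φ, IsTest Ω φ → ∫ x, f x * φ x = ∫ x, g x * φ x) :
    f =ᵐ[volume.restrict Ω] g := by
  have := ae_eq_zero_of_forall_test hΩ (hf.sub hg) fun φ hφ ↦ by
    simp only [Pi.sub_apply, sub_mul]
    rw [integral_sub (hφ.integrable hf) (hφ.integrable hg), h φ hφ, sub_self]
  filter_upwards [this] with x hx using sub_eq_zero.1 hx

lemma IsWeakPartial.unique (hΩ : IsOpen Ω) (h : IsWeakPartial Ω i f g)
    (h₁ : IsWeakPartial Ω i f g₁) : g =ᵐ[volume.restrict Ω] g₁ :=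
  ae_eq_of_forall_test hΩ h.2.1 h₁.2.1 fun _ hφ ↦
    neg_injective ((h.integral_eq hφ).symm.trans (h₁.integral_eq hφ))

lemma IsWeakPartial.weakPartial (h : IsWeakPartial Ω i f g) :
    IsWeakPartial Ω i f (weakPartial Ω i f) := by
  have hex : ∃ g, IsWeakPartial Ω i f g := ⟨g, h⟩
  rw [PrestrainedPlate.weakPartial, dif_pos hex]
  exact hex.choose_spec

lemma IsWeakPartial.weakPartial_ae_eq (hΩ : IsOpen Ω) (h : IsWeakPartial Ω i f g) :
    PrestrainedPlate.weakPartial Ω i f =ᵐ[volume.restrict Ω] g :=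
  h.weakPartial.unique hΩ h

/-- The choice depends on `f` only through the predicate `IsWeakPartial Ω i f`, which ignores null
sets; hence equality at every point and not just almost everywhere. -/
lemma weakPartial_congr (h : f =ᵐ[volume.restrict Ω] f₁) :
    weakPartial Ω i f = weakPartial Ω i f₁ := by
  have : IsWeakPartial Ω i f = IsWeakPartial Ω i f₁ := by
    ext g
    exact ⟨fun h' ↦ h'.congr h .rfl, fun h' ↦ h'.congr h.symm .rfl⟩
  unfold weakPartial
  generalize IsWeakPartial Ω i f = P at this
  subst this
  rfl

/-- Two integrations by parts reduce both sides to the symmetry of the second derivatives of the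
test function. -/
lemma IsWeakPartial.comm (hΩ : IsOpen Ω) {fi fj fij fji : Plane → ℝ}
    (hi : IsWeakPartial Ω i f fi) (hj : IsWeakPartial Ω j f fj)
    (hij : IsWeakPartial Ω j fi fij) (hji : IsWeakPartial Ω i fj fji) :
    fij =ᵐ[volume.restrict Ω] fji := by
  refine ae_eq_of_forall_test hΩ hij.2.1 hji.2.1 fun φ hφ ↦ ?_
  have h1 := hij.integral_eq hφ
  have h2 := hji.integral_eq hφ
  have h3 := hi.integral_eq (hφ.partial (e j))
  have h4 := hj.integral_eq (hφ.partial (e i))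
  have hsymm : ∀ x, fderiv ℝ (fun y ↦ fderiv ℝ φ y (e j)) x (e i) =
      fderiv ℝ (fun y ↦ fderiv ℝ φ y (e i)) x (e j) := fun x ↦ by
    have hd : DifferentiableAt ℝ (fderiv ℝ φ) x :=
      ((hφ.contDiff.fderiv_right (m := ∞) (by simp)).differentiable (by simp)) x
    rw [fderiv_clm_apply hd (differentiableAt_const _),
      fderiv_clm_apply hd (differentiableAt_const _)]
    have := (hφ.contDiff.contDiffAt (x := x)).isSymmSndFDerivAt
      (by rw [minSmoothness_of_isRCLikeNormedField]
          exact WithTop.coe_le_coe.2 (le_top : (2 : ℕ∞) ≤ ⊤))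
    simpa using this (e i) (e j)
  simp only [hsymm] at h3
  linarith

lemma IsWeakPartial.add (h : IsWeakPartial Ω i f g) (h₁ : IsWeakPartial Ω i f₁ g₁) :
    IsWeakPartial Ω i (fun x ↦ f x + f₁ x) (fun x ↦ g x + g₁ x) := by
  refine isWeakPartial_iff.2 ⟨h.1.add h₁.1, h.2.1.add h₁.2.1, fun φ hφ ↦ ?_⟩
  simp only [add_mul]
  rw [integral_add ((hφ.partial (e i)).integrable h.1) ((hφ.partial (e i)).integrable h₁.1),
    integral_add (hφ.integrable h.2.1) (hφ.integrable h₁.2.1), h.integral_eq hφ,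
    h₁.integral_eq hφ, neg_add]

/-- Differentiable functions with continuous partial derivative. -/
lemma isWeakPartial_of_hasFDerivAt (hΩ : IsOpen Ω) {f' : Plane → Plane →L[ℝ] ℝ}
    (hf : ∀ x ∈ Ω, HasFDerivAt f (f' x) x) (hf' : ContinuousOn (fun x ↦ f' x (e i)) Ω) :
    IsWeakPartial Ω i f fun x ↦ f' x (e i) := by
  have hfc : ContinuousOn f Ω := fun x hx ↦ (hf x hx).continuousAt.continuousWithinAt
  have h1 := hfc.locallyIntegrableOn (μ := volume) hΩ.measurableSet
  have h2 := hf'.locallyIntegrableOn (μ := volume) hΩ.measurableSet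
  refine isWeakPartial_iff.2 ⟨h1, h2, fun φ hφ ↦ ?_⟩
  exact integral_bilinear_hasLineDerivAt_right_eq_neg_left_of_integrable
    (B := ContinuousLinearMap.mul ℝ ℝ) (f := f) (g := φ) (v := e i)
    (f' := fun x ↦ f' x (e i)) (g' := fun x ↦ fderiv ℝ φ x (e i))
    (hφ.integrable h2) ((hφ.partial (e i)).integrable h1) (hφ.integrable h1)
    (fun x hx ↦ (hf x (hφ.tsupport_subset hx)).hasLineDerivAt _)
    (fun x _ ↦ (hφ.contDiff.differentiable (by simp) x).hasFDerivAt.hasLineDerivAt _)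

lemma isWeakPartial_zero : IsWeakPartial Ω i (fun _ ↦ 0) (fun _ ↦ 0) :=
  isWeakPartial_iff.2 ⟨locallyIntegrableOn_zero, locallyIntegrableOn_zero, fun φ _ ↦ by simp⟩

lemma IsWeakPartial.sum {ι : Type*} (s : Finset ι) {f g : ι → Plane → ℝ}
    (h : ∀ k ∈ s, IsWeakPartial Ω i (f k) (g k)) :
    IsWeakPartial Ω i (fun x ↦ ∑ k ∈ s, f k x) (fun x ↦ ∑ k ∈ s, g k x) := by
  classical
  induction s using Finset.induction_on with
  | empty => simpa using isWeakPartial_zero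
  | insert a s ha ih =>
    simp only [Finset.sum_insert ha]
    exact (h a (Finset.mem_insert_self a s)).add
      (ih fun k hk ↦ h k (Finset.mem_insert_of_mem hk))

lemma locBdd_of_ae_bdd {C : ℝ} (hC : ∀ᵐ x ∂volume.restrict Ω, |f x| ≤ C) : LocBdd Ω f :=
  fun _ hK _ ↦ ⟨C, ae_mono (Measure.restrict_mono_set _ hK) hC⟩

lemma locBdd_of_continuousOn (hf : ContinuousOn f Ω) : LocBdd Ω f := fun K hK hc ↦ by
  obtain ⟨C, hC⟩ := hc.exists_bound_of_continuousOn (hf.mono hK)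
  exact ⟨C, (ae_restrict_iff' hc.measurableSet).2 (Eventually.of_forall hC)⟩

/-- `f` is essentially bounded on `Ω` with weak partial derivatives `f' i` in `L²(Ω)`. -/
structure HasBddW12 (Ω : Set Plane) (f : Plane → ℝ) (f' : Fin 2 → Plane → ℝ) : Prop where
  bdd : ∃ C, ∀ᵐ x ∂volume.restrict Ω, |f x| ≤ C
  weak : ∀ i, IsWeakPartial Ω i f (f' i)
  l2 : ∀ i, MemLp (f' i) 2 (volume.restrict Ω)

variable {f' f₁' g' : Fin 2 → Plane → ℝ}

lemma HasBddW12.locBdd (h : HasBddW12 Ω f f') : LocBdd Ω f :=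
  locBdd_of_ae_bdd h.bdd.choose_spec

lemma IsWeakPartial.aestronglyMeasurable (h : IsWeakPartial Ω i f g) :
    AEStronglyMeasurable f (volume.restrict Ω) := h.1.aestronglyMeasurable

/-- Bounded `W^{1,2}` functions form an algebra; this is what keeps the normal and the Cosserat
vector, polynomial in `∇y` with smooth coefficients, in `W^{1,2}`. -/
lemma HasBddW12.mul (hΩ : IsOpen Ω) (h : HasBddW12 Ω f f') (h₁ : HasBddW12 Ω f₁ f₁') :
    HasBddW12 Ω (fun x ↦ f x * f₁ x) (fun i x ↦ f x * f₁' i x + f' i x * f₁ x) := by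
  obtain ⟨C, hC⟩ := h.bdd
  obtain ⟨D, hD⟩ := h₁.bdd
  refine ⟨⟨|C| * D, ?_⟩, fun i ↦ (h.weak i).mul hΩ h.locBdd h₁.locBdd (h₁.weak i),
    fun i ↦ MemLp.add ?_ ?_⟩
  · filter_upwards [hC, hD] with x h1 h2
    rw [abs_mul]
    exact mul_le_mul (h1.trans (le_abs_self C)) h2 (abs_nonneg _) (abs_nonneg _)
  · refine (h₁.l2 i).of_le_mul (c := C) ((h.weak i).aestronglyMeasurable.mul (h₁.l2 i).1) ?_
    filter_upwards [hC] with x h1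
    rw [norm_mul]
    exact mul_le_mul_of_nonneg_right h1 (norm_nonneg _)
  · refine (h.l2 i).of_le_mul (c := D) ((h.l2 i).1.mul (h₁.weak i).aestronglyMeasurable) ?_
    filter_upwards [hD] with x h1
    rw [norm_mul, mul_comm]
    exact mul_le_mul_of_nonneg_right h1 (norm_nonneg _)

lemma HasBddW12.add (h : HasBddW12 Ω f f') (h₁ : HasBddW12 Ω f₁ f₁') :
    HasBddW12 Ω (fun x ↦ f x + f₁ x) (fun i x ↦ f' i x + f₁' i x) := by
  obtain ⟨C, hC⟩ := h.bdd
  obtain ⟨D, hD⟩ := h₁.bdd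
  refine ⟨⟨C + D, ?_⟩, fun i ↦ (h.weak i).add (h₁.weak i), fun i ↦ (h.l2 i).add (h₁.l2 i)⟩
  filter_upwards [hC, hD] with x h1 h2 using (abs_add_le _ _).trans (add_le_add h1 h2)

lemma HasBddW12.sum {ι : Type*} (s : Finset ι) {f : ι → Plane → ℝ}
    {f' : ι → Fin 2 → Plane → ℝ} (h : ∀ k ∈ s, HasBddW12 Ω (f k) (f' k)) :
    HasBddW12 Ω (fun x ↦ ∑ k ∈ s, f k x) (fun i x ↦ ∑ k ∈ s, f' k i x) := by
  classical
  induction s using Finset.induction_on with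
  | empty =>
    simpa using ⟨⟨0, by simp⟩, fun _ ↦ isWeakPartial_zero, fun _ ↦ MemLp.zero'⟩
  | insert a s ha ih =>
    simp only [Finset.sum_insert ha]
    exact (h a (Finset.mem_insert_self a s)).add
      (ih fun k hk ↦ h k (Finset.mem_insert_of_mem hk))

lemma HasBddW12.congr (h : HasBddW12 Ω f f') (hf : f =ᵐ[volume.restrict Ω] f₁) :
    HasBddW12 Ω f₁ f' := by
  obtain ⟨C, hC⟩ := h.bdd
  refine ⟨⟨C, ?_⟩, fun i ↦ (h.weak i).congr hf .rfl, h.l2⟩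
  filter_upwards [hC, hf] with x h1 h2
  rwa [← h2]

lemma memLp_of_ae_bdd (hb : Bornology.IsBounded Ω)
    (hf : AEStronglyMeasurable f (volume.restrict Ω)) {C : ℝ}
    (hC : ∀ᵐ x ∂volume.restrict Ω, |f x| ≤ C) {p : ℝ≥0∞} : MemLp f p (volume.restrict Ω) := by
  have : IsFiniteMeasure (volume.restrict Ω) := ⟨by simpa using hb.measure_lt_top⟩
  exact MemLp.of_bound hf C hC

lemma HasBddW12.memW12 (hb : Bornology.IsBounded Ω) (h : HasBddW12 Ω f f') : MemW12 Ω f :=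
  ⟨memLp_of_ae_bdd hb (h.weak 0).aestronglyMeasurable h.bdd.choose_spec,
    fun i ↦ ⟨f' i, h.l2 i, h.weak i⟩⟩

lemma HasBddW12.memLp (hb : Bornology.IsBounded Ω) (h : HasBddW12 Ω f f') {p : ℝ≥0∞} :
    MemLp f p (volume.restrict Ω) :=
  memLp_of_ae_bdd hb (h.weak 0).aestronglyMeasurable h.bdd.choose_spec

lemma HasBddW12.weakPartial_ae_eq (hΩ : IsOpen Ω) (h : HasBddW12 Ω f f') (i : Fin 2) :
    PrestrainedPlate.weakPartial Ω i f =ᵐ[volume.restrict Ω] f' i :=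
  (h.weak i).weakPartial_ae_eq hΩ

lemma HasBddW12.unique (hΩ : IsOpen Ω) (h : HasBddW12 Ω f f') (h₁ : HasBddW12 Ω f₁ f₁')
    (hf : f =ᵐ[volume.restrict Ω] f₁) (i : Fin 2) : f' i =ᵐ[volume.restrict Ω] f₁' i :=
  ((h.weak i).congr hf .rfl).unique hΩ (h₁.weak i)

lemma MemW12.hasBddW12 (hΩ : IsOpen Ω) (h : MemW12 Ω f) {C : ℝ}
    (hC : ∀ᵐ x ∂volume.restrict Ω, |f x| ≤ C) :
    HasBddW12 Ω f fun i ↦ PrestrainedPlate.weakPartial Ω i f where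
  bdd := ⟨C, hC⟩
  weak i := let ⟨_, _, hg⟩ := h.2 i; hg.weakPartial
  l2 i := let ⟨_, hg, hw⟩ := h.2 i; hg.ae_eq (hw.weakPartial_ae_eq hΩ).symm

/-- Bounded differentiable functions with continuous bounded derivatives. -/
lemma hasBddW12_of_hasFDerivAt (hΩ : IsOpen Ω) (hb : Bornology.IsBounded Ω)
    {f' : Plane → Plane →L[ℝ] ℝ} (hf : ∀ x ∈ Ω, HasFDerivAt f (f' x) x)
    (hf' : ∀ i, ContinuousOn (fun x ↦ f' x (e i)) Ω) (hB : ∃ C, ∀ x ∈ Ω, |f x| ≤ C)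
    (hB' : ∀ i, ∃ C, ∀ x ∈ Ω, |f' x (e i)| ≤ C) :
    HasBddW12 Ω f fun i x ↦ f' x (e i) := by
  have hae : ∀ {p : Plane → Prop}, (∀ x ∈ Ω, p x) → ∀ᵐ x ∂volume.restrict Ω, p x := fun h ↦
    (ae_restrict_iff' hΩ.measurableSet).2 (Eventually.of_forall h)
  obtain ⟨C, hC⟩ := hB
  refine ⟨⟨C, hae hC⟩, fun i ↦ isWeakPartial_of_hasFDerivAt hΩ hf (hf' i), fun i ↦ ?_⟩
  obtain ⟨D, hD⟩ := hB' i
  exact memLp_of_ae_bdd hb ((hf' i).aestronglyMeasurable hΩ.measurableSet) (hae hD)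

end WeakPartial

/-! ### The quadratic forms `Q₃` and `Q₂` vanish exactly on skew matrices -/

section Energy

open Filter Topology

/-- A negative second derivative would make `a` a local maximum too, so `g` would be constant near
`a`. -/
lemma deriv_deriv_nonneg_of_isLocalMin {g : ℝ → ℝ} {a : ℝ} (h : IsLocalMin g a)
    (hc : ContinuousAt g a) : 0 ≤ deriv (deriv g) a := by
  by_contra! hneg
  have h1 : deriv (fun t ↦ -g t) = fun t ↦ -deriv g t := by ext; simp
  have h2 : IsLocalMin (fun t ↦ -g t) a := by
    refine isLocalMin_of_deriv_deriv_pos ?_ ?_ hc.neg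
    · rw [h1]; simpa using hneg
    · rw [h1]; simpa using h.deriv_eq_zero
  have h3 : g =ᶠ[𝓝 a] fun _ ↦ g a := by
    filter_upwards [h, h2] with t h3 h4
    linarith
  have h4 : deriv g =ᶠ[𝓝 a] fun _ ↦ 0 := h3.deriv.trans (by simp)
  rw [h4.deriv_eq] at hneg
  simp at hneg

/-- For `c' < ψ 0` the function `w (x + t v) - c' t²` has a local minimum at `0`, so its second
derivative there is nonnegative; then `c'` tends to `ψ 0`. -/
lemma two_mul_le_fderiv_fderiv {E : Type*} [NormedAddCommGroup E] [NormedSpace ℝ E] {w : E → ℝ}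
    {x v : E} (hw : ContDiffAt ℝ 2 w x) (hw0 : w x = 0) {ψ : ℝ → ℝ} (hψ : ContinuousAt ψ 0)
    (h : ∀ᶠ t in 𝓝 0, ψ t * t ^ 2 ≤ w (x + t • v)) :
    2 * ψ 0 ≤ fderiv ℝ (fderiv ℝ w) x v v := by
  let γ : ℝ → E := fun t ↦ x + t • v
  have hγ : ∀ t, HasDerivAt γ v t := fun t ↦
    (((hasDerivAt_id t).smul_const v).const_add x).congr_deriv (one_smul _ _)
  have hγ0 : γ 0 = x := by simp [γ]
  have hγc : Tendsto γ (𝓝 0) (𝓝 x) := by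
    have := (hγ 0).continuousAt.tendsto
    rwa [hγ0] at this
  have hd1 : ∀ᶠ y in 𝓝 x, DifferentiableAt ℝ w y :=
    (hw.eventually (by norm_cast)).mono fun x hx ↦ hx.differentiableAt (by norm_num)
  have hd2 : DifferentiableAt ℝ (fderiv ℝ w) x :=
    (hw.fderiv_right (m := 1) (by norm_num)).differentiableAt (by norm_num)
  have hf' : ∀ᶠ t in 𝓝 0, HasDerivAt (fun t ↦ w (γ t)) (fderiv ℝ w (γ t) v) t := by
    filter_upwards [hγc.eventually hd1] with t ht
    exact ht.hasFDerivAt.comp_hasDerivAt t (hγ t)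
  have hf'' : HasDerivAt (fun t ↦ fderiv ℝ w (γ t) v) (fderiv ℝ (fderiv ℝ w) x v v) 0 := by
    have h0 : HasFDerivAt (fderiv ℝ w) (fderiv ℝ (fderiv ℝ w) x) (γ 0) := by
      rw [hγ0]; exact hd2.hasFDerivAt
    simpa using (h0.comp_hasDerivAt 0 (hγ 0)).clm_apply (hasDerivAt_const 0 v)
  suffices h : ∀ c' < ψ 0, 2 * c' ≤ fderiv ℝ (fderiv ℝ w) x v v by
    refine le_of_forall_lt_imp_le_of_dense fun a ha ↦ ?_
    have := h (a / 2) (by linarith)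
    linarith
  intro c' hc'
  let g : ℝ → ℝ := fun t ↦ w (γ t) - c' * t ^ 2
  have hg' : deriv g =ᶠ[𝓝 0] fun t ↦ fderiv ℝ w (γ t) v - c' * (2 * t) := by
    filter_upwards [hf'] with t ht
    have := ht.fun_sub ((hasDerivAt_pow 2 t).const_mul c')
    simpa using this.deriv
  have hg'' : deriv (deriv g) 0 = fderiv ℝ (fderiv ℝ w) x v v - 2 * c' := by
    have := (hf''.fun_sub (((hasDerivAt_id (0 : ℝ)).const_mul 2).const_mul c')).deriv
    rw [mul_one, mul_comm c' 2] at this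
    rw [hg'.deriv_eq]
    exact this
  have hmin : IsLocalMin g 0 := by
    filter_upwards [continuousAt_const.eventually_lt hψ hc', h] with t h1 h2
    have h0 : g 0 = 0 := by simp [g, hγ0, hw0]
    have h7 : c' * t ^ 2 ≤ ψ t * t ^ 2 := mul_le_mul_of_nonneg_right h1.le (sq_nonneg t)
    simp only [h0, g]
    linarith
  have hgc : ContinuousAt g 0 := hf'.self_of_nhds.continuousAt.sub (by fun_prop)
  have := deriv_deriv_nonneg_of_isLocalMin hmin hgc
  linarith

lemma fderiv_fderiv_eq_zero_of_curve {E : Type*} [NormedAddCommGroup E] [NormedSpace ℝ E]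
    {w : E → ℝ} {γ : ℝ → E} {x v : E} (hγ : HasDerivAt γ v 0) (hγ0 : γ 0 = x)
    (hw : DifferentiableAt ℝ (fderiv ℝ w) x) (h : ∀ t, fderiv ℝ w (γ t) = 0) :
    fderiv ℝ (fderiv ℝ w) x v = 0 := by
  subst hγ0
  have h1 := hw.hasFDerivAt.comp_hasDerivAt (0 : ℝ) hγ
  rw [show (fderiv ℝ w ∘ γ) = fun _ ↦ 0 from funext h] at h1
  exact h1.unique (hasDerivAt_const 0 0)

attribute [local instance] Matrix.frobeniusNormedAddCommGroup Matrix.frobeniusNormedSpace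
  Matrix.frobeniusNormedRing Matrix.frobeniusNormedAlgebra

lemma frobenius_norm_sq (A : Matrix (Fin 3) (Fin 3) ℝ) : ‖A‖ ^ 2 = (Aᵀ * A).trace := by
  rw [Matrix.frobenius_norm_def, ← Real.sqrt_eq_rpow, Real.sq_sqrt (by positivity),
    Finset.sum_comm]
  simp [Matrix.trace, Matrix.mul_apply, pow_two]

lemma abs_apply_le_frobenius_norm (A : Matrix (Fin 3) (Fin 3) ℝ) (i j : Fin 3) :
    |A i j| ≤ ‖A‖ := by
  refine abs_le_of_sq_le_sq ?_ (norm_nonneg _)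
  rw [frobenius_norm_sq]
  simp only [Matrix.trace, Matrix.diag_apply, Matrix.mul_apply, Matrix.transpose_apply,
    ← pow_two]
  exact (Finset.single_le_sum (f := fun k ↦ A k j ^ 2) (fun k _ ↦ sq_nonneg _)
    (Finset.mem_univ i)).trans (Finset.single_le_sum (f := fun l ↦ ∑ k, A k l ^ 2)
    (fun l _ ↦ Finset.sum_nonneg fun k _ ↦ sq_nonneg _) (Finset.mem_univ j))

lemma mem_SO3_iff {R : Matrix (Fin 3) (Fin 3) ℝ} : R ∈ SO3 ↔ Rᵀ * R = 1 ∧ R.det = 1 := by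
  change R ∈ Matrix.specialOrthogonalGroup (Fin 3) ℝ ↔ _
  rw [Matrix.mem_specialOrthogonalGroup_iff, Matrix.mem_orthogonalGroup_iff,
    mul_eq_one_comm]

lemma one_mem_SO3 : (1 : Matrix (Fin 3) (Fin 3) ℝ) ∈ SO3 := by simp [mem_SO3_iff]

lemma norm_le_two_of_mem_SO3 {R : Matrix (Fin 3) (Fin 3) ℝ} (h : R ∈ SO3) : ‖R‖ ≤ 2 := by
  refine abs_le_of_sq_le_sq' ?_ zero_le_two |>.2
  rw [frobenius_norm_sq, (mem_SO3_iff.1 h).1]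
  norm_num

/-- The distance to the rotations controls the linearized strain. -/
lemma infDist_SO3_lower_bound (F : Matrix (Fin 3) (Fin 3) ℝ) (t : ℝ) :
    |t| * (‖F + Fᵀ + t • (Fᵀ * F)‖ / (4 + |t| * ‖F‖)) ≤ Metric.infDist (1 + t • F) SO3 := by
  have hden : 0 < 4 + |t| * ‖F‖ := by positivity
  set A := 1 + t • F with hA
  have hAA : Aᵀ * A - 1 = t • (F + Fᵀ + t • (Fᵀ * F)) := by
    rw [hA]
    simp only [Matrix.transpose_add, Matrix.transpose_one, Matrix.transpose_smul, add_mul,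
      mul_add, one_mul, mul_one, smul_add, Matrix.smul_mul, Matrix.mul_smul]
    abel
  -- Expanding `AᵀA - RᵀR` about `R` gives a linear and a quadratic term in `A - R`; the `4` is
  -- twice the bound `‖R‖ ≤ 2`.
  have hR : ∀ R ∈ SO3, |t| * ‖F + Fᵀ + t • (Fᵀ * F)‖ ≤ dist A R * (4 + dist A R) := by
    intro R hR
    have h1 : Aᵀ * A - 1 = Aᵀ * (A - R) - Rᵀ * R + Aᵀ * R := by
      rw [(mem_SO3_iff.1 hR).1]; noncomm_ring
    have h2 : Aᵀ * A - 1 = (A - R)ᵀ * R + Rᵀ * (A - R) + (A - R)ᵀ * (A - R) := by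
      rw [← (mem_SO3_iff.1 hR).1, Matrix.transpose_sub]; noncomm_ring
    rw [dist_eq_norm, ← Real.norm_eq_abs, ← norm_smul, ← hAA, h2]
    have hR2 := norm_le_two_of_mem_SO3 hR
    have e1 : ‖(A - R)ᵀ‖ = ‖A - R‖ := Matrix.frobenius_norm_transpose _
    have e2 : ‖Rᵀ‖ = ‖R‖ := Matrix.frobenius_norm_transpose _
    refine norm_add₃_le.trans ?_
    have n1 := norm_mul_le (A - R)ᵀ R
    have n2 := norm_mul_le Rᵀ (A - R)
    have n3 := norm_mul_le (A - R)ᵀ (A - R)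
    rw [e1] at n1 n3
    rw [e2] at n2
    nlinarith [norm_nonneg (A - R), norm_nonneg R]
  have hone : dist A 1 = |t| * ‖F‖ := by
    rw [dist_eq_norm, hA, add_sub_cancel_left, norm_smul, Real.norm_eq_abs]
  have h1 := hR 1 one_mem_SO3
  rw [hone] at h1
  rw [Metric.le_infDist ⟨1, one_mem_SO3⟩, ← mul_div_assoc]
  intro R hRm
  rw [div_le_iff₀ hden]
  -- Rotations closer than the identity have the quadratic term absorbed by the denominator; for the
  -- others the estimate at `R = 1` already suffices.
  rcases le_total (dist A R) (|t| * ‖F‖) with h | h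
  · exact (hR R hRm).trans (mul_le_mul_of_nonneg_left (by linarith) dist_nonneg)
  · exact h1.trans (mul_le_mul_of_nonneg_right h hden.le)

variable {W : Matrix (Fin 3) (Fin 3) ℝ → ℝ≥0∞}

lemma Q3_eq (F : Matrix (Fin 3) (Fin 3) ℝ) :
    Q3 W F = fderiv ℝ (fderiv ℝ fun F' ↦ (W F').toReal) 1 F F :=
  iteratedFDeriv_two_apply _ _ _

lemma IsEnergyDensity.contDiffAt (hW : IsEnergyDensity W) {R : Matrix (Fin 3) (Fin 3) ℝ}
    (hR : R ∈ SO3) : ContDiffAt ℝ 2 (fun F ↦ (W F).toReal) R := by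
  obtain ⟨U, hU, hUS, -, hd⟩ := hW.regular
  exact hd.contDiffAt (hU.mem_nhds (hUS hR))

lemma IsEnergyDensity.eventually_ne_top (hW : IsEnergyDensity W) :
    ∀ᶠ F in 𝓝 (1 : Matrix (Fin 3) (Fin 3) ℝ), W F ≠ ⊤ := by
  obtain ⟨U, hU, hUS, hfin, -⟩ := hW.regular
  exact eventually_of_mem (hU.mem_nhds (hUS one_mem_SO3)) hfin

/-- Nondegeneracy gives `W(1 + tF) ≥ ψ(t) t²` for small `t`, with `ψ(0) = c ‖F + Fᵀ‖² / 16`, and the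
second derivative is at least `2 ψ(0)`. -/
lemma IsEnergyDensity.exists_Q3_lower_bound (hW : IsEnergyDensity W) :
    ∃ c > 0, ∀ F : Matrix (Fin 3) (Fin 3) ℝ, c * ‖F + Fᵀ‖ ^ 2 ≤ Q3 W F := by
  obtain ⟨c, hc, hcW⟩ := hW.nondegenerate
  refine ⟨2 * (c / 16), by positivity, fun F ↦ ?_⟩
  have hcont : Tendsto (fun t : ℝ ↦ 1 + t • F) (𝓝 0) (𝓝 1) := by
    have : ContinuousAt (fun t : ℝ ↦ 1 + t • F) 0 := by fun_prop
    simpa [ContinuousAt] using this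
  have hψ : ContinuousAt
      (fun t : ℝ ↦ c * (‖F + Fᵀ + t • (Fᵀ * F)‖ / (4 + |t| * ‖F‖)) ^ 2) 0 := by
    have : (4 : ℝ) + |0| * ‖F‖ ≠ 0 := by simp
    fun_prop (disch := assumption)
  have := two_mul_le_fderiv_fderiv (v := F) (hW.contDiffAt one_mem_SO3)
    (by simp [hW.normalized 1 one_mem_SO3]) hψ (by
      filter_upwards [hcont.eventually hW.eventually_ne_top] with t h2
      have h3 : c * Metric.infDist (1 + t • F) SO3 ^ 2 ≤ (W (1 + t • F)).toReal := by
        have := ENNReal.toReal_mono h2 (hcW (1 + t • F))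
        rwa [ENNReal.toReal_ofReal (by positivity)] at this
      refine le_trans (le_of_eq ?_) ((mul_le_mul_of_nonneg_left
        (pow_le_pow_left₀ (by positivity) (infDist_SO3_lower_bound F t) 2) hc.le).trans h3)
      rw [mul_pow |t|, sq_abs]; ring)
  rw [Q3_eq]
  refine le_trans (le_of_eq ?_) this
  simp only [zero_smul, add_zero, abs_zero, zero_mul]
  ring

/-- The determinant is `1`, not `-1`, because `exp A` is the square of the orthogonal matrix `exp
(A/2)`. -/
lemma exp_mem_SO3 {A : Matrix (Fin 3) (Fin 3) ℝ} (hA : Aᵀ = -A) : NormedSpace.exp A ∈ SO3 := by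
  have h1 : ∀ B : Matrix (Fin 3) (Fin 3) ℝ, Bᵀ = -B →
      (NormedSpace.exp B)ᵀ * NormedSpace.exp B = 1 := fun B hB ↦ by
    rw [← Matrix.exp_transpose, hB, ← Matrix.exp_add_of_commute _ _ (Commute.refl B).neg_left,
      neg_add_cancel, NormedSpace.exp_zero]
  refine mem_SO3_iff.2 ⟨h1 A hA, ?_⟩
  have h2 : ((1 / 2 : ℝ) • A)ᵀ = -((1 / 2 : ℝ) • A) := by
    rw [Matrix.transpose_smul, hA, smul_neg]
  have h3 : NormedSpace.exp A =
      NormedSpace.exp ((1 / 2 : ℝ) • A) * NormedSpace.exp ((1 / 2 : ℝ) • A) := by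
    rw [← Matrix.exp_add_of_commute _ _ (Commute.refl _), ← add_smul]
    norm_num
  have h4 := congrArg Matrix.det (h1 _ h2)
  rw [Matrix.det_mul, Matrix.det_transpose, Matrix.det_one] at h4
  rw [h3, Matrix.det_mul, h4]

/-- Every rotation is a minimum of `W`, so `DW` vanishes along the curve `exp (tA)`; differentiating
at `t = 0` gives `D²W(Id) A = 0`. -/
lemma IsEnergyDensity.Q3_eq_zero_of_skew (hW : IsEnergyDensity W)
    {A : Matrix (Fin 3) (Fin 3) ℝ} (hA : Aᵀ = -A) : Q3 W A = 0 := by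
  have hexp := hasDerivAt_exp_smul_const A (0 : ℝ)
  rw [zero_smul, NormedSpace.exp_zero, one_mul] at hexp
  have key := fderiv_fderiv_eq_zero_of_curve hexp (by rw [zero_smul, NormedSpace.exp_zero])
    (((hW.contDiffAt one_mem_SO3).fderiv_right (m := 1) (by norm_num)).differentiableAt
      (by norm_num)) fun t ↦ by
    have hmem : NormedSpace.exp (t • A) ∈ SO3 := exp_mem_SO3 (by
      rw [Matrix.transpose_smul, hA, smul_neg])
    refine IsLocalMin.fderiv_eq_zero (Eventually.of_forall fun F ↦ ?_)
    have h0 := hW.normalized _ hmem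
    change (W (NormedSpace.exp (t • A))).toReal ≤ (W F).toReal
    rw [h0]
    exact ENNReal.toReal_nonneg
  rw [Q3_eq]
  exact DFunLike.congr_fun key A

lemma matrixSqrt_spec {P : Matrix (Fin 3) (Fin 3) ℝ} (hP : P.PosDef) :
    (matrixSqrt P)ᵀ = matrixSqrt P ∧ matrixSqrt P * matrixSqrt P = P ∧
      IsUnit (matrixSqrt P).det := by
  open scoped MatrixOrder in
  have h1 : matrixSqrt P * matrixSqrt P = P :=
    CFC.sqrt_mul_sqrt_self P hP.posSemidef.nonneg
  have h2 : (matrixSqrt P).PosSemidef := by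
    open scoped MatrixOrder in
    exact Matrix.nonneg_iff_posSemidef.1 (CFC.sqrt_nonneg P)
  refine ⟨by simpa [Matrix.conjTranspose_eq_transpose_of_trivial] using h2.isHermitian.eq,
    h1, ?_⟩
  have h3 := hP.det_pos
  rw [← h1, Matrix.det_mul] at h3
  exact isUnit_iff_ne_zero.2 fun h ↦ by simp [h] at h3

/-- Padding `F` with zeros gives a skew competitor, and conjugation by the symmetric matrix `√P⁻¹`
keeps it skew. -/
lemma IsEnergyDensity.Q2_eq_zero_of_skew (hW : IsEnergyDensity W)
    {P : Matrix (Fin 3) (Fin 3) ℝ} (hP : P.PosDef) {F : Matrix (Fin 2) (Fin 2) ℝ}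
    (hF : F + Fᵀ = 0) : Q2 W P F = 0 := by
  obtain ⟨c, hc, hcQ⟩ := hW.exists_Q3_lower_bound
  have hpos : ∀ A, 0 ≤ Q3 W A := fun A ↦ le_trans (by positivity) (hcQ A)
  have hent : ∀ i j, F i j + F j i = 0 := fun i j ↦ by
    simpa using congrFun (congrFun hF i) j
  refine le_antisymm (csInf_le ⟨0, ?_⟩ ?_) (Real.sInf_nonneg ?_)
  · rintro _ ⟨_, _, rfl⟩; exact hpos _
  · refine ⟨!![F 0 0, F 0 1, 0; F 1 0, F 1 1, 0; 0, 0, 0], ?_, ?_⟩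
    · ext i j; fin_cases i <;> fin_cases j <;> rfl
    · refine (hW.Q3_eq_zero_of_skew ?_).symm
      have hS : ((matrixSqrt P)⁻¹)ᵀ = (matrixSqrt P)⁻¹ := by
        rw [Matrix.transpose_nonsing_inv, (matrixSqrt_spec hP).1]
      rw [Matrix.transpose_mul, Matrix.transpose_mul, hS, ← Matrix.mul_assoc, ← neg_mul,
        ← mul_neg]
      congr 2
      ext i j
      have h00 := hent 0 0
      have h01 := hent 0 1
      have h11 := hent 1 1
      fin_cases i <;> fin_cases j <;> simp <;> linarith
  · rintro _ ⟨_, _, rfl⟩; exact hpos _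

/-- With `T = √P` and `X = T⁻¹F'T⁻¹` one has `F' + F'ᵀ = T (X + Xᵀ) T` and `‖T‖² = tr P`. The bound
is explicit in `P` so that it can be integrated over `Ω`. -/
lemma IsEnergyDensity.exists_Q2_lower_bound (hW : IsEnergyDensity W) :
    ∃ c > 0, ∀ P : Matrix (Fin 3) (Fin 3) ℝ, P.PosDef → ∀ (F : Matrix (Fin 2) (Fin 2) ℝ) i j,
      c * ((F i j + F j i) / P.trace) ^ 2 ≤ Q2 W P F := by
  obtain ⟨c, hc, hcQ⟩ := hW.exists_Q3_lower_bound
  refine ⟨c, hc, fun P hP F i j ↦ ?_⟩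
  obtain ⟨hT, hTT, hTu⟩ := matrixSqrt_spec hP
  set T := matrixSqrt P
  have htr : ‖T‖ ^ 2 = P.trace := by rw [frobenius_norm_sq, hT, hTT]
  have hT0 : 0 < P.trace := hP.trace_pos
  refine le_csInf ⟨_, !![F 0 0, F 0 1, 0; F 1 0, F 1 1, 0; 0, 0, 0], ?_, rfl⟩ ?_
  · ext i j; fin_cases i <;> fin_cases j <;> rfl
  · rintro _ ⟨F', rfl, rfl⟩
    refine le_trans ?_ (hcQ _)
    set X := T⁻¹ * F' * T⁻¹ with hX
    have hS : (T⁻¹)ᵀ = T⁻¹ := by rw [Matrix.transpose_nonsing_inv, hT]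
    have h1 : F' + F'ᵀ = T * (X + Xᵀ) * T := by
      rw [hX, Matrix.transpose_mul, Matrix.transpose_mul, hS, ← Matrix.mul_assoc,
        ← Matrix.add_mul, ← Matrix.mul_add, Matrix.mul_assoc, Matrix.mul_assoc,
        Matrix.nonsing_inv_mul _ hTu, Matrix.mul_one, ← Matrix.mul_assoc,
        Matrix.mul_nonsing_inv _ hTu, Matrix.one_mul]
    have h2 : ‖F' + F'ᵀ‖ ≤ P.trace * ‖X + Xᵀ‖ := by
      rw [h1, ← htr]
      have n1 := norm_mul_le (T * (X + Xᵀ)) T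
      have n2 := norm_mul_le T (X + Xᵀ)
      nlinarith [norm_nonneg T, norm_nonneg (X + Xᵀ)]
    have h3 := (abs_apply_le_frobenius_norm (F' + F'ᵀ) i.castSucc j.castSucc).trans h2
    have h4 : |(minor22 F' i j + minor22 F' j i) / P.trace| ≤ ‖X + Xᵀ‖ := by
      rw [abs_div, abs_of_pos hT0, div_le_iff₀ hT0, mul_comm]
      exact h3
    rw [← sq_abs]
    gcongr

end Energy

/-! ### Christoffel symbols, regularity and curvature of the metric -/

section Metric

open Filter Topology

variable {Ω : Set Plane} {f : Plane → ℝ}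

/-- Near each point of the closure, smoothness within the closure provides a derivative continuous
up to the boundary, which agrees with `fderiv` on the open set; compactness makes the local bounds
uniform. -/
lemma exists_fderiv_bound (hΩ : IsOpen Ω) (hb : Bornology.IsBounded Ω)
    (hf : ContDiffOn ℝ ∞ f (closure Ω)) : ∃ C, ∀ x ∈ Ω, ‖fderiv ℝ f x‖ ≤ C := by
  suffices h : ∃ C, ∀ x ∈ Ω ∩ closure Ω, ‖fderiv ℝ f x‖ ≤ C by
    rwa [inter_eq_left.2 subset_closure] at h
  refine hb.isCompact_closure.induction_on (p := fun s ↦ ∃ C, ∀ x ∈ Ω ∩ s, ‖fderiv ℝ f x‖ ≤ C)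
    ⟨0, by simp⟩ (fun s t hst ⟨C, hC⟩ ↦ ⟨C, fun x hx ↦ hC x ⟨hx.1, hst hx.2⟩⟩)
    (fun s t ⟨C, hC⟩ ⟨D, hD⟩ ↦ ⟨max C D, fun x hx ↦ hx.2.elim
      (fun h ↦ (hC x ⟨hx.1, h⟩).trans (le_max_left _ _))
      (fun h ↦ (hD x ⟨hx.1, h⟩).trans (le_max_right _ _))⟩) fun p hp ↦ ?_
  obtain ⟨u, hu, -, f', hf', hc⟩ :=
    (contDiffWithinAt_succ_iff_hasFDerivWithinAt (n := 0) (by simp)).1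
    ((hf p hp).of_le (m := 0 + 1) (by simp))
  rw [insert_eq_of_mem hp] at hu
  obtain ⟨V, hV, hpV, hVu⟩ := mem_nhdsWithin.1 hu
  have hpu : p ∈ u := hVu ⟨hpV, hp⟩
  have hbd : ∀ᶠ x in 𝓝[u] p, ‖f' x‖ < ‖f' p‖ + 1 :=
    hc.continuousWithinAt.norm.eventually_lt continuousWithinAt_const (lt_add_one _)
  obtain ⟨V', hV', hpV', hVu'⟩ := mem_nhdsWithin.1 hbd
  refine ⟨V ∩ V', mem_nhdsWithin_of_mem_nhds ((hV.inter hV').mem_nhds ⟨hpV, hpV'⟩),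
    ‖f' p‖ + 1, fun x hx ↦ ?_⟩
  have hsub : Ω ∩ V ⊆ u := fun y hy ↦ hVu ⟨hy.2, subset_closure hy.1⟩
  have hxu : u ∈ 𝓝 x := mem_of_superset ((hΩ.inter hV).mem_nhds ⟨hx.1, hx.2.1⟩) hsub
  rw [((hf' x (mem_of_mem_nhds hxu)).hasFDerivAt hxu).fderiv]
  exact (hVu' ⟨hx.2.2, mem_of_mem_nhds hxu⟩ : _ < _).le

lemma norm_e (i : Fin 2) : ‖e i‖ = 1 := by simp [e]

lemma abs_apply_e_le (L : Plane →L[ℝ] ℝ) (i : Fin 2) : |L (e i)| ≤ ‖L‖ := by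
  simpa [norm_e] using L.le_opNorm (e i)

lemma exists_bound_of_contDiffOn_closure (hb : Bornology.IsBounded Ω)
    (hf : ContDiffOn ℝ ∞ f (closure Ω)) : ∃ C, ∀ x ∈ Ω, |f x| ≤ C :=
  let ⟨C, hC⟩ := hb.isCompact_closure.exists_bound_of_continuousOn hf.continuousOn
  ⟨C, fun x hx ↦ hC x (subset_closure hx)⟩

lemma continuousOn_fderiv_apply {n : WithTop ℕ∞} (hn : 1 ≤ n) (hΩ : IsOpen Ω)
    (hf : ContDiffOn ℝ n f Ω) (v : Plane) : ContinuousOn (fun x ↦ fderiv ℝ f x v) Ω :=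
  (hf.continuousOn_fderiv_of_isOpen hΩ hn).clm_apply continuousOn_const

lemma hasFDerivAt_of_contDiffOn {n : WithTop ℕ∞} (hn : 1 ≤ n) (hΩ : IsOpen Ω)
    (hf : ContDiffOn ℝ n f Ω) {x : Plane} (hx : x ∈ Ω) : HasFDerivAt f (fderiv ℝ f x) x :=
  ((hf.contDiffAt (hΩ.mem_nhds hx)).differentiableAt
    (fun h ↦ by simp [h] at hn)).hasFDerivAt

lemma hasBddW12_of_contDiffOn_closure (hΩ : IsOpen Ω) (hb : Bornology.IsBounded Ω)
    (hf : ContDiffOn ℝ ∞ f (closure Ω)) :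
    HasBddW12 Ω f fun i x ↦ fderiv ℝ f x (e i) := by
  have hf' := hf.mono subset_closure
  obtain ⟨C, hC⟩ := exists_fderiv_bound hΩ hb hf
  exact hasBddW12_of_hasFDerivAt hΩ hb
    (fun x hx ↦ hasFDerivAt_of_contDiffOn (by simp) hΩ hf' hx)
    (fun i ↦ continuousOn_fderiv_apply (by simp) hΩ hf' (e i))
    (exists_bound_of_contDiffOn_closure hb hf)
    (fun i ↦ ⟨C, fun x hx ↦ (abs_apply_e_le _ i).trans (hC x hx)⟩)

lemma partial3_castSucc (i : Fin 2) (f : Plane → ℝ) (x : Plane) :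
    partial3 i.castSucc f x = fderiv ℝ f x (e i) := by
  fin_cases i <;> rfl

lemma partial3_two (f : Plane → ℝ) (x : Plane) : partial3 2 f x = 0 := rfl

lemma partial3_congr {f₁ : Plane → ℝ} {x : Plane} (h : f =ᶠ[𝓝 x] f₁) (k : Fin 3) :
    partial3 k f x = partial3 k f₁ x := by
  simp only [partial3, h.fderiv_eq]

variable {G : Plane → Matrix (Fin 3) (Fin 3) ℝ}

/-- The matrix `[Γ^k_{ij}]_{k,j}` of the connection in the direction `e i`. -/
noncomputable def conn (G : Plane → Matrix (Fin 3) (Fin 3) ℝ) (i : Fin 2) (x : Plane) :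
    Matrix (Fin 3) (Fin 3) ℝ :=
  Matrix.of fun k j ↦ christoffel G k i.castSucc j x

lemma IsPlateMetric.symm (hG : IsPlateMetric Ω G) {x : Plane} (hx : x ∈ closure Ω)
    (a b : Fin 3) : G x a b = G x b a := by
  have := (hG.posDef x hx).isHermitian.apply a b
  simpa using this.symm

lemma IsPlateMetric.transpose_eq (hG : IsPlateMetric Ω G) {x : Plane} (hx : x ∈ closure Ω) :
    (G x)ᵀ = G x := by
  ext a b; exact hG.symm hx b a

lemma IsPlateMetric.isUnit_det (hG : IsPlateMetric Ω G) {x : Plane} (hx : x ∈ closure Ω) :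
    IsUnit (G x).det := (hG.posDef x hx).det_pos.ne'.isUnit

lemma IsPlateMetric.partial3_symm (hΩ : IsOpen Ω) (hG : IsPlateMetric Ω G) {x : Plane}
    (hx : x ∈ Ω) (a b l : Fin 3) :
    partial3 l (fun z ↦ G z a b) x = partial3 l (fun z ↦ G z b a) x :=
  partial3_congr (eventually_of_mem (hΩ.mem_nhds hx)
    fun _ hz ↦ hG.symm (subset_closure hz) a b) l

lemma IsPlateMetric.christoffel_symm (hΩ : IsOpen Ω) (hG : IsPlateMetric Ω G) {x : Plane}
    (hx : x ∈ Ω) (s k l : Fin 3) : christoffel G s k l x = christoffel G s l k x := by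
  unfold christoffel
  congr 1
  refine Finset.sum_congr rfl fun m _ ↦ ?_
  rw [hG.partial3_symm hΩ hx k l m]
  ring

lemma IsPlateMetric.conn_symm (hΩ : IsOpen Ω) (hG : IsPlateMetric Ω G) {x : Plane}
    (hx : x ∈ Ω) (i j : Fin 2) (k : Fin 3) :
    conn G i x k j.castSucc = conn G j x k i.castSucc :=
  hG.christoffel_symm hΩ hx k i.castSucc j.castSucc

/-- The Christoffel symbols of the first kind. -/
lemma IsPlateMetric.sum_mul_christoffel (hG : IsPlateMetric Ω G) {x : Plane}
    (hx : x ∈ closure Ω) (a k l : Fin 3) :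
    ∑ s, G x a s * christoffel G s k l x = (1 / 2) * (partial3 l (fun z ↦ G z a k) x +
      partial3 k (fun z ↦ G z a l) x - partial3 a (fun z ↦ G z k l) x) := by
  let v : Fin 3 → ℝ := fun m ↦ partial3 l (fun z ↦ G z m k) x +
      partial3 k (fun z ↦ G z m l) x - partial3 m (fun z ↦ G z k l) x
  have h1 : ∀ s, christoffel G s k l x = (1 / 2) * ((G x)⁻¹ *ᵥ v) s := fun s ↦ rfl
  simp_rw [h1, mul_left_comm _ (1 / 2 : ℝ)]
  rw [← Finset.mul_sum]
  congr 1
  have h2 : G x *ᵥ ((G x)⁻¹ *ᵥ v) = v := by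
    rw [Matrix.mulVec_mulVec, Matrix.mul_nonsing_inv _ (hG.isUnit_det hx), Matrix.one_mulVec]
  exact congrFun h2 a

lemma IsPlateMetric.mul_conn_apply (hG : IsPlateMetric Ω G) {x : Plane}
    (hx : x ∈ closure Ω) (i : Fin 2) (a l : Fin 3) :
    (G x * conn G i x) a l = (1 / 2) * (partial3 l (fun z ↦ G z a i.castSucc) x +
      fderiv ℝ (fun z ↦ G z a l) x (e i) - partial3 a (fun z ↦ G z i.castSucc l) x) := by
  rw [Matrix.mul_apply, ← partial3_castSucc]
  exact hG.sum_mul_christoffel hx a i.castSucc l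

/-- The entrywise derivative of a matrix field. -/
noncomputable def dmat (i : Fin 2) (M : Plane → Matrix (Fin 3) (Fin 3) ℝ) (x : Plane) :
    Matrix (Fin 3) (Fin 3) ℝ :=
  Matrix.of fun a b ↦ fderiv ℝ (fun z ↦ M z a b) x (e i)

/-- The connection is metric. -/
lemma IsPlateMetric.mul_conn_add_transpose (hΩ : IsOpen Ω) (hG : IsPlateMetric Ω G) {x : Plane}
    (hx : x ∈ Ω) (i : Fin 2) :
    G x * conn G i x + (G x * conn G i x)ᵀ = dmat i G x := by
  ext a b
  rw [Matrix.add_apply, Matrix.transpose_apply, hG.mul_conn_apply (subset_closure hx),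
    hG.mul_conn_apply (subset_closure hx), dmat, Matrix.of_apply, ← partial3_castSucc,
    ← partial3_castSucc, hG.partial3_symm hΩ hx b a, hG.partial3_symm hΩ hx a i.castSucc,
    hG.partial3_symm hΩ hx b i.castSucc]
  ring

/-- Since `∂₃G = 0`, `(GΓ_i)_{j3} = ½ (∂_i G_{j3} - ∂_j G_{i3})`. This is where independence of `x₃`
makes the connection term drop out of `sym((∇y)ᵀ∇b)`. -/
lemma IsPlateMetric.mul_conn_skew (hG : IsPlateMetric Ω G) {x : Plane}
    (hx : x ∈ closure Ω) (i j : Fin 2) :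
    (G x * conn G i x) j.castSucc 2 + (G x * conn G j x) i.castSucc 2 = 0 := by
  rw [hG.mul_conn_apply hx, hG.mul_conn_apply hx,
    partial3_two, partial3_two, partial3_castSucc, partial3_castSucc]
  ring

/-! ### Regularity -/

lemma IsPlateMetric.contDiffOn_det (hG : IsPlateMetric Ω G) :
    ContDiffOn ℝ ∞ (fun x ↦ (G x).det) (closure Ω) := by
  have h := hG.smooth
  simp only [Matrix.det_fin_three]
  fun_prop

lemma IsPlateMetric.contDiffOn_inv (hG : IsPlateMetric Ω G) (i j : Fin 3) :
    ContDiffOn ℝ ∞ (fun x ↦ (G x)⁻¹ i j) (closure Ω) := by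
  have h := hG.smooth
  have hadj : ContDiffOn ℝ ∞ (fun x ↦ (G x).adjugate i j) (closure Ω) := by
    simp only [Matrix.adjugate_fin_three]
    fin_cases i <;> fin_cases j <;> simp <;> fun_prop
  have heq : ∀ x, (G x)⁻¹ i j = ((G x).det)⁻¹ * (G x).adjugate i j := fun x ↦ by
    rw [Matrix.inv_def, Ring.inverse_eq_inv']; rfl
  simp only [heq]
  exact (hG.contDiffOn_det.inv fun x hx ↦ (hG.posDef x hx).det_pos.ne').mul hadj

lemma contDiffOn_partial3 (hΩ : IsOpen Ω) (hf : ContDiffOn ℝ ∞ f Ω) (k : Fin 3) :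
    ContDiffOn ℝ ∞ (partial3 k f) Ω := by
  have : ∀ v : Plane, ContDiffOn ℝ ∞ (fun x ↦ fderiv ℝ f x v) Ω := fun v ↦
    (hf.fderiv_of_isOpen hΩ (by simp)).clm_apply contDiffOn_const
  fin_cases k
  · exact this (e 0)
  · exact this (e 1)
  · exact contDiffOn_const

lemma IsPlateMetric.contDiffOn_christoffel (hΩ : IsOpen Ω) (hG : IsPlateMetric Ω G)
    (s k l : Fin 3) : ContDiffOn ℝ ∞ (christoffel G s k l) Ω := by
  have h1 : ∀ m l k, ContDiffOn ℝ ∞ (partial3 l fun z ↦ G z m k) Ω := fun m l k ↦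
    contDiffOn_partial3 hΩ ((hG.smooth m k).mono subset_closure) l
  have h2 : ∀ m, ContDiffOn ℝ ∞ (fun x ↦ (G x)⁻¹ s m) Ω := fun m ↦
    (hG.contDiffOn_inv s m).mono subset_closure
  exact contDiffOn_const.mul (ContDiffOn.sum fun m _ ↦ (h2 m).mul
    (((h1 m l k).add (h1 m k l)).sub (h1 k m l)))

lemma IsPlateMetric.exists_bound_christoffel (hΩ : IsOpen Ω) (hb : Bornology.IsBounded Ω)
    (hG : IsPlateMetric Ω G) (s k l : Fin 3) :
    ∃ C, ∀ x ∈ Ω, |christoffel G s k l x| ≤ C := by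
  have hp : ∀ l m k, ∃ C, ∀ x ∈ Ω, |partial3 l (fun z ↦ G z m k) x| ≤ C := fun l m k ↦ by
    obtain ⟨C, hC⟩ := exists_fderiv_bound hΩ hb (hG.smooth m k)
    refine ⟨max C 0, fun x hx ↦ ?_⟩
    have h1 := fun i ↦ (abs_apply_e_le (fderiv ℝ (fun z ↦ G z m k) x) i).trans
      ((hC x hx).trans (le_max_left C 0))
    fin_cases l
    · exact h1 0
    · exact h1 1
    · simp [partial3]
  have hi : ∀ m, ∃ C, ∀ x ∈ Ω, |(G x)⁻¹ s m| ≤ C := fun m ↦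
    exists_bound_of_contDiffOn_closure hb (hG.contDiffOn_inv s m)
  choose P hP using hp
  choose I hI using hi
  refine ⟨1 / 2 * ∑ m, I m * (P l m k + P k m l + P m k l), fun x hx ↦ ?_⟩
  rw [christoffel, abs_mul, abs_of_pos (by norm_num : (0 : ℝ) < 1 / 2)]
  refine mul_le_mul_of_nonneg_left ((Finset.abs_sum_le_sum_abs _ _).trans
    (Finset.sum_le_sum fun m _ ↦ ?_)) (by norm_num)
  rw [abs_mul]
  refine mul_le_mul (hI m x hx) ?_ (abs_nonneg _) ((abs_nonneg _).trans (hI m x hx))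
  exact (abs_sub _ _).trans (add_le_add ((abs_add_le _ _).trans
    (add_le_add (hP l m k x hx) (hP k m l x hx))) (hP m k l x hx))

/-! ### Curvature -/

/-- The curvature matrix `[R^s_{i12}]_{s,i}` of the connection. -/
noncomputable def curv (G : Plane → Matrix (Fin 3) (Fin 3) ℝ) (x : Plane) :
    Matrix (Fin 3) (Fin 3) ℝ :=
  dmat 0 (conn G 1) x - dmat 1 (conn G 0) x + conn G 0 x * conn G 1 x - conn G 1 x * conn G 0 x

lemma dmat_mul {M N : Plane → Matrix (Fin 3) (Fin 3) ℝ} {x : Plane}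
    (hM : ∀ a b, DifferentiableAt ℝ (fun z ↦ M z a b) x)
    (hN : ∀ a b, DifferentiableAt ℝ (fun z ↦ N z a b) x) (i : Fin 2) :
    dmat i (fun z ↦ M z * N z) x = dmat i M x * N x + M x * dmat i N x := by
  ext a b
  simp only [dmat, Matrix.of_apply, Matrix.mul_apply, Matrix.add_apply]
  rw [fderiv_fun_sum (A := fun k z ↦ M z a k * N z k b) fun k _ ↦ (hM a k).fun_mul (hN k b), ← Finset.sum_add_distrib,
    sum_apply]
  refine Finset.sum_congr rfl fun k _ ↦ ?_
  rw [fderiv_fun_mul (hM a k) (hN k b)]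
  simp [mul_comm, add_comm]

lemma IsPlateMetric.differentiableAt (hΩ : IsOpen Ω) (hG : IsPlateMetric Ω G) {x : Plane}
    (hx : x ∈ Ω) (a b : Fin 3) : DifferentiableAt ℝ (fun z ↦ G z a b) x :=
  (hasFDerivAt_of_contDiffOn (by simp) hΩ ((hG.smooth a b).mono subset_closure)
    hx).differentiableAt

lemma IsPlateMetric.differentiableAt_conn (hΩ : IsOpen Ω) (hG : IsPlateMetric Ω G) {x : Plane}
    (hx : x ∈ Ω) (i : Fin 2) (a b : Fin 3) : DifferentiableAt ℝ (fun z ↦ conn G i z a b) x :=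
  (hasFDerivAt_of_contDiffOn (by simp) hΩ
    (hG.contDiffOn_christoffel hΩ a i.castSucc b) hx).differentiableAt

/-- Differentiating `∂_i G = GΓ_i + (GΓ_i)ᵀ` once more and using `∂₁∂₂G = ∂₂∂₁G`. -/
lemma IsPlateMetric.mul_curv_skew (hΩ : IsOpen Ω) (hG : IsPlateMetric Ω G) {x : Plane}
    (hx : x ∈ Ω) : G x * curv G x + (G x * curv G x)ᵀ = 0 := by
  have hdG := hG.differentiableAt hΩ hx
  have hdc := hG.differentiableAt_conn hΩ hx
  have hdB : ∀ i a b, DifferentiableAt ℝ (fun z ↦ (G z * conn G i z) a b) x := fun i a b ↦ by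
    simp only [Matrix.mul_apply]
    exact DifferentiableAt.fun_sum fun k _ ↦ (hdG a k).mul (hdc i k b)
  have hB : ∀ i j, dmat j (fun z ↦ G z * conn G i z) x +
      (dmat j (fun z ↦ G z * conn G i z) x)ᵀ = dmat j (dmat i G) x := fun i j ↦ by
    ext a b
    simp only [dmat, Matrix.of_apply, Matrix.add_apply, Matrix.transpose_apply]
    have : (fun z ↦ fderiv ℝ (fun z ↦ G z a b) z (e i)) =ᶠ[𝓝 x]
        fun z ↦ (G z * conn G i z) a b + (G z * conn G i z) b a := by
      filter_upwards [hΩ.mem_nhds hx] with z hz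
      exact (congrFun (congrFun (hG.mul_conn_add_transpose hΩ hz i) a) b).symm
    rw [this.fderiv_eq, fderiv_fun_add (hdB i a b) (hdB i b a)]
    rfl
  have hsymm : dmat 0 (dmat 1 G) x = dmat 1 (dmat 0 G) x := by
    ext a b
    simp only [dmat, Matrix.of_apply]
    have hc : ContDiffAt ℝ ∞ (fun z ↦ G z a b) x :=
      ((hG.smooth a b).mono subset_closure).contDiffAt (hΩ.mem_nhds hx)
    have hd : DifferentiableAt ℝ (fderiv ℝ fun z ↦ G z a b) x :=
      (hc.fderiv_right (m := 1) (by norm_cast)).differentiableAt (by norm_num)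
    have h2 := hc.isSymmSndFDerivAt (by
      rw [minSmoothness_of_isRCLikeNormedField]
      exact WithTop.coe_le_coe.2 (le_top : (2 : ℕ∞) ≤ ⊤))
    rw [fderiv_clm_apply hd (differentiableAt_const _),
      fderiv_clm_apply hd (differentiableAt_const _)]
    simpa using h2 (e 0) (e 1)
  have h01 := hB 1 0
  have h10 := hB 0 1
  rw [dmat_mul hdG (hdc 1), ← hG.mul_conn_add_transpose hΩ hx 0] at h01
  rw [dmat_mul hdG (hdc 0), ← hG.mul_conn_add_transpose hΩ hx 1] at h10
  have hGt := hG.transpose_eq (subset_closure hx)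
  rw [← hsymm, ← h01] at h10
  simp only [curv, Matrix.mul_add, Matrix.mul_sub, Matrix.transpose_add, Matrix.transpose_sub,
    Matrix.transpose_mul, hGt, Matrix.add_mul, Matrix.transpose_transpose,
    ← Matrix.mul_assoc] at h10 ⊢
  rw [← sub_eq_zero] at h10
  rw [← neg_eq_zero, ← h10]
  abel

lemma IsPlateMetric.riemann_eq_curv (hΩ : IsOpen Ω) (hG : IsPlateMetric Ω G) {x : Plane}
    (hx : x ∈ Ω) (s i : Fin 3) : riemann G s i 0 1 x = curv G x s i := by
  have h := fun s i ↦ hG.christoffel_symm hΩ hx s i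
  have hp : ∀ (j : Fin 2) (k : Fin 3), fderiv ℝ (christoffel G s i k) x (e j) =
      fderiv ℝ (christoffel G s k i) x (e j) := fun j k ↦ by
    have : christoffel G s i k =ᶠ[𝓝 x] christoffel G s k i :=
      eventually_of_mem (hΩ.mem_nhds hx) fun z hz ↦ hG.christoffel_symm hΩ hz s i k
    rw [this.fderiv_eq]
  have h0 : (0 : Fin 3) = (0 : Fin 2).castSucc := rfl
  have h1 : (1 : Fin 3) = (1 : Fin 2).castSucc := rfl
  simp only [riemann, curv, Matrix.sub_apply, Matrix.add_apply, dmat, Matrix.of_apply,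
    Matrix.mul_apply, conn]
  rw [h0, h1, partial3_castSucc, partial3_castSucc, hp, hp]
  simp only [h _ i]

/-- The skew matrix `L = G · curv` has three free entries. `R₁₂₁₂` is `L₁₂`; once it vanishes,
`R³₁₁₂` and `R³₂₂₁` are, up to sign, `G³³ L₃₁` and `G³³ L₃₂`, and `G³³ > 0`. -/
lemma IsPlateMetric.curvaturesVanish_iff (hΩ : IsOpen Ω) (hG : IsPlateMetric Ω G) :
    CurvaturesVanish Ω G ↔ ∀ x ∈ Ω, curv G x = 0 := by
  have hneg : ∀ x ∈ Ω, riemann G 2 1 1 0 x = -curv G x 2 1 := fun x hx ↦ by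
    rw [← hG.riemann_eq_curv hΩ hx]; simp only [riemann]; ring
  have hlow : ∀ x ∈ Ω, riemannLow G 0 1 0 1 x = (G x * curv G x) 0 1 := fun x hx ↦ by
    simp only [riemannLow, hG.riemann_eq_curv hΩ hx, Matrix.mul_apply]
  refine forall₂_congr fun x hx ↦ ?_
  rw [hneg x hx, hlow x hx, hG.riemann_eq_curv hΩ hx]
  refine ⟨fun ⟨h1, h2, h3⟩ ↦ ?_, fun h ↦ by simp [h]⟩
  have hsk : ∀ a b, (G x * curv G x) a b + (G x * curv G x) b a = 0 := fun a b ↦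
    congrFun (congrFun (hG.mul_curv_skew hΩ hx) a) b
  set L := G x * curv G x with hL
  have hu := hG.isUnit_det (subset_closure hx)
  have hK : curv G x = (G x)⁻¹ * L := by
    rw [hL, ← Matrix.mul_assoc, Matrix.nonsing_inv_mul _ hu, Matrix.one_mul]
  have hG33 : 0 < (G x)⁻¹ 2 2 := (hG.posDef x (subset_closure hx)).inv.diag_pos
  have e0 := hsk 0 0
  have e1 := hsk 1 1
  have e2 := hsk 2 2
  have e01 := hsk 0 1
  have e02 := hsk 0 2
  have e12 := hsk 1 2
  rw [hK, Matrix.mul_apply, Fin.sum_univ_three] at h1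
  rw [hK, Matrix.mul_apply, Fin.sum_univ_three] at h2
  have l00 : L 0 0 = 0 := by linarith
  have l11 : L 1 1 = 0 := by linarith
  have l22 : L 2 2 = 0 := by linarith
  have l10 : L 1 0 = 0 := by linarith
  have l20 : L 2 0 = 0 := by
    rw [l00, l10] at h1
    simpa [hG33.ne'] using h1
  have l21 : L 2 1 = 0 := by
    rw [h3, l11] at h2
    simpa [hG33.ne'] using h2
  have hL0 : L = 0 := by
    ext a b
    fin_cases a <;> fin_cases b <;> simp <;> linarith
  rw [hK, hL0, Matrix.mul_zero]

end Metric

/-! ### Pointwise linear algebra of frames, normals and Cosserat vectors -/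

section Frame

open Filter Topology

variable {Ω : Set Plane} {G : Plane → Matrix (Fin 3) (Fin 3) ℝ}

/-! ### Linear algebra of frames -/

/-- The Koszul argument: a trilinear form symmetric in one pair of arguments and skew in another
vanishes. -/
lemma apply_castSucc_eq_zero {E : Fin 2 → Matrix (Fin 3) (Fin 3) ℝ}
    (hs : ∀ i, E i + (E i)ᵀ = 0) (hc : ∀ i j k, E i k j.castSucc = E j k i.castSucc)
    (i a b : Fin 2) : E i a.castSucc b.castSucc = 0 := by
  have h : ∀ i a b, E i a b + E i b a = 0 := fun i a b ↦ congrFun (congrFun (hs i) a) b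
  have h1 : E 0 0 1 = E 1 0 0 := hc 0 1 0
  have h2 : E 0 1 1 = E 1 1 0 := hc 0 1 1
  have h3 := h 0 0 0
  have h4 := h 0 1 1
  have h5 := h 0 0 1
  have h6 := h 1 0 0
  have h7 := h 1 1 1
  have h8 := h 1 0 1
  fin_cases i <;> fin_cases a <;> fin_cases b <;> simp <;> linarith

lemma eq_zero_iff_of_skew {E : Fin 2 → Matrix (Fin 3) (Fin 3) ℝ}
    (hs : ∀ i, E i + (E i)ᵀ = 0) (hc : ∀ i j k, E i k j.castSucc = E j k i.castSucc) :
    (∀ i, E i = 0) ↔ ∀ i j : Fin 2, E i 2 j.castSucc = 0 := by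
  refine ⟨fun h i j ↦ by simp [h i], fun h i ↦ ?_⟩
  have h0 := apply_castSucc_eq_zero hs hc i
  have h1 : ∀ a b, E i a b + E i b a = 0 := fun a b ↦ congrFun (congrFun (hs i) a) b
  have h2 : ∀ a : Fin 3, ∀ b : Fin 2, E i a b.castSucc = 0 := fun a b ↦ by
    induction a using Fin.lastCases with
    | last => exact h i b
    | cast a => exact h0 a b
  ext a b
  induction b using Fin.lastCases with
  | cast b => exact h2 a b
  | last =>
    induction a using Fin.lastCases with
    | cast a =>
      have := h1 a.castSucc (Fin.last 2)
      rw [h2, add_zero] at this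
      exact this
    | last =>
      have := h1 (Fin.last 2) (Fin.last 2)
      change E i (Fin.last 2) (Fin.last 2) = 0
      linarith

/-- The matrix with the columns `p₁, p₂, b`. -/
def colMatrix (p : Matrix (Fin 3) (Fin 2) ℝ) (b : Fin 3 → ℝ) : Matrix (Fin 3) (Fin 3) ℝ :=
  (Matrix.of ![pᵀ 0, pᵀ 1, b])ᵀ

lemma colMatrix_castSucc (p : Matrix (Fin 3) (Fin 2) ℝ) (b : Fin 3 → ℝ) (k : Fin 3)
    (j : Fin 2) : colMatrix p b k j.castSucc = p k j := by
  fin_cases j <;> rfl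

lemma det_colMatrix (p : Matrix (Fin 3) (Fin 2) ℝ) (b : Fin 3 → ℝ) :
    (colMatrix p b).det = crossProduct (pᵀ 0) (pᵀ 1) ⬝ᵥ b := by
  rw [colMatrix, Matrix.det_transpose, Matrix.det_fin_three, cross_apply,
    Matrix.vec3_dotProduct]
  simp
  ring

/-- The Gram matrix fixes the products of `b` with `p₁, p₂`, and the positive determinant fixes its
product with `p₁ × p₂`; these three vectors are independent. -/
lemma colMatrix_injective {p : Matrix (Fin 3) (Fin 2) ℝ} {b b' : Fin 3 → ℝ}
    (hd : 0 < (colMatrix p b).det) (hd' : 0 < (colMatrix p b').det)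
    (h : (colMatrix p b)ᵀ * colMatrix p b = (colMatrix p b')ᵀ * colMatrix p b') : b = b' := by
  have h1 := congrArg Matrix.det h
  simp only [Matrix.det_mul, Matrix.det_transpose] at h1
  have h2 : (colMatrix p b).det = (colMatrix p b').det := by nlinarith
  rw [det_colMatrix, det_colMatrix] at h2
  have hentry : ∀ j : Fin 2, pᵀ j ⬝ᵥ b = pᵀ j ⬝ᵥ b' := fun j ↦ by
    have := congrFun (congrFun h j.castSucc) 2
    simp only [Matrix.mul_apply, Matrix.transpose_apply, colMatrix_castSucc]
      at this
    exact this
  set n := crossProduct (pᵀ 0) (pᵀ 1) with hn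
  have hnn : n ⬝ᵥ n ≠ 0 := fun h0 ↦ by
    rw [det_colMatrix, ← hn, dotProduct_self_eq_zero.1 h0, zero_dotProduct] at hd
    exact lt_irrefl _ hd
  have hu : (colMatrix p n)ᵀ *ᵥ (b - b') = 0 := by
    ext j
    fin_cases j
    · change pᵀ 0 ⬝ᵥ (b - b') = 0
      rw [dotProduct_sub, hentry, sub_self]
    · change pᵀ 1 ⬝ᵥ (b - b') = 0
      rw [dotProduct_sub, hentry, sub_self]
    · change n ⬝ᵥ (b - b') = 0
      rw [dotProduct_sub, h2, sub_self]
  refine sub_eq_zero.1 (Matrix.eq_zero_of_mulVec_eq_zero ?_ hu)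
  rwa [Matrix.det_transpose, det_colMatrix]

section Pointwise

variable {P : Matrix (Fin 3) (Fin 3) ℝ} {p : Matrix (Fin 3) (Fin 2) ℝ}

lemma minor22_posDef (hP : P.PosDef) : (minor22 P).PosDef :=
  hP.submatrix (Fin.castSucc_injective 2)

lemma cross_dot_cross_eq_det (hp : pᵀ * p = minor22 P) :
    crossProduct (pᵀ 0) (pᵀ 1) ⬝ᵥ crossProduct (pᵀ 0) (pᵀ 1) = (minor22 P).det := by
  rw [cross_dot_cross, ← hp, Matrix.det_fin_two]
  rfl

/-- The unit normal of a pair of vectors. -/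
noncomputable def normalVec (p : Matrix (Fin 3) (Fin 2) ℝ) : Fin 3 → ℝ :=
  (Real.sqrt (crossProduct (pᵀ 0) (pᵀ 1) ⬝ᵥ crossProduct (pᵀ 0) (pᵀ 1)))⁻¹ •
    crossProduct (pᵀ 0) (pᵀ 1)

/-- The Cosserat vector of a pair of vectors. -/
noncomputable def cosseratVec (P : Matrix (Fin 3) (Fin 3) ℝ) (p : Matrix (Fin 3) (Fin 2) ℝ) :
    Fin 3 → ℝ :=
  p *ᵥ ((minor22 P)⁻¹ *ᵥ ![P 0 2, P 1 2]) +
    (Real.sqrt P.det / Real.sqrt (minor22 P).det) • normalVec p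

lemma normalVec_dot (p : Matrix (Fin 3) (Fin 2) ℝ) (j : Fin 2) : normalVec p ⬝ᵥ pᵀ j = 0 := by
  have h0 := dot_self_cross (pᵀ 0) (pᵀ 1)
  have h1 := dot_cross_self (pᵀ 0) (pᵀ 1)
  rw [normalVec, smul_dotProduct, dotProduct_comm (crossProduct (pᵀ 0) (pᵀ 1)) (pᵀ j)]
  fin_cases j
  · simp [h0]
  · simp [h1]

lemma normalVec_dot_self (hP : P.PosDef) (hp : pᵀ * p = minor22 P) :
    normalVec p ⬝ᵥ normalVec p = 1 := by
  have h := (minor22_posDef hP).det_pos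
  rw [normalVec, smul_dotProduct, dotProduct_smul, cross_dot_cross_eq_det hp, smul_eq_mul,
    smul_eq_mul]
  have h2 := Real.mul_self_sqrt h.le
  have h3 : Real.sqrt (minor22 P).det ≠ 0 := (Real.sqrt_pos.2 h).ne'
  field_simp
  rw [pow_two, h2]

lemma transpose_mulVec_mulVec (hP : P.PosDef) (hp : pᵀ * p = minor22 P) (v : Fin 2 → ℝ) :
    pᵀ *ᵥ (p *ᵥ ((minor22 P)⁻¹ *ᵥ v)) = v := by
  rw [Matrix.mulVec_mulVec, hp, Matrix.mulVec_mulVec,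
    Matrix.mul_nonsing_inv _ (minor22_posDef hP).det_pos.ne'.isUnit, Matrix.one_mulVec]

lemma dot_cosseratVec (hP : P.PosDef) (hp : pᵀ * p = minor22 P) (j : Fin 2) :
    pᵀ j ⬝ᵥ cosseratVec P p = P j.castSucc 2 := by
  rw [cosseratVec, dotProduct_add, dotProduct_smul, dotProduct_comm _ (normalVec p),
    normalVec_dot, smul_zero, add_zero]
  have := congrFun (transpose_mulVec_mulVec hP hp ![P 0 2, P 1 2]) j
  refine this.trans ?_
  fin_cases j <;> rfl

lemma normalVec_dot_cosseratVec (hP : P.PosDef) (hp : pᵀ * p = minor22 P) :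
    normalVec p ⬝ᵥ cosseratVec P p = Real.sqrt P.det / Real.sqrt (minor22 P).det := by
  rw [cosseratVec, dotProduct_add, dotProduct_smul, normalVec_dot_self hP hp, smul_eq_mul,
    mul_one, add_eq_right, Matrix.dotProduct_mulVec]
  have : normalVec p ᵥ* p = 0 := by
    ext j; exact normalVec_dot p j
  rw [this, zero_dotProduct]

/-- The Schur complement: `det P / det P_{2×2} = P₃₃ - vᵀ (P_{2×2})⁻¹ v` with `v = (P₁₃, P₂₃)`. This
explains the coefficient of the normal in `b`. -/
lemma cosseratVec_dot_self (hP : P.PosDef) (hp : pᵀ * p = minor22 P) :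
    cosseratVec P p ⬝ᵥ cosseratVec P p = P 2 2 := by
  have hd := (minor22_posDef hP).det_pos
  have hs : ∀ a b, P a b = P b a := fun a b ↦ by simpa using (hP.isHermitian.apply a b).symm
  set v : Fin 2 → ℝ := ![P 0 2, P 1 2] with hv
  have h1 : cosseratVec P p ⬝ᵥ cosseratVec P p =
      ((minor22 P)⁻¹ *ᵥ v) ⬝ᵥ v + P.det / (minor22 P).det := by
    nth_rw 1 [cosseratVec]
    rw [add_dotProduct, smul_dotProduct, normalVec_dot_cosseratVec hP hp, smul_eq_mul,
      div_mul_div_comm, Real.mul_self_sqrt hP.det_pos.le, Real.mul_self_sqrt hd.le,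
      ← Matrix.vecMul_transpose, ← Matrix.dotProduct_mulVec]
    congr 2
    ext j
    refine (dot_cosseratVec hP hp j).trans ?_
    fin_cases j <;> rfl
  rw [h1, Matrix.inv_def, Ring.inverse_eq_inv', Matrix.adjugate_fin_two, hv]
  rw [Matrix.det_fin_two] at hd ⊢
  rw [Matrix.det_fin_three]
  simp only [minor22, Matrix.submatrix_apply, Fin.castSucc_zero, Fin.castSucc_one] at hd ⊢
  rw [hs 1 0] at hd
  rw [hs 2 0, hs 2 1, hs 1 0]
  have hne : P 0 0 * P 1 1 - P 0 1 ^ 2 ≠ 0 := by rw [pow_two]; exact hd.ne'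
  simp only [Matrix.mulVec, dotProduct, Fin.sum_univ_two, Matrix.smul_apply, Matrix.of_apply,
    Matrix.cons_val_zero, Matrix.cons_val_one, smul_eq_mul]
  field_simp
  ring

lemma colMatrix_cosserat_gram (hP : P.PosDef) (hp : pᵀ * p = minor22 P) :
    (colMatrix p (cosseratVec P p))ᵀ * colMatrix p (cosseratVec P p) = P := by
  have hs : ∀ a b, P a b = P b a := fun a b ↦ by simpa using (hP.isHermitian.apply a b).symm
  set Q := colMatrix p (cosseratVec P p) with hQ
  have hc : ∀ a b, (Qᵀ * Q) a b = Qᵀ a ⬝ᵥ Qᵀ b := fun a b ↦ rfl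
  have h1 : ∀ j : Fin 2, Qᵀ j.castSucc = pᵀ j := fun j ↦ by
    ext k; exact colMatrix_castSucc _ _ k j
  have h2 : Qᵀ (Fin.last 2) = cosseratVec P p := rfl
  ext a b
  rw [hc]
  induction a using Fin.lastCases with
  | last =>
    induction b using Fin.lastCases with
    | last => rw [h2]; exact cosseratVec_dot_self hP hp
    | cast b => rw [h1, h2, dotProduct_comm, hs]; exact dot_cosseratVec hP hp b
  | cast a =>
    induction b using Fin.lastCases with
    | last => rw [h1, h2]; exact dot_cosseratVec hP hp a
    | cast b => rw [h1, h1]; exact congrFun (congrFun hp a) b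

lemma det_colMatrix_cosserat_pos (hP : P.PosDef) (hp : pᵀ * p = minor22 P) :
    0 < (colMatrix p (cosseratVec P p)).det := by
  have hd := (minor22_posDef hP).det_pos
  have h1 := normalVec_dot_cosseratVec hP hp
  rw [normalVec, smul_dotProduct, cross_dot_cross_eq_det hp, smul_eq_mul,
    inv_mul_eq_div, div_left_inj' (Real.sqrt_pos.2 hd).ne'] at h1
  rw [det_colMatrix, h1]
  exact Real.sqrt_pos.2 hP.det_pos

lemma inv_two_two_eq (P : Matrix (Fin 3) (Fin 3) ℝ) :
    P⁻¹ 2 2 = (minor22 P).det / P.det := by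
  rw [Matrix.inv_def, Ring.inverse_eq_inv', Matrix.adjugate_fin_three, Matrix.det_fin_two]
  simp [minor22]
  field_simp

/-- The unit normal in terms of the frame. -/
lemma normalVec_dot_eq (hP : P.PosDef) (hp : pᵀ * p = minor22 P) (v : Fin 3 → ℝ) :
    normalVec p ⬝ᵥ v = 1 / Real.sqrt (P⁻¹ 2 2) *
      (P⁻¹ *ᵥ ((colMatrix p (cosseratVec P p))ᵀ *ᵥ v)) 2 := by
  have hd := (minor22_posDef hP).det_pos
  have hgram := colMatrix_cosserat_gram hP hp
  set Q := colMatrix p (cosseratVec P p) with hQ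
  -- The normal is orthogonal to the first two columns, so pairing with it extracts the third
  -- coordinate in the frame.
  have hQN : Qᵀ *ᵥ normalVec p =
      Pi.single 2 (Real.sqrt P.det / Real.sqrt (minor22 P).det) := by
    ext j
    induction j using Fin.lastCases with
    | last =>
      change cosseratVec P p ⬝ᵥ normalVec p = _
      rw [dotProduct_comm, normalVec_dot_cosseratVec hP hp]
      simp
    | cast j =>
      have : (Qᵀ *ᵥ normalVec p) j.castSucc = pᵀ j ⬝ᵥ normalVec p := by
        simp only [Matrix.mulVec]
        congr 1
        ext k; exact colMatrix_castSucc _ _ k j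
      rw [this, dotProduct_comm, normalVec_dot]
      fin_cases j <;> simp
  have hleft : (P⁻¹ * Qᵀ) * Q = 1 := by
    rw [Matrix.mul_assoc, hgram, Matrix.nonsing_inv_mul _ hP.det_pos.ne'.isUnit]
  have hright : Q * (P⁻¹ * Qᵀ) = 1 := mul_eq_one_comm.1 hleft
  have hw : 1 / Real.sqrt (P⁻¹ 2 2) = Real.sqrt P.det / Real.sqrt (minor22 P).det := by
    rw [inv_two_two_eq, Real.sqrt_div hd.le, one_div_div]
  calc normalVec p ⬝ᵥ v = normalVec p ⬝ᵥ (Q *ᵥ (P⁻¹ *ᵥ (Qᵀ *ᵥ v))) := by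
        rw [Matrix.mulVec_mulVec, Matrix.mulVec_mulVec, Matrix.mul_assoc, hright,
          Matrix.one_mulVec]
    _ = (Qᵀ *ᵥ normalVec p) ⬝ᵥ (P⁻¹ *ᵥ (Qᵀ *ᵥ v)) := by
        rw [Matrix.dotProduct_mulVec, Matrix.mulVec_transpose Q (normalVec p)]
    _ = _ := by rw [hQN, single_dotProduct, hw]

end Pointwise

end Frame

/-! ### Weakly differentiable frames and their defect from being parallel -/

section AEFrame

open Filter Topology

variable {Ω : Set Plane} {G : Plane → Matrix (Fin 3) (Fin 3) ℝ}
  {Q : Plane → Matrix (Fin 3) (Fin 3) ℝ} {y b : Plane → Fin 3 → ℝ} {f f₁ : Plane → ℝ}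

/-! ### Regularity of the gradient and of the Cosserat vector -/

lemma MemW12.congr (h : MemW12 Ω f) (hf : f =ᵐ[volume.restrict Ω] f₁) : MemW12 Ω f₁ :=
  ⟨h.1.ae_eq hf, fun i ↦ let ⟨g, hg, hw⟩ := h.2 i; ⟨g, hg, hw.congr hf .rfl⟩⟩

lemma MemW22.isWeakPartial (h : MemW22 Ω f) (i : Fin 2) :
    IsWeakPartial Ω i f (weakPartial Ω i f) :=
  let ⟨_, _, hw⟩ := h.2 i
  hw.weakPartial

lemma MemW22.memW12_weakPartial (hΩ : IsOpen Ω) (h : MemW22 Ω f) (i : Fin 2) :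
    MemW12 Ω (weakPartial Ω i f) :=
  let ⟨_, hg, hw⟩ := h.2 i
  hg.congr (hw.weakPartial_ae_eq hΩ).symm

/-- `f` is essentially bounded on `Ω` and has weak partial derivatives in `L²(Ω)`. -/
def IsBddW12 (Ω : Set Plane) (f : Plane → ℝ) : Prop := ∃ f', HasBddW12 Ω f f'

lemma IsBddW12.mul (hΩ : IsOpen Ω) (h : IsBddW12 Ω f) (h₁ : IsBddW12 Ω f₁) :
    IsBddW12 Ω fun x ↦ f x * f₁ x :=
  let ⟨_, h⟩ := h; let ⟨_, h₁⟩ := h₁; ⟨_, h.mul hΩ h₁⟩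

lemma IsBddW12.add (h : IsBddW12 Ω f) (h₁ : IsBddW12 Ω f₁) : IsBddW12 Ω fun x ↦ f x + f₁ x :=
  let ⟨_, h⟩ := h; let ⟨_, h₁⟩ := h₁; ⟨_, h.add h₁⟩

lemma IsBddW12.congr (h : IsBddW12 Ω f) (hf : f =ᵐ[volume.restrict Ω] f₁) : IsBddW12 Ω f₁ :=
  let ⟨_, h⟩ := h; ⟨_, h.congr hf⟩

lemma isBddW12_of_contDiffOn (hΩ : IsOpen Ω) (hb : Bornology.IsBounded Ω)
    (hf : ContDiffOn ℝ ∞ f (closure Ω)) : IsBddW12 Ω f :=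
  ⟨_, hasBddW12_of_contDiffOn_closure hΩ hb hf⟩

lemma IsBddW12.sub (hΩ : IsOpen Ω) (hb : Bornology.IsBounded Ω) (h : IsBddW12 Ω f)
    (h₁ : IsBddW12 Ω f₁) : IsBddW12 Ω fun x ↦ f x - f₁ x := by
  have := h.add ((isBddW12_of_contDiffOn hΩ hb (contDiffOn_const (c := (-1 : ℝ)))).mul hΩ h₁)
  simpa only [neg_mul, one_mul, ← sub_eq_add_neg] using this

lemma abs_apply_le_of_gram {m n : Type*} [Fintype m] {A : Matrix m n ℝ}
    (k : m) (j : n) : |A k j| ≤ 1 + (Aᵀ * A) j j := by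
  have h : A k j * A k j ≤ (Aᵀ * A) j j := by
    rw [Matrix.mul_apply]
    exact Finset.single_le_sum (f := fun k ↦ Aᵀ j k * A k j)
      (fun k _ ↦ mul_self_nonneg (A k j)) (Finset.mem_univ k)
  rw [abs_le]
  constructor <;> nlinarith [mul_self_nonneg (A k j - 1), mul_self_nonneg (A k j + 1)]

lemma ae_mem (hΩ : IsOpen Ω) : ∀ᵐ x ∂volume.restrict Ω, x ∈ Ω := ae_restrict_mem hΩ.measurableSet

lemma IsPlateMetric.exists_bound_apply (hb : Bornology.IsBounded Ω) (hG : IsPlateMetric Ω G)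
    (i j : Fin 3) : ∃ C, ∀ x ∈ Ω, 1 + G x i j ≤ C := by
  obtain ⟨C, hC⟩ := exists_bound_of_contDiffOn_closure hb (hG.smooth i j)
  exact ⟨1 + C, fun x hx ↦ by linarith [(abs_le.1 (hC x hx)).2]⟩

lemma IsIsometricImmersion.hasBddW12 (hΩ : IsOpen Ω) (hb : Bornology.IsBounded Ω)
    (hG : IsPlateMetric Ω G) (hy : IsIsometricImmersion Ω G y) (k : Fin 3) (j : Fin 2) :
    HasBddW12 Ω (fun x ↦ grad Ω y x k j) fun i ↦ weakPartial Ω i fun x ↦ grad Ω y x k j := by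
  obtain ⟨C, hC⟩ := hG.exists_bound_apply hb j.castSucc j.castSucc
  refine ((hy.1 k).memW12_weakPartial hΩ j).hasBddW12 hΩ (C := C) ?_
  filter_upwards [hy.2, ae_mem hΩ] with x h1 h2
  refine (abs_apply_le_of_gram (A := grad Ω y x) k j).trans ?_
  rw [h1]
  exact hC x h2

lemma IsPlateMetric.contDiffOn_det_minor22 (hG : IsPlateMetric Ω G) :
    ContDiffOn ℝ ∞ (fun x ↦ (minor22 (G x)).det) (closure Ω) := by
  have h := hG.smooth
  simp only [Matrix.det_fin_two, minor22, Matrix.submatrix_apply]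
  fun_prop

lemma IsPlateMetric.contDiffOn_sqrt_det_minor22 (hG : IsPlateMetric Ω G) :
    ContDiffOn ℝ ∞ (fun x ↦ (Real.sqrt (minor22 (G x)).det)⁻¹) (closure Ω) := by
  have h : ∀ x ∈ closure Ω, 0 < (minor22 (G x)).det := fun x hx ↦
    (minor22_posDef (hG.posDef x hx)).det_pos
  exact (hG.contDiffOn_det_minor22.sqrt fun x hx ↦ (h x hx).ne').inv
    fun x hx ↦ (Real.sqrt_pos.2 (h x hx)).ne'

/-- The length `|∂₁y × ∂₂y| = √(det G_{2×2})` is a smooth positive function, so the normal is a.e. a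
polynomial in `∇y` with smooth coefficients. -/
lemma isBddW12_unitNormal (hΩ : IsOpen Ω) (hb : Bornology.IsBounded Ω)
    (hG : IsPlateMetric Ω G) (hy : IsIsometricImmersion Ω G y) (k : Fin 3) :
    IsBddW12 Ω fun x ↦ unitNormal Ω y x k := by
  have hp : ∀ k j, IsBddW12 Ω fun x ↦ grad Ω y x k j := fun k j ↦ ⟨_, hy.hasBddW12 hΩ hb hG k j⟩
  have hcross : IsBddW12 Ω fun x ↦
      crossProduct ((grad Ω y x)ᵀ 0) ((grad Ω y x)ᵀ 1) k := by
    simp only [cross_apply]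
    fin_cases k
    · exact ((hp 1 0).mul hΩ (hp 2 1)).sub hΩ hb ((hp 2 0).mul hΩ (hp 1 1))
    · exact ((hp 2 0).mul hΩ (hp 0 1)).sub hΩ hb ((hp 0 0).mul hΩ (hp 2 1))
    · exact ((hp 0 0).mul hΩ (hp 1 1)).sub hΩ hb ((hp 1 0).mul hΩ (hp 0 1))
  refine ((isBddW12_of_contDiffOn hΩ hb hG.contDiffOn_sqrt_det_minor22).mul hΩ hcross).congr ?_
  filter_upwards [hy.2] with x hx
  simp only [unitNormal, cross_dot_cross_eq_det hx, Pi.smul_apply, smul_eq_mul]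

lemma isBddW12_cosserat (hΩ : IsOpen Ω) (hb : Bornology.IsBounded Ω)
    (hG : IsPlateMetric Ω G) (hy : IsIsometricImmersion Ω G y) (k : Fin 3) :
    IsBddW12 Ω fun x ↦ cosserat Ω G y x k := by
  have hp : ∀ k j, IsBddW12 Ω fun x ↦ grad Ω y x k j := fun k j ↦ ⟨_, hy.hasBddW12 hΩ hb hG k j⟩
  have hd : ∀ x ∈ closure Ω, (minor22 (G x)).det ≠ 0 := fun x hx ↦
    (minor22_posDef (hG.posDef x hx)).det_pos.ne'
  have hc : ∀ j : Fin 2, IsBddW12 Ω fun x ↦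
      ((minor22 (G x))⁻¹ *ᵥ ![G x 0 2, G x 1 2]) j := fun j ↦ by
    refine isBddW12_of_contDiffOn hΩ hb ?_
    have hs := hG.smooth
    have hi : ContDiffOn ℝ ∞ (fun x ↦ (minor22 (G x)).det⁻¹) (closure Ω) :=
      hG.contDiffOn_det_minor22.inv hd
    simp only [Matrix.inv_def, Ring.inverse_eq_inv', Matrix.adjugate_fin_two, Matrix.mulVec,
      dotProduct, Fin.sum_univ_two, Matrix.smul_apply, smul_eq_mul, Matrix.of_apply]
    fin_cases j
    · simp [minor22] at hi ⊢; fun_prop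
    · simp [minor22] at hi ⊢; fun_prop
  have hn : IsBddW12 Ω fun x ↦ Real.sqrt (G x).det / Real.sqrt (minor22 (G x)).det := by
    refine isBddW12_of_contDiffOn hΩ hb ?_
    simp only [div_eq_mul_inv]
    exact (hG.contDiffOn_det.sqrt fun x hx ↦ (hG.posDef x hx).det_pos.ne').mul
      hG.contDiffOn_sqrt_det_minor22
  refine ((((hp k 0).mul hΩ (hc 0)).add ((hp k 1).mul hΩ (hc 1))).add
    (hn.mul hΩ (isBddW12_unitNormal hΩ hb hG hy k))).congr (Eventually.of_forall fun x ↦ ?_)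
  simp only [cosserat, Pi.add_apply, Pi.smul_apply, smul_eq_mul]
  congr 1
  exact (Fin.sum_univ_two fun j ↦ grad Ω y x k j *
    ((minor22 (G x))⁻¹ *ᵥ ![G x 0 2, G x 1 2]) j).symm

/-! ### Weakly differentiable frames -/

/-- The weak partial derivative of a matrix field. -/
noncomputable def wmat (Ω : Set Plane) (i : Fin 2) (Q : Plane → Matrix (Fin 3) (Fin 3) ℝ)
    (x : Plane) : Matrix (Fin 3) (Fin 3) ℝ :=
  Matrix.of fun k j ↦ weakPartial Ω i (fun z ↦ Q z k j) x

/-- A bounded weakly differentiable frame with Gram matrix `G` whose first two columns form a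
gradient. -/
structure IsFrame (Ω : Set Plane) (G Q : Plane → Matrix (Fin 3) (Fin 3) ℝ) : Prop where
  hasBddW12 : ∀ k j, HasBddW12 Ω (fun x ↦ Q x k j) fun i ↦ weakPartial Ω i fun x ↦ Q x k j
  gram : ∀ᵐ x ∂volume.restrict Ω, (Q x)ᵀ * Q x = G x
  closed : ∀ᵐ x ∂volume.restrict Ω, ∀ (i j : Fin 2) (k : Fin 3),
    wmat Ω i Q x k j.castSucc = wmat Ω j Q x k i.castSucc

/-- The matrix field with the columns `∂₁y, ∂₂y, b`. -/
noncomputable def frame (Ω : Set Plane) (y b : Plane → Fin 3 → ℝ) (x : Plane) :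
    Matrix (Fin 3) (Fin 3) ℝ :=
  colMatrix (grad Ω y x) (b x)

/-- The Gram matrix bounds the entries of the frame, and commuting weak derivatives of `y` give the
compatibility of the first two columns. -/
lemma isFrame_frame (hΩ : IsOpen Ω) (hbd : Bornology.IsBounded Ω) (hG : IsPlateMetric Ω G)
    (hy : ∀ k, MemW22 Ω fun x ↦ y x k) (hb : ∀ k, MemW12 Ω fun x ↦ b x k)
    (hgram : ∀ᵐ x ∂volume.restrict Ω, (frame Ω y b x)ᵀ * frame Ω y b x = G x) :
    IsFrame Ω G (frame Ω y b) := by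
  have hcol : ∀ k (j : Fin 2), (fun x ↦ frame Ω y b x k j.castSucc) =
      weakPartial Ω j fun x ↦ y x k := fun k j ↦ by
    ext x; exact colMatrix_castSucc _ _ k j
  have hreg : ∀ k j, MemW12 Ω fun x ↦ frame Ω y b x k j := fun k j ↦ by
    induction j using Fin.lastCases with
    | last => exact hb k
    | cast j => rw [hcol]; exact (hy k).memW12_weakPartial hΩ j
  refine ⟨fun k j ↦ ?_, hgram, ?_⟩
  · obtain ⟨C, hC⟩ := hG.exists_bound_apply hbd j j
    refine (hreg k j).hasBddW12 hΩ (C := C) ?_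
    filter_upwards [hgram, ae_mem hΩ] with x h1 h2
    refine (abs_apply_le_of_gram (A := frame Ω y b x) k j).trans ?_
    rw [h1]
    exact hC x h2
  · simp only [ae_all_iff]
    intro i j k
    simp only [wmat, Matrix.of_apply, hcol]
    obtain ⟨_, _, h1⟩ := ((hy k).memW12_weakPartial hΩ i).2 j
    obtain ⟨_, _, h2⟩ := ((hy k).memW12_weakPartial hΩ j).2 i
    exact ((hy k).isWeakPartial j).comm hΩ ((hy k).isWeakPartial i) h2.weakPartial
      h1.weakPartial

lemma IsFrame.transpose_mul_wmat (hΩ : IsOpen Ω) (hbd : Bornology.IsBounded Ω)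
    (hG : IsPlateMetric Ω G) (hQ : IsFrame Ω G Q) : ∀ᵐ x ∂volume.restrict Ω, ∀ i,
      (Q x)ᵀ * wmat Ω i Q x + ((Q x)ᵀ * wmat Ω i Q x)ᵀ = dmat i G x := by
  have key : ∀ a b i, ∀ᵐ x ∂volume.restrict Ω,
      ∑ k, (Q x k a * weakPartial Ω i (fun z ↦ Q z k b) x +
        weakPartial Ω i (fun z ↦ Q z k a) x * Q x k b) = fderiv ℝ (fun z ↦ G z a b) x (e i) :=
    fun a b i ↦ by
    have h1 := HasBddW12.sum Finset.univ fun k _ ↦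
      (hQ.hasBddW12 k a).mul hΩ (hQ.hasBddW12 k b)
    refine h1.unique hΩ (hasBddW12_of_contDiffOn_closure hΩ hbd (hG.smooth a b)) ?_ i
    filter_upwards [hQ.gram] with x hx
    rw [← hx, Matrix.mul_apply]
    rfl
  rw [ae_all_iff]
  intro i
  have key' : ∀ᵐ x ∂volume.restrict Ω, ∀ a b,
      ∑ k, (Q x k a * weakPartial Ω i (fun z ↦ Q z k b) x +
        weakPartial Ω i (fun z ↦ Q z k a) x * Q x k b) = fderiv ℝ (fun z ↦ G z a b) x (e i) := by
    simp only [ae_all_iff]; exact fun a b ↦ key a b i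
  filter_upwards [key'] with x hx
  ext a b
  rw [Matrix.add_apply, Matrix.transpose_apply, Matrix.mul_apply, Matrix.mul_apply,
    ← Finset.sum_add_distrib, dmat, Matrix.of_apply, ← hx]
  exact Finset.sum_congr rfl fun k _ ↦ by
    simp only [wmat, Matrix.transpose_apply, Matrix.of_apply]; ring

/-- The deviation of a frame from being parallel. -/
noncomputable def defect (Ω : Set Plane) (G Q : Plane → Matrix (Fin 3) (Fin 3) ℝ) (x : Plane)
    (i : Fin 2) : Matrix (Fin 3) (Fin 3) ℝ :=
  (Q x)ᵀ * wmat Ω i Q x - G x * conn G i x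

/-- The frame is parallel along the midplate. -/
def IsParallel (Ω : Set Plane) (G Q : Plane → Matrix (Fin 3) (Fin 3) ℝ) : Prop :=
  ∀ᵐ x ∂volume.restrict Ω, ∀ i, wmat Ω i Q x = Q x * conn G i x

/-- Skewness compares the weak product rule for `QᵀQ = G` with metric compatibility of `Γ`; the
symmetry compares closedness of the gradient columns with vanishing torsion. -/
lemma IsFrame.defect_spec (hΩ : IsOpen Ω) (hbd : Bornology.IsBounded Ω)
    (hG : IsPlateMetric Ω G) (hQ : IsFrame Ω G Q) : ∀ᵐ x ∂volume.restrict Ω,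
      (∀ i, defect Ω G Q x i + (defect Ω G Q x i)ᵀ = 0) ∧
      ∀ (i j : Fin 2) k, defect Ω G Q x i k j.castSucc = defect Ω G Q x j k i.castSucc := by
  filter_upwards [hQ.transpose_mul_wmat hΩ hbd hG, hQ.closed, ae_mem hΩ] with x h1 h2 hx
  refine ⟨fun i ↦ ?_, fun i j k ↦ ?_⟩
  · rw [defect, Matrix.transpose_sub, sub_add_sub_comm, h1 i,
      hG.mul_conn_add_transpose hΩ hx, sub_self]
  · simp only [defect, Matrix.sub_apply, Matrix.mul_apply, h2 i j, hG.conn_symm hΩ hx i j]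

lemma IsFrame.defect_eq_zero_iff (hΩ : IsOpen Ω) (hG : IsPlateMetric Ω G) (hQ : IsFrame Ω G Q) :
    ∀ᵐ x ∂volume.restrict Ω, ∀ i,
      defect Ω G Q x i = 0 ↔ wmat Ω i Q x = Q x * conn G i x := by
  filter_upwards [hQ.gram, ae_mem hΩ] with x h hx i
  have hd : IsUnit (Q x)ᵀ := by
    have h1 := hG.isUnit_det (subset_closure hx)
    rw [← h, Matrix.det_mul] at h1
    exact (Matrix.isUnit_iff_isUnit_det _).2 (isUnit_of_mul_isUnit_left h1)
  rw [defect, sub_eq_zero, ← h, Matrix.mul_assoc, hd.mul_right_inj]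

lemma IsFrame.isParallel_iff (hΩ : IsOpen Ω) (hbd : Bornology.IsBounded Ω)
    (hG : IsPlateMetric Ω G) (hQ : IsFrame Ω G Q) : IsParallel Ω G Q ↔
      ∀ᵐ x ∂volume.restrict Ω, ∀ i j : Fin 2, defect Ω G Q x i 2 j.castSucc = 0 := by
  refine eventually_congr ?_
  filter_upwards [hQ.defect_spec hΩ hbd hG, hQ.defect_eq_zero_iff hΩ hG] with x h1 h2
  simp only [← h2]
  exact eq_zero_iff_of_skew h1.1 h1.2

lemma transpose_grad_mul_grad_apply (x : Plane) (j i : Fin 2) :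
    ((grad Ω y x)ᵀ * grad Ω b x) j i =
      ((frame Ω y b x)ᵀ * wmat Ω i (frame Ω y b) x) j.castSucc 2 := by
  simp only [Matrix.mul_apply, Matrix.transpose_apply, frame, colMatrix_castSucc]
  rfl

/-- The frame `(∂₁y, ∂₂y, b)` is parallel if and only if `(∇y)ᵀ∇b` is skew. -/
lemma isParallel_frame_iff (hΩ : IsOpen Ω) (hbd : Bornology.IsBounded Ω)
    (hG : IsPlateMetric Ω G) (hQ : IsFrame Ω G (frame Ω y b)) :
    IsParallel Ω G (frame Ω y b) ↔ ∀ᵐ x ∂volume.restrict Ω,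
      (grad Ω y x)ᵀ * grad Ω b x + ((grad Ω y x)ᵀ * grad Ω b x)ᵀ = 0 := by
  rw [hQ.isParallel_iff hΩ hbd hG]
  refine eventually_congr ?_
  filter_upwards [hQ.defect_spec hΩ hbd hG, ae_mem hΩ] with x ⟨h1, h2⟩ hx
  -- The last column of `Qᵀ∂_i Q` contains `(∇y)ᵀ∂_i b`. On symmetrizing, the connection terms
  -- cancel, and the defect entries are equal by their symmetry in `i, j`.
  have h3 : ∀ i j : Fin 2, ((grad Ω y x)ᵀ * grad Ω b x +
      ((grad Ω y x)ᵀ * grad Ω b x)ᵀ) j i = -2 * defect Ω G (frame Ω y b) x i 2 j.castSucc := by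
    intro i j
    have e1 : ∀ i j : Fin 2, defect Ω G (frame Ω y b) x i j.castSucc 2 =
        -defect Ω G (frame Ω y b) x i 2 j.castSucc := fun i j ↦ by
      have := congrFun (congrFun (h1 i) j.castSucc) 2
      simp only [Matrix.add_apply, Matrix.transpose_apply, Matrix.zero_apply] at this
      linarith
    have e2 := e1 i j
    have e3 := e1 j i
    rw [h2 j i] at e3
    have e4 := hG.mul_conn_skew (subset_closure hx) i j
    simp only [defect, Matrix.sub_apply] at e2 e3 ⊢
    rw [Matrix.add_apply, Matrix.transpose_apply, transpose_grad_mul_grad_apply,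
      transpose_grad_mul_grad_apply]
    linarith
  rw [← Matrix.ext_iff]
  simp only [h3, Matrix.zero_apply]
  exact ⟨fun h j i ↦ by rw [h]; simp, fun h i j ↦ by have := h j i; linarith⟩

end AEFrame

/-! ### The three immersion conditions as parallelism of the frame, and its curvature obstruction -/

section Immersion

open Filter Topology

variable {Ω : Set Plane} {G : Plane → Matrix (Fin 3) (Fin 3) ℝ}
  {Q : Plane → Matrix (Fin 3) (Fin 3) ℝ} {y b : Plane → Fin 3 → ℝ}
  {W : Matrix (Fin 3) (Fin 3) ℝ → ℝ≥0∞}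

lemma IsIsometricImmersion.cosserat_spec (hΩ : IsOpen Ω) (hG : IsPlateMetric Ω G)
    (hy : IsIsometricImmersion Ω G y) : ∀ᵐ x ∂volume.restrict Ω,
      0 < (frame Ω y (cosserat Ω G y) x).det ∧
      (frame Ω y (cosserat Ω G y) x)ᵀ * frame Ω y (cosserat Ω G y) x = G x := by
  filter_upwards [hy.2, ae_mem hΩ] with x h hx
  have hP := hG.posDef x (subset_closure hx)
  exact ⟨det_colMatrix_cosserat_pos hP h, colMatrix_cosserat_gram hP h⟩

lemma IsIsometricImmersion.memW12_cosserat (hΩ : IsOpen Ω) (hb : Bornology.IsBounded Ω)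
    (hG : IsPlateMetric Ω G) (hy : IsIsometricImmersion Ω G y) (k : Fin 3) :
    MemW12 Ω fun x ↦ cosserat Ω G y x k :=
  let ⟨_, h⟩ := isBddW12_cosserat hΩ hb hG hy k
  h.memW12 hb

lemma IsIsometricImmersion.isFrame (hΩ : IsOpen Ω) (hb : Bornology.IsBounded Ω)
    (hG : IsPlateMetric Ω G) (hy : IsIsometricImmersion Ω G y) :
    IsFrame Ω G (frame Ω y (cosserat Ω G y)) :=
  isFrame_frame hΩ hb hG hy.1 (hy.memW12_cosserat hΩ hb hG)
    ((hy.cosserat_spec hΩ hG).mono fun _ h ↦ h.2)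

/-! ### Skewness of `(∇y)ᵀ∇b` -/

lemma half_smul_eq_zero_iff {F : Matrix (Fin 2) (Fin 2) ℝ} :
    (1 / 2 : ℝ) • F = 0 ↔ F = 0 := by simp

lemma hasSymFreeImmersion_iff (hΩ : IsOpen Ω) (hbd : Bornology.IsBounded Ω)
    (hG : IsPlateMetric Ω G) : HasSymFreeImmersion Ω G ↔
      ∃ y, IsIsometricImmersion Ω G y ∧ IsParallel Ω G (frame Ω y (cosserat Ω G y)) := by
  simp only [HasSymFreeImmersion, half_smul_eq_zero_iff]
  constructor
  · rintro ⟨y, hy, b, -, hQ, hs⟩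
    have hbc : b =ᵐ[volume.restrict Ω] cosserat Ω G y := by
      filter_upwards [hQ, hy.cosserat_spec hΩ hG] with x h1 h2
      exact colMatrix_injective h1.1 h2.1 (h1.2.trans h2.2.symm)
    have hgrad : grad Ω b = grad Ω (cosserat Ω G y) := by
      ext x k i
      exact congrFun (weakPartial_congr (hbc.mono fun z hz ↦ congrFun hz k)) x
    rw [hgrad] at hs
    exact ⟨y, hy, (isParallel_frame_iff hΩ hbd hG (hy.isFrame hΩ hbd hG)).2 hs⟩
  · rintro ⟨y, hy, hp⟩
    exact ⟨y, hy, _, hy.memW12_cosserat hΩ hbd hG, hy.cosserat_spec hΩ hG,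
      (isParallel_frame_iff hΩ hbd hG (hy.isFrame hΩ hbd hG)).1 hp⟩

/-! ### The second fundamental form -/

/-- The weak derivative of `N · ∂_i y = 0`. -/
lemma IsIsometricImmersion.secondForm_eq (hΩ : IsOpen Ω) (hbd : Bornology.IsBounded Ω)
    (hG : IsPlateMetric Ω G) (hy : IsIsometricImmersion Ω G y) :
    ∀ᵐ x ∂volume.restrict Ω, ∀ i j : Fin 2, secondForm Ω y x i j =
      -(unitNormal Ω y x ⬝ᵥ fun k ↦ wmat Ω j (frame Ω y (cosserat Ω G y)) x k i.castSucc) := by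
  simp only [ae_all_iff]
  intro i j
  have hN := fun k ↦ (isBddW12_unitNormal hΩ hbd hG hy k).choose_spec
  have hsum := HasBddW12.sum Finset.univ fun k _ ↦ (hN k).mul hΩ (hy.hasBddW12 hΩ hbd hG k i)
  have h0 := hsum.unique hΩ
    (hasBddW12_of_contDiffOn_closure hΩ hbd (contDiffOn_const (c := (0 : ℝ))))
    (Eventually.of_forall fun x ↦ normalVec_dot (grad Ω y x) i) j
  have hN' : ∀ᵐ x ∂volume.restrict Ω, ∀ k, weakPartial Ω j (fun z ↦ unitNormal Ω y z k) x =
      (isBddW12_unitNormal hΩ hbd hG hy k).choose j x :=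
    ae_all_iff.2 fun k ↦ (hN k).weakPartial_ae_eq hΩ j
  filter_upwards [h0, hN'] with x h1 h2
  simp only [← h2, fderiv_fun_const, Pi.zero_apply, zero_apply,
    Finset.sum_add_distrib] at h1
  have hcol : ∀ k, (fun z ↦ frame Ω y (cosserat Ω G y) z k i.castSucc) =
      fun z ↦ grad Ω y z k i := fun k ↦ by
    ext z; exact colMatrix_castSucc _ _ k i
  simp only [secondForm, Matrix.mul_apply, Matrix.transpose_apply, wmat, Matrix.of_apply, hcol,
    dotProduct]
  rw [← add_eq_zero_iff_eq_neg, add_comm, ← h1]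
  congr 1
  exact Finset.sum_congr rfl fun k _ ↦ mul_comm _ _

/-- The normal part of `∂_j∂_i y` is the third entry of column `i` of `G⁻¹Qᵀ∂_j Q = Γ_j + G⁻¹E_j`,
divided by `√G³³`. That column of `E_j` has only a third entry, so the deviation is a nonzero
multiple of `(E_j)_{3i}`. -/
lemma IsIsometricImmersion.secondForm_eq_iff (hΩ : IsOpen Ω) (hbd : Bornology.IsBounded Ω)
    (hG : IsPlateMetric Ω G) (hy : IsIsometricImmersion Ω G y) :
    (∀ᵐ x ∂volume.restrict Ω, ∀ i j : Fin 2, secondForm Ω y x i j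
      = -(1 / Real.sqrt ((G x)⁻¹ 2 2)) * christoffel G 2 i.castSucc j.castSucc x) ↔
      IsParallel Ω G (frame Ω y (cosserat Ω G y)) := by
  have hQ := hy.isFrame hΩ hbd hG
  rw [hQ.isParallel_iff hΩ hbd hG]
  refine eventually_congr ?_
  filter_upwards [hQ.defect_spec hΩ hbd hG, hy.secondForm_eq hΩ hbd hG, hy.2, ae_mem hΩ]
    with x ⟨h1, h2⟩ h3 h4 hx
  have hP := hG.posDef x (subset_closure hx)
  have hpos : 0 < (G x)⁻¹ 2 2 := hP.inv.diag_pos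
  have hsq := Real.sqrt_pos.2 hpos
  set E := defect Ω G (frame Ω y (cosserat Ω G y)) x with hE
  have key : ∀ i j : Fin 2, secondForm Ω y x i j = -(1 / Real.sqrt ((G x)⁻¹ 2 2)) *
      (christoffel G 2 i.castSucc j.castSucc x + (G x)⁻¹ 2 2 * E j 2 i.castSucc) := by
    intro i j
    rw [h3 i j]
    have h5 := normalVec_dot_eq hP h4
      fun k ↦ wmat Ω j (frame Ω y (cosserat Ω G y)) x k i.castSucc
    refine (congrArg Neg.neg h5).trans ?_
    rw [neg_mul]
    congr 2
    have h6 : (frame Ω y (cosserat Ω G y) x)ᵀ * wmat Ω j (frame Ω y (cosserat Ω G y)) x =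
        G x * conn G j x + E j := by rw [hE, defect]; abel
    have h7 : ((G x)⁻¹ * ((frame Ω y (cosserat Ω G y) x)ᵀ *
        wmat Ω j (frame Ω y (cosserat Ω G y)) x)) 2 i.castSucc =
        christoffel G 2 i.castSucc j.castSucc x + (G x)⁻¹ 2 2 * E j 2 i.castSucc := by
      rw [h6, mul_add, ← Matrix.mul_assoc, Matrix.nonsing_inv_mul _ hP.det_pos.ne'.isUnit,
        one_mul, Matrix.add_apply, hG.christoffel_symm hΩ hx]
      congr 1
      have h8 : E j 0 i.castSucc = 0 := apply_castSucc_eq_zero h1 h2 j 0 i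
      have h9 : E j 1 i.castSucc = 0 := apply_castSucc_eq_zero h1 h2 j 1 i
      rw [Matrix.mul_apply, Fin.sum_univ_three, h8, h9]
      ring
    exact h7
  refine ⟨fun h i j ↦ ?_, fun h i j ↦ by rw [key, h]; ring⟩
  have h10 := (key j i).symm.trans (h j i)
  have h11 : -(1 / Real.sqrt ((G x)⁻¹ 2 2)) * ((G x)⁻¹ 2 2 * E i 2 j.castSucc) = 0 := by
    linarith
  have h12 : -(1 / Real.sqrt ((G x)⁻¹ 2 2)) ≠ 0 := by
    rw [neg_ne_zero]; positivity
  rcases mul_eq_zero.1 h11 with h | h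
  · exact absurd h h12
  · exact (mul_eq_zero.1 h).resolve_left hpos.ne'

lemma hasChristoffelImmersion_iff (hΩ : IsOpen Ω) (hbd : Bornology.IsBounded Ω)
    (hG : IsPlateMetric Ω G) : HasChristoffelImmersion Ω G ↔
      ∃ y, IsIsometricImmersion Ω G y ∧ IsParallel Ω G (frame Ω y (cosserat Ω G y)) :=
  exists_congr fun _ ↦ and_congr_right fun hy ↦ hy.secondForm_eq_iff hΩ hbd hG

/-! ### The bending energy -/

lemma IsIsometricImmersion.aemeasurable_grad_cosserat (hΩ : IsOpen Ω)
    (hbd : Bornology.IsBounded Ω) (hG : IsPlateMetric Ω G) (hy : IsIsometricImmersion Ω G y)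
    (i j : Fin 2) : AEMeasurable
      (fun x ↦ ((grad Ω y x)ᵀ * grad Ω (cosserat Ω G y) x) i j) (volume.restrict Ω) := by
  have hN := fun k ↦ (isBddW12_cosserat hΩ hbd hG hy k).choose_spec
  simp only [Matrix.mul_apply]
  refine Finset.aemeasurable_fun_sum _ fun k _ ↦ AEMeasurable.mul ?_ ?_
  · exact ((hy.hasBddW12 hΩ hbd hG k i).memLp hbd (p := 2)).1.aemeasurable
  · exact ((hN k).weak j).weakPartial.2.1.aestronglyMeasurable.aemeasurable

lemma IsIsometricImmersion.bendingEnergy_eq_zero_iff (hΩ : IsOpen Ω)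
    (hbd : Bornology.IsBounded Ω) (hG : IsPlateMetric Ω G) (hW : IsEnergyDensity W)
    (hy : IsIsometricImmersion Ω G y) :
    bendingEnergy W Ω G y = 0 ↔ IsParallel Ω G (frame Ω y (cosserat Ω G y)) := by
  rw [isParallel_frame_iff hΩ hbd hG (hy.isFrame hΩ hbd hG), bendingEnergy, mul_eq_zero,
    or_iff_right (by simp)]
  constructor
  · intro h
    obtain ⟨c, hc, hlow⟩ := hW.exists_Q2_lower_bound
    have key : ∀ i j : Fin 2, ∀ᵐ x ∂volume.restrict Ω,
        ((grad Ω y x)ᵀ * grad Ω (cosserat Ω G y) x) i j +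
        ((grad Ω y x)ᵀ * grad Ω (cosserat Ω G y) x) j i = 0 := by
      intro i j
      -- The lower bound for `Q₂` replaces the energy integrand by an explicitly measurable one, so
      -- a zero integral gives vanishing a.e. without discussing measurability of `Q₂`.
      set F : Plane → ℝ≥0∞ := fun x ↦ ENNReal.ofReal (c *
        ((((grad Ω y x)ᵀ * grad Ω (cosserat Ω G y) x) i j +
        ((grad Ω y x)ᵀ * grad Ω (cosserat Ω G y) x) j i) / (G x).trace) ^ 2) with hF
      have hFm : AEMeasurable F (volume.restrict Ω) := by
        have h1 := hy.aemeasurable_grad_cosserat hΩ hbd hG i j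
        have h2 := hy.aemeasurable_grad_cosserat hΩ hbd hG j i
        have h3 : AEMeasurable (fun x ↦ (G x).trace) (volume.restrict Ω) := by
          have : ContinuousOn (fun x ↦ (G x).trace) Ω := by
            simp only [Matrix.trace, Matrix.diag_apply]
            exact continuousOn_finsetSum _ fun k _ ↦
              (hG.smooth k k).continuousOn.mono subset_closure
          exact this.aemeasurable hΩ.measurableSet
        exact ((((h1.add h2).div h3).pow_const 2).const_mul c).ennreal_ofReal
      have hF0 : ∫⁻ x in Ω, F x = 0 := by
        refine le_antisymm ((lintegral_mono_ae ?_).trans h.le) zero_le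
        filter_upwards [ae_mem hΩ] with x hx
        exact ENNReal.ofReal_le_ofReal (hlow _ (hG.posDef x (subset_closure hx)) _ i j)
      filter_upwards [(lintegral_eq_zero_iff' hFm).1 hF0, ae_mem hΩ] with x h1 hx
      have htr : 0 < (G x).trace := (hG.posDef x (subset_closure hx)).trace_pos
      have h2 := ENNReal.ofReal_eq_zero.1 h1
      have h3 := pow_eq_zero_iff two_ne_zero |>.1
        (le_antisymm (nonpos_of_mul_nonpos_right h2 hc) (sq_nonneg _))
      exact (div_eq_zero_iff.1 h3).resolve_right htr.ne'
    have key' := ae_all_iff.2 fun i ↦ ae_all_iff.2 (key i)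
    filter_upwards [key'] with x hx
    ext i j
    exact hx i j
  · intro h
    refine (lintegral_congr_ae ?_).trans lintegral_zero
    filter_upwards [h, ae_mem hΩ] with x h1 hx
    rw [hW.Q2_eq_zero_of_skew (hG.posDef x (subset_closure hx)) h1, ENNReal.ofReal_zero]

lemma minBendingEnergyZero_iff (hΩ : IsOpen Ω) (hbd : Bornology.IsBounded Ω)
    (hG : IsPlateMetric Ω G) (hW : IsEnergyDensity W) : MinBendingEnergyZero W Ω G ↔
      ∃ y, IsIsometricImmersion Ω G y ∧ IsParallel Ω G (frame Ω y (cosserat Ω G y)) := by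
  have h0 : 0 ∈ lowerBounds (bendingEnergy W Ω G '' {y | IsIsometricImmersion Ω G y}) :=
    fun _ _ ↦ zero_le
  rw [MinBendingEnergyZero, IsLeast, and_iff_left h0, mem_image]
  exact exists_congr fun _ ↦ and_congr_right fun hy ↦
    hy.bendingEnergy_eq_zero_iff hΩ hbd hG hW

/-! ### Parallel frames force the curvature to vanish -/

lemma IsPlateMetric.continuousOn_dmat_conn (hΩ : IsOpen Ω) (hG : IsPlateMetric Ω G)
    (i j : Fin 2) (a b : Fin 3) : ContinuousOn (fun x ↦ dmat i (conn G j) x a b) Ω :=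
  continuousOn_fderiv_apply (by simp) hΩ (hG.contDiffOn_christoffel hΩ a j.castSucc b) (e i)

lemma IsPlateMetric.continuousOn_conn (hΩ : IsOpen Ω) (hG : IsPlateMetric Ω G)
    (i : Fin 2) (a b : Fin 3) : ContinuousOn (fun x ↦ conn G i x a b) Ω :=
  (hG.contDiffOn_christoffel hΩ a i.castSucc b).continuousOn

/-- The derivatives `QΓ_i` are again weakly differentiable, so `∂₁(QΓ₂) = ∂₂(QΓ₁)` holds a.e.; by
the product rule this says `Q · curv = 0`, and `Q` is invertible. Continuity of `curv` removes the
null set. -/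
lemma IsFrame.curv_eq_zero (hΩ : IsOpen Ω) (hG : IsPlateMetric Ω G) (hQ : IsFrame Ω G Q)
    (hp : IsParallel Ω G Q) : ∀ x ∈ Ω, curv G x = 0 := by
  have hw : ∀ k j i, IsWeakPartial Ω i (fun x ↦ Q x k j)
      fun x ↦ ∑ m, Q x k m * conn G i x m j := fun k j i ↦ by
    refine ((hQ.hasBddW12 k j).weak i).congr .rfl ?_
    filter_upwards [hp] with x hx
    exact congrFun (congrFun (hx i) k) j
  have hc : ∀ m j i l, IsWeakPartial Ω l (fun x ↦ conn G i x m j)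
      fun x ↦ dmat l (conn G i) x m j := fun m j i l ↦
    isWeakPartial_of_hasFDerivAt hΩ
      (fun x hx ↦ (hG.differentiableAt_conn hΩ hx i m j).hasFDerivAt)
      (hG.continuousOn_dmat_conn hΩ l i m j)
  have hcb : ∀ m j i, LocBdd Ω fun x ↦ conn G i x m j := fun m j i ↦
    locBdd_of_continuousOn (hG.continuousOn_conn hΩ i m j)
  have hw2 : ∀ k j i l, IsWeakPartial Ω l (fun x ↦ ∑ m, Q x k m * conn G i x m j)
      fun x ↦ ∑ m, (Q x k m * dmat l (conn G i) x m j +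
        (∑ s, Q x k s * conn G l x s m) * conn G i x m j) := fun k j i l ↦
    IsWeakPartial.sum _ fun m _ ↦
      (hw k m l).mul hΩ (hQ.hasBddW12 k m).locBdd (hcb m j i) (hc m j i l)
  have hcomm : ∀ᵐ x ∂volume.restrict Ω, ∀ k j, (Q x * dmat 1 (conn G 0) x +
      Q x * conn G 1 x * conn G 0 x) k j =
      (Q x * dmat 0 (conn G 1) x + Q x * conn G 0 x * conn G 1 x) k j := by
    simp only [ae_all_iff]
    intro k j
    filter_upwards [(hw k j 0).comm hΩ (hw k j 1) (hw2 k j 0 1) (hw2 k j 1 0)] with x hx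
    simp only [Matrix.add_apply, Matrix.mul_apply, ← Finset.sum_add_distrib]
    exact hx
  have hzero : ∀ a b, (fun x ↦ curv G x a b) =ᵐ[volume.restrict Ω] fun _ ↦ 0 := fun a b ↦ by
    filter_upwards [hcomm, hQ.gram, ae_mem hΩ] with x h1 h2 hx
    have hd : IsUnit (Q x) := by
      have h1 := hG.isUnit_det (subset_closure hx)
      rw [← h2, Matrix.det_mul] at h1
      exact (Matrix.isUnit_iff_isUnit_det _).2 (isUnit_of_mul_isUnit_right h1)
    have h3 : Q x * curv G x = 0 := by
      have := Matrix.ext h1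
      rw [curv, mul_sub, mul_add, mul_sub, ← Matrix.mul_assoc, ← Matrix.mul_assoc]
      rw [← sub_eq_zero.2 this.symm]
      abel
    rw [(hd.mul_right_eq_zero).1 h3, Matrix.zero_apply]
  intro x hx
  ext a b
  refine Measure.eqOn_open_of_ae_eq (hzero a b) hΩ ?_ continuousOn_const hx
  simp only [curv, Matrix.sub_apply, Matrix.add_apply, Matrix.mul_apply]
  have h1 := hG.continuousOn_dmat_conn hΩ
  have h2 := hG.continuousOn_conn hΩ
  fun_prop

end Immersion

/-! ### Boundedness up to a smooth boundary -/

section Boundary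

open Filter Topology

variable {Ω : Set Plane} {f : Plane → ℝ}

lemma apply_eq_sum (L : Plane →L[ℝ] ℝ) (v : Plane) : L v = v 0 * L (e 0) + v 1 * L (e 1) := by
  have hv : v = v 0 • e 0 + v 1 • e 1 := by
    ext k; fin_cases k <;> simp [e]
  conv_lhs => rw [hv]
  simp

lemma norm_le_of_abs_apply_e_le {L : Plane →L[ℝ] ℝ} {C : Fin 2 → ℝ}
    (h : ∀ i, |L (e i)| ≤ C i) : ‖L‖ ≤ C 0 + C 1 := by
  have h0 := (abs_nonneg _).trans (h 0)
  have h1 := (abs_nonneg _).trans (h 1)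
  refine L.opNorm_le_bound (add_nonneg h0 h1) fun v ↦ ?_
  have hv : ∀ i, |v i| ≤ ‖v‖ := fun i ↦ PiLp.norm_apply_le v i
  rw [apply_eq_sum, Real.norm_eq_abs, add_mul]
  refine (abs_add_le _ _).trans (add_le_add ?_ ?_)
  · rw [abs_mul, mul_comm]
    exact mul_le_mul (h 0) (hv 0) (abs_nonneg _) h0
  · rw [abs_mul, mul_comm]
    exact mul_le_mul (h 1) (hv 1) (abs_nonneg _) h1

/-- Near a smooth boundary point one can move into the domain by a fixed vector. -/
lemma HasSmoothBoundary.exists_inward (hs : HasSmoothBoundary Ω) {p : Plane}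
    (hp : p ∈ frontier Ω) : ∃ v : Plane, p + v ∈ Ω ∧
      ∀ᶠ x in 𝓝 p, x ∈ Ω → ∀ t ∈ Icc (0 : ℝ) 1, x + t • v ∈ Ω := by
  obtain ⟨U, hU, hpU, ρ, hρ, hρp, hΩU⟩ := hs p hp
  obtain ⟨w, hw⟩ : ∃ w, fderiv ℝ ρ p w < 0 := by
    obtain ⟨w, hw⟩ : ∃ w, fderiv ℝ ρ p w ≠ 0 := by
      by_contra! h
      exact hρp (ContinuousLinearMap.ext h)
    rcases lt_or_gt_of_ne hw with h | h
    · exact ⟨w, h⟩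
    · exact ⟨-w, by simpa using h⟩
  have hcont : ContinuousAt (fun x ↦ fderiv ℝ ρ x w) p :=
    (continuousOn_fderiv_apply (by simp) hU hρ w).continuousAt (hU.mem_nhds hpU)
  obtain ⟨r, hr, hball⟩ := Metric.eventually_nhds_iff_ball.1
    ((hcont.eventually_lt_const hw).and (hU.mem_nhds hpU))
  have hρp0 : ρ p ≤ 0 := by
    have hcl : p ∈ closure (Ω ∩ U) := by
      rw [inter_comm]
      exact mem_closure_iff_nhds.2 fun t ht ↦ by
        obtain ⟨z, hz, hzΩ⟩ := mem_closure_iff_nhds.1 hp.1 (t ∩ U) (inter_mem ht (hU.mem_nhds hpU))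
        exact ⟨z, hz.1, hz.2, hzΩ⟩
    have hcw : ContinuousWithinAt ρ (Ω ∩ U) p :=
      ((hρ.continuousOn.continuousAt (hU.mem_nhds hpU))).continuousWithinAt
    refine hcw.closure_le hcl continuousWithinAt_const fun z hz ↦ ?_
    rw [hΩU] at hz
    exact hz.2.le
  -- Scaling the descent direction `w` of `ρ` so that moves from `ball p (r / 2)` stay in `ball p
  -- r`, where `ρ` decreases along `w`.
  set s : ℝ := r / (2 * (‖w‖ + 1)) with hsdef
  have hs0 : 0 < s := by positivity
  have hsw : s * ‖w‖ < r / 2 := by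
    rw [hsdef, div_mul_eq_mul_div, div_lt_div_iff₀ (by positivity) (by positivity)]
    nlinarith [norm_nonneg w]
  have hmem : ∀ x ∈ Metric.ball p (r / 2), ∀ t ∈ Icc (0 : ℝ) 1,
      x + t • s • w ∈ Metric.ball p r := fun x hx t ht ↦ by
    rw [Metric.mem_ball, dist_eq_norm] at hx ⊢
    have h1 : ‖t • s • w‖ ≤ s * ‖w‖ := by
      rw [norm_smul, norm_smul, Real.norm_of_nonneg ht.1, Real.norm_of_nonneg hs0.le]
      exact mul_le_of_le_one_left (by positivity) ht.2
    calc ‖x + t • s • w - p‖ = ‖(x - p) + t • s • w‖ := by congr 1; abel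
      _ ≤ ‖x - p‖ + ‖t • s • w‖ := norm_add_le _ _
      _ < r := by linarith
  have hanti : ∀ x ∈ Metric.ball p (r / 2),
      StrictAntiOn (fun t : ℝ ↦ ρ (x + t • s • w)) (Icc 0 1) := fun x hx ↦ by
    have hd : ∀ t ∈ Icc (0 : ℝ) 1, HasDerivAt (fun t : ℝ ↦ ρ (x + t • s • w))
        (fderiv ℝ ρ (x + t • s • w) (s • w)) t := fun t ht ↦ by
      have h1 := hasFDerivAt_of_contDiffOn (by simp) hU hρ (hball _ (hmem x hx t ht)).2
      have h2 : HasDerivAt (fun t : ℝ ↦ x + t • s • w) (s • w) t := by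
        simpa using ((hasDerivAt_id t).smul_const (s • w)).const_add x
      exact h1.comp_hasDerivAt t h2
    refine strictAntiOn_of_deriv_neg (convex_Icc 0 1)
      (fun t ht ↦ (hd t ht).continuousAt.continuousWithinAt) fun t ht ↦ ?_
    have ht' := interior_subset ht
    rw [(hd t ht').deriv, map_smul, smul_eq_mul]
    exact mul_neg_of_pos_of_neg hs0 (hball _ (hmem x hx t ht')).1
  have hsub : ∀ z ∈ Metric.ball p r, ρ z < 0 → z ∈ Ω := fun z hz hz0 ↦ by
    have : z ∈ Ω ∩ U := by rw [hΩU]; exact ⟨(hball z hz).2, hz0⟩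
    exact this.1
  refine ⟨s • w, ?_, ?_⟩
  · have hpb : p ∈ Metric.ball p (r / 2) := Metric.mem_ball_self (by positivity)
    have h1 := hanti p hpb (left_mem_Icc.2 zero_le_one) (right_mem_Icc.2 zero_le_one) one_pos
    have h2 := hmem p hpb 1 (right_mem_Icc.2 zero_le_one)
    simp only [zero_smul, add_zero, one_smul] at h1 h2
    exact hsub _ h2 (h1.trans_le hρp0)
  · filter_upwards [Metric.ball_mem_nhds p (half_pos hr)] with x hx hxΩ t ht
    have hρx : ρ x < 0 := by
      have : x ∈ Ω ∩ U := ⟨hxΩ, (hball x (Metric.ball_subset_ball (by linarith) hx)).2⟩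
      rw [hΩU] at this
      exact this.2
    have h1 := (hanti x hx).antitoneOn (left_mem_Icc.2 zero_le_one) ht ht.1
    simp only [zero_smul, add_zero] at h1
    exact hsub _ (hmem x hx t ht) (h1.trans_lt hρx)

/-- A function with bounded gradient on a bounded domain with smooth boundary is bounded. -/
lemma exists_bound_of_fderiv_bound (hΩ : IsOpen Ω) (hb : Bornology.IsBounded Ω)
    (hs : HasSmoothBoundary Ω) (hf : ∀ x ∈ Ω, DifferentiableAt ℝ f x) {C : ℝ}
    (hC : ∀ x ∈ Ω, ‖fderiv ℝ f x‖ ≤ C) : ∃ D, ∀ x ∈ Ω, |f x| ≤ D := by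
  have hloc : ∀ q ∈ Ω, ∀ᶠ x in 𝓝 q, |f x| ≤ |f q| + 1 := fun q hq ↦
    ((hf q hq).continuousAt.abs.eventually_lt_const (lt_add_one _)).mono fun _ h ↦ h.le
  suffices h : ∃ D, ∀ x ∈ Ω ∩ closure Ω, |f x| ≤ D by
    rwa [inter_eq_left.2 subset_closure] at h
  refine hb.isCompact_closure.induction_on (p := fun s ↦ ∃ D, ∀ x ∈ Ω ∩ s, |f x| ≤ D)
    ⟨0, by simp⟩ (fun s t hst ⟨C, hC⟩ ↦ ⟨C, fun x hx ↦ hC x ⟨hx.1, hst hx.2⟩⟩)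
    (fun s t ⟨C, hC⟩ ⟨D, hD⟩ ↦ ⟨max C D, fun x hx ↦ hx.2.elim
      (fun h ↦ (hC x ⟨hx.1, h⟩).trans (le_max_left _ _))
      (fun h ↦ (hD x ⟨hx.1, h⟩).trans (le_max_right _ _))⟩) fun p hp ↦ ?_
  by_cases hpΩ : p ∈ Ω
  · exact ⟨_, mem_nhdsWithin_of_mem_nhds (hloc p hpΩ), _, fun x hx ↦ hx.2⟩
  -- Near a boundary point, `f x` is compared along a segment inside `Ω` with `f (x + v)`, and `x +
  -- v` is close to the interior point `p + v`.
  · obtain ⟨v, hv, hin⟩ := hs.exists_inward (p := p)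
      (by rw [frontier, hΩ.interior_eq]; exact ⟨hp, hpΩ⟩)
    have hq : ∀ᶠ x in 𝓝 p, |f (x + v)| ≤ |f (p + v)| + 1 :=
      ((continuous_id.add continuous_const).tendsto' p (p + v) rfl).eventually (hloc _ hv)
    refine ⟨_, mem_nhdsWithin_of_mem_nhds (hin.and hq), |f (p + v)| + 1 + C * ‖v‖,
      fun x hx ↦ ?_⟩
    have hseg : segment ℝ x (x + v) ⊆ Ω := by
      rw [segment_eq_image']
      rintro _ ⟨t, ht, rfl⟩
      simpa using hx.2.1 hx.1 t ht
    have hmv := Convex.norm_image_sub_le_of_norm_fderiv_le (𝕜 := ℝ)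
      (fun z hz ↦ hf z (hseg hz)) (fun z hz ↦ hC z (hseg hz)) (convex_segment x (x + v))
      (right_mem_segment ℝ x (x + v)) (left_mem_segment ℝ x (x + v))
    rw [sub_add_cancel_left, norm_neg, Real.norm_eq_abs] at hmv
    have h2 := hx.2.2
    have h3 := abs_sub_abs_le_abs_sub (f x) (f (x + v))
    linarith

end Boundary

/-! ### Flat matrix systems in the plane -/

section Existence

open Filter Topology

variable {Ω : Set Plane} {G : Plane → Matrix (Fin 3) (Fin 3) ℝ}

section Solve

variable {ι 𝔸 : Type*} [NormedRing 𝔸] [NormedAlgebra ℝ 𝔸]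
  {M : Fin 2 → Plane → Matrix ι ι ℝ}

/-- The form `∑ᵢ Mᵢ dxᵢ` with values in a normed algebra isomorphic to the matrices. -/
noncomputable def algForm (B : (ι → ι → ℝ) →L[ℝ] 𝔸) (M : Fin 2 → Plane → Matrix ι ι ℝ)
    (x : Plane) : Plane →L[ℝ] 𝔸 :=
  ∑ i, ContinuousLinearMap.smulRightL ℝ Plane 𝔸 (EuclideanSpace.proj i) (B fun a b ↦ M i x a b)

variable {B : (ι → ι → ℝ) →L[ℝ] 𝔸}

lemma algForm_apply (x v : Plane) : algForm B M x v =
    v 0 • B (fun a b ↦ M 0 x a b) + v 1 • B (fun a b ↦ M 1 x a b) := by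
  simp [algForm, Fin.sum_univ_two]

lemma contDiffOn_algForm [Fintype ι] (hM : ∀ i a b, ContDiffOn ℝ ∞ (fun x ↦ M i x a b) Ω) :
    ContDiffOn ℝ ∞ (algForm B M) Ω := by
  unfold algForm
  refine ContDiffOn.sum fun i _ ↦ ContDiff.comp_contDiffOn (ContinuousLinearMap.contDiff _)
    (B.contDiff.comp_contDiffOn ?_)
  exact contDiffOn_pi.2 fun a ↦ contDiffOn_pi.2 fun b ↦ hM i a b

lemma fderiv_algForm [Fintype ι] {x : Plane} (hM : ∀ i a b, DifferentiableAt ℝ (fun z ↦ M i z a b) x)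
    (u v : Plane) : fderiv ℝ (algForm B M) x u v =
      v 0 • B (fun a b ↦ fderiv ℝ (fun z ↦ M 0 z a b) x u) +
      v 1 • B (fun a b ↦ fderiv ℝ (fun z ↦ M 1 z a b) x u) := by
  have h (i : Fin 2) := (ContinuousLinearMap.smulRightL ℝ Plane 𝔸
    (EuclideanSpace.proj i)).hasFDerivAt.comp x (B.hasFDerivAt.comp x
      (hasFDerivAt_pi.2 fun a ↦ hasFDerivAt_pi.2 fun b ↦ (hM i a b).hasFDerivAt))
  have h1 : HasFDerivAt (algForm B M) _ x := HasFDerivAt.fun_sum (u := Finset.univ) fun i _ ↦ h i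
  rw [h1.fderiv, Fin.sum_univ_two]
  rfl

/-- **Frobenius theorem** for matrix valued total differential systems in the plane. -/
theorem exists_matrix_solution [Fintype ι] [DecidableEq ι] (hΩ : IsOpen Ω) (hsc : IsSimplyConnected Ω)
    (hM : ∀ i a b, ContDiffOn ℝ ∞ (fun x ↦ M i x a b) Ω)
    (hflat : ∀ x ∈ Ω, (Matrix.of fun a b ↦ fderiv ℝ (fun z ↦ M 1 z a b) x (e 0)) -
      (Matrix.of fun a b ↦ fderiv ℝ (fun z ↦ M 0 z a b) x (e 1)) +
      M 0 x * M 1 x - M 1 x * M 0 x = 0)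
    {x₀ : Plane} (hx₀ : x₀ ∈ Ω) (Z₀ : Matrix ι ι ℝ) :
    ∃ Z : Plane → Matrix ι ι ℝ, Z x₀ = Z₀ ∧ ∀ x ∈ Ω, ∀ a b,
      ∃ L : Plane →L[ℝ] ℝ, HasFDerivAt (fun z ↦ Z z a b) L x ∧
        ∀ i, L (e i) = (Z x * M i x) a b := by
  -- Matrices are identified with operators on `ℝ^ι` to obtain a complete normed algebra; only the
  -- entries of the solution are used afterwards.
  obtain ⟨φ⟩ : Nonempty (Matrix ι ι ℝ ≃ₐ[ℝ] ((ι → ℝ) →L[ℝ] (ι → ℝ))) :=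
    ⟨Matrix.toLinAlgEquiv'.trans (Module.End.toContinuousLinearMap (ι → ℝ))⟩
  obtain ⟨B, hB⟩ : ∃ B : (ι → ι → ℝ) →L[ℝ] ((ι → ℝ) →L[ℝ] (ι → ℝ)),
      ∀ N : ι → ι → ℝ, B N = φ (Matrix.of N) :=
    ⟨LinearMap.toContinuousLinearMap
      (φ.toLinearMap.comp (Matrix.ofLinearEquiv ℝ).toLinearMap), fun _ ↦ rfl⟩
  have hd : ∀ x ∈ Ω, ∀ i a b, DifferentiableAt ℝ (fun z ↦ M i z a b) x := fun x hx i a b ↦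
    (hasFDerivAt_of_contDiffOn (by simp) hΩ (hM i a b) hx).differentiableAt
  have hfl : ∀ x ∈ Ω, FlatAt (algForm B M) x := fun x hx u v ↦ by
    -- In the plane the curvature form is alternating, so it is the area `u₀v₁ - u₁v₀` times its
    -- value on the coordinate vectors.
    have key := congrArg (fun N ↦ (u 0 * v 1 - u 1 * v 0) • φ N) (hflat x hx)
    simp only [map_add, map_sub, map_mul, map_zero, smul_zero] at key
    have hu : ∀ i (u : Plane), (fun a b ↦ fderiv ℝ (fun z ↦ M i z a b) x u) =
        u 0 • (fun a b ↦ fderiv ℝ (fun z ↦ M i z a b) x (e 0)) +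
        u 1 • (fun a b ↦ fderiv ℝ (fun z ↦ M i z a b) x (e 1)) := fun i u ↦ by
      ext a b; exact apply_eq_sum _ u
    rw [fderiv_algForm (hd x hx), fderiv_algForm (hd x hx), algForm_apply, algForm_apply,
      hu 0 u, hu 1 u, hu 0 v, hu 1 v]
    simp only [map_add, map_smul]
    simp only [hB, add_mul, mul_add, smul_mul_assoc, mul_smul_comm]
    have hM' : ∀ i, Matrix.of (fun a b ↦ M i x a b) = M i x := fun _ ↦ rfl
    simp only [hM']
    rw [← key]
    module
  obtain ⟨Z, hZ₀, hZ⟩ := exists_solution_of_flat hΩ hsc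
    ((contDiffOn_algForm (B := B) hM).of_le (by norm_cast)) hfl hx₀ (φ Z₀)
  let ev : ι → ι → ((ι → ℝ) →L[ℝ] (ι → ℝ)) →L[ℝ] ℝ := fun a b ↦
    LinearMap.toContinuousLinearMap ((Matrix.entryLinearMap ℝ ℝ a b).comp φ.symm.toLinearMap)
  refine ⟨fun x ↦ φ.symm (Z x), by simp only [hZ₀, φ.symm_apply_apply], fun x hx a b ↦
    ⟨_, (ev a b).hasFDerivAt.comp x (hZ x hx), fun i ↦ ?_⟩⟩
  have h1 : algForm B M x (e i) = φ (M i x) := by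
    rw [algForm_apply]
    fin_cases i <;> simp [e, hB] <;> rfl
  change φ.symm (Z x * algForm B M x (e i)) a b = _
  rw [h1, map_mul, φ.symm_apply_apply]

end Solve
end Existence

/-! ### Developing a flat metric into an isometric immersion with parallel frame -/

section Realization

open Filter Topology

variable {Ω : Set Plane} {G : Plane → Matrix (Fin 3) (Fin 3) ℝ}

/-- The connection matrix of affine frames in the direction `e i`. -/
noncomputable def affConn (G : Plane → Matrix (Fin 3) (Fin 3) ℝ) (i : Fin 2) (x : Plane) :
    Matrix (Fin 3 ⊕ Unit) (Fin 3 ⊕ Unit) ℝ :=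
  Matrix.fromBlocks (conn G i x) (Matrix.of fun k _ ↦ if k = i.castSucc then 1 else 0) 0 0

/-- The pointwise equations `∂ᵢQ = Q Γᵢ` and `∂ᵢy = Q eᵢ`. -/
structure IsDevelopment (Ω : Set Plane) (G Q : Plane → Matrix (Fin 3) (Fin 3) ℝ)
    (y : Plane → Fin 3 → ℝ) : Prop where
  frame : ∀ x ∈ Ω, ∀ a b, ∃ L : Plane →L[ℝ] ℝ, HasFDerivAt (fun z ↦ Q z a b) L x ∧
    ∀ i, L (e i) = (Q x * conn G i x) a b
  point : ∀ x ∈ Ω, ∀ a, ∃ L : Plane →L[ℝ] ℝ, HasFDerivAt (fun z ↦ y z a) L x ∧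
    ∀ i : Fin 2, L (e i) = Q x a i.castSucc

/-- The upper blocks of `dZ = Z A` with connection `[Γ_i, e_i; 0, 0]` are the equations for `Q` and
`y` at once. Flatness of its upper left block is `curv = 0`, and of its upper right block the
absence of torsion, `Γ₁e₂ = Γ₂e₁`. -/
lemma exists_isDevelopment (hΩ : IsOpen Ω) (hsc : IsSimplyConnected Ω) (hG : IsPlateMetric Ω G)
    (hc : ∀ x ∈ Ω, curv G x = 0) {x₀ : Plane} (hx₀ : x₀ ∈ Ω) (Q₀ : Matrix (Fin 3) (Fin 3) ℝ) :
    ∃ Q y, Q x₀ = Q₀ ∧ IsDevelopment Ω G Q y := by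
  have hM : ∀ i a b, ContDiffOn ℝ ∞ (fun x ↦ affConn G i x a b) Ω := fun i a b ↦ by
    rcases a with a | a <;> rcases b with b | b
    · exact hG.contDiffOn_christoffel hΩ a i.castSucc b
    all_goals exact contDiffOn_const
  have hflat : ∀ x ∈ Ω, (Matrix.of fun a b ↦ fderiv ℝ (fun z ↦ affConn G 1 z a b) x (e 0)) -
      (Matrix.of fun a b ↦ fderiv ℝ (fun z ↦ affConn G 0 z a b) x (e 1)) +
      affConn G 0 x * affConn G 1 x - affConn G 1 x * affConn G 0 x = 0 := fun x hx ↦ by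
    have hd : ∀ i j, (Matrix.of fun a b ↦ fderiv ℝ (fun z ↦ affConn G i z a b) x (e j)) =
        Matrix.fromBlocks (dmat j (conn G i) x) 0 0 0 := fun i j ↦ by
      ext a b
      rcases a with a | a <;> rcases b with b | b
      · rfl
      all_goals simp [affConn]
    have hm : ∀ i j, affConn G i x * affConn G j x = Matrix.fromBlocks
        (conn G i x * conn G j x) (Matrix.of fun k _ ↦ conn G i x k j.castSucc) 0 0 := fun i j ↦ by
      rw [affConn, affConn, Matrix.fromBlocks_multiply]
      simp only [Matrix.mul_zero, Matrix.zero_mul, add_zero]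
      congr 1
      ext k _
      simp [Matrix.mul_apply]
    have h0 := hc x hx
    rw [curv] at h0
    rw [hd, hd, hm, hm]
    ext a b
    rcases a with a | a <;> rcases b with b | b
    · exact congrFun (congrFun h0 a) b
    · have := hG.conn_symm hΩ hx 0 1 a
      simp only [Matrix.sub_apply, Matrix.add_apply, Matrix.fromBlocks_apply₁₂,
        Matrix.of_apply, this, Matrix.zero_apply]
      ring
    all_goals simp
  obtain ⟨Z, hZ₀, hZ⟩ := exists_matrix_solution hΩ hsc hM hflat hx₀
    (Matrix.fromBlocks Q₀ 0 0 0)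
  refine ⟨fun x ↦ (Z x).toBlocks₁₁, fun x a ↦ Z x (Sum.inl a) (Sum.inr ()), ?_,
    ⟨fun x hx a b ↦ ?_, fun x hx a ↦ ?_⟩⟩
  · simp only [hZ₀, Matrix.toBlocks_fromBlocks₁₁]
  · obtain ⟨L, h1, h2⟩ := hZ x hx (Sum.inl a) (Sum.inl b)
    refine ⟨L, h1, fun i ↦ ?_⟩
    rw [h2, Matrix.mul_apply, Matrix.mul_apply]
    simp [affConn, Matrix.toBlocks₁₁]
  · obtain ⟨L, h1, h2⟩ := hZ x hx (Sum.inl a) (Sum.inr ())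
    refine ⟨L, h1, fun i ↦ ?_⟩
    rw [h2, Matrix.mul_apply]
    simp [affConn, Matrix.toBlocks₁₁]

variable {Q : Plane → Matrix (Fin 3) (Fin 3) ℝ} {y : Plane → Fin 3 → ℝ}

lemma IsDevelopment.differentiableAt (h : IsDevelopment Ω G Q y) {x : Plane} (hx : x ∈ Ω)
    (a b : Fin 3) : DifferentiableAt ℝ (fun z ↦ Q z a b) x :=
  let ⟨_, hL, _⟩ := h.frame x hx a b
  hL.differentiableAt

lemma IsDevelopment.dmat_eq (h : IsDevelopment Ω G Q y) {x : Plane} (hx : x ∈ Ω) (i : Fin 2) :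
    dmat i Q x = Q x * conn G i x := by
  ext a b
  obtain ⟨L, hL, hi⟩ := h.frame x hx a b
  rw [dmat, Matrix.of_apply, hL.fderiv, hi]

lemma eq_zero_of_apply_e {L : Plane →L[ℝ] ℝ} (h : ∀ i, L (e i) = 0) : L = 0 := by
  ext v
  rw [apply_eq_sum, h, h, mul_zero, mul_zero, add_zero]
  rfl

/-- A matrix field with vanishing partial derivatives on a connected set is constant. -/
lemma eq_of_dmat_eq_zero (hΩ : IsOpen Ω) (hc : IsPreconnected Ω)
    {M : Plane → Matrix (Fin 3) (Fin 3) ℝ}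
    (hd : ∀ x ∈ Ω, ∀ a b, DifferentiableAt ℝ (fun z ↦ M z a b) x)
    (h : ∀ x ∈ Ω, ∀ i, dmat i M x = 0) {x x₀ : Plane} (hx : x ∈ Ω) (hx₀ : x₀ ∈ Ω) :
    M x = M x₀ := by
  ext a b
  refine hΩ.is_const_of_fderiv_eq_zero (𝕜 := ℝ) hc
    (fun z hz ↦ (hd z hz a b).differentiableWithinAt) (fun z hz ↦ ?_) hx hx₀
  exact eq_zero_of_apply_e fun i ↦ congrFun (congrFun (h z hz i) a) b

lemma dmat_congr {M N : Plane → Matrix (Fin 3) (Fin 3) ℝ} {x : Plane} (h : M =ᶠ[𝓝 x] N)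
    (i : Fin 2) : dmat i M x = dmat i N x := by
  ext a b
  have : (fun z ↦ M z a b) =ᶠ[𝓝 x] fun z ↦ N z a b := h.mono fun z hz ↦ by simp only [hz]
  simp only [dmat, Matrix.of_apply, this.fderiv_eq]

lemma IsPlateMetric.differentiableAt_inv (hΩ : IsOpen Ω) (hG : IsPlateMetric Ω G) {x : Plane}
    (hx : x ∈ Ω) (a b : Fin 3) : DifferentiableAt ℝ (fun z ↦ (G z)⁻¹ a b) x :=
  (hasFDerivAt_of_contDiffOn (by simp) hΩ ((hG.contDiffOn_inv a b).mono subset_closure)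
    hx).differentiableAt

lemma IsPlateMetric.dmat_inv (hΩ : IsOpen Ω) (hG : IsPlateMetric Ω G) {x : Plane}
    (hx : x ∈ Ω) (i : Fin 2) :
    dmat i (fun z ↦ (G z)⁻¹) x = -((G x)⁻¹ * dmat i G x * (G x)⁻¹) := by
  have h1 := dmat_mul (hG.differentiableAt hΩ hx) (hG.differentiableAt_inv hΩ hx) i
  have h2 : (fun z ↦ G z * (G z)⁻¹) =ᶠ[𝓝 x] fun _ ↦ 1 := by
    filter_upwards [hΩ.mem_nhds hx] with z hz
    exact Matrix.mul_nonsing_inv _ (hG.isUnit_det (subset_closure hz))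
  have h3 : dmat i (fun _ ↦ (1 : Matrix (Fin 3) (Fin 3) ℝ)) x = 0 := by
    ext a b; simp [dmat]
  rw [dmat_congr h2, h3] at h1
  have h4 := congrArg (fun N ↦ (G x)⁻¹ * N) h1
  simp only [mul_zero, mul_add, ← Matrix.mul_assoc,
    Matrix.nonsing_inv_mul _ (hG.isUnit_det (subset_closure hx)), one_mul] at h4
  exact eq_neg_of_add_eq_zero_right h4.symm

lemma dmat_transpose (M : Plane → Matrix (Fin 3) (Fin 3) ℝ) (i : Fin 2) (x : Plane) :
    dmat i (fun z ↦ (M z)ᵀ) x = (dmat i M x)ᵀ := rfl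

/-- The developed frame realizes the metric. -/
lemma IsDevelopment.gram (hΩ : IsOpen Ω) (hc : IsPreconnected Ω) (hG : IsPlateMetric Ω G)
    (h : IsDevelopment Ω G Q y) {x₀ : Plane} (hx₀ : x₀ ∈ Ω) (h₀ : (Q x₀)ᵀ * Q x₀ = G x₀)
    {x : Plane} (hx : x ∈ Ω) : (Q x)ᵀ * Q x = G x := by
  have hdQ := fun x (hx : x ∈ Ω) ↦ h.differentiableAt hx
  have hdI := fun x (hx : x ∈ Ω) ↦ hG.differentiableAt_inv hΩ hx
  have hdQI : ∀ x ∈ Ω, ∀ a b, DifferentiableAt ℝ (fun z ↦ (Q z * (G z)⁻¹) a b) x :=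
    fun x hx a b ↦ by
    simp only [Matrix.mul_apply]
    exact DifferentiableAt.fun_sum fun k _ ↦ (hdQ x hx a k).mul (hdI x hx k b)
  -- `Q G⁻¹ Qᵀ` is used in place of `QᵀQ - G`: for a parallel frame its derivative is identically
  -- zero, so no uniqueness theorem is needed.
  have hdH : ∀ x ∈ Ω, ∀ a b, DifferentiableAt ℝ (fun z ↦ (Q z * (G z)⁻¹ * (Q z)ᵀ) a b) x :=
    fun x hx a b ↦ by
    have : (fun z ↦ (Q z * (G z)⁻¹ * (Q z)ᵀ) a b) =
        fun z ↦ ∑ k, (Q z * (G z)⁻¹) a k * Q z b k := by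
      ext z; rw [Matrix.mul_apply]; rfl
    rw [this]
    exact DifferentiableAt.fun_sum fun k _ ↦ (hdQI x hx a k).mul (hdQ x hx b k)
  have hzero : ∀ x ∈ Ω, ∀ i, dmat i (fun z ↦ Q z * (G z)⁻¹ * (Q z)ᵀ) x = 0 := fun x hx i ↦ by
    have hu := hG.isUnit_det (subset_closure hx)
    have hGt := hG.transpose_eq (subset_closure hx)
    rw [dmat_mul (N := fun z ↦ (Q z)ᵀ) (hdQI x hx) (fun a b ↦ hdQ x hx b a), dmat_mul (hdQ x hx) (hdI x hx),
      dmat_transpose, h.dmat_eq hx, hG.dmat_inv hΩ hx, ← hG.mul_conn_add_transpose hΩ hx,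
      Matrix.transpose_mul, Matrix.transpose_mul, hGt]
    simp only [mul_add, add_mul, mul_neg, neg_mul, Matrix.mul_assoc,
      Matrix.nonsing_inv_mul_cancel_left _ _ hu, neg_add, Matrix.mul_nonsing_inv _ hu, one_mul]
    abel
  have hinv : ∀ x ∈ Ω, (Q x)ᵀ * Q x = G x ↔ Q x * (G x)⁻¹ * (Q x)ᵀ = 1 := fun x hx ↦ by
    have hu := hG.isUnit_det (subset_closure hx)
    constructor
    · intro h1
      rw [Matrix.mul_assoc, mul_eq_one_comm, Matrix.mul_assoc, h1, Matrix.nonsing_inv_mul _ hu]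
    · intro h1
      rw [Matrix.mul_assoc, mul_eq_one_comm, Matrix.mul_assoc] at h1
      have := congrArg (fun N ↦ G x * N) h1
      simpa only [Matrix.mul_nonsing_inv_cancel_left _ _ hu, mul_one] using this
  rw [hinv x hx, ← (hinv x₀ hx₀).1 h₀]
  exact eq_of_dmat_eq_zero hΩ hc hdH hzero hx hx₀

lemma IsDevelopment.continuousOn (h : IsDevelopment Ω G Q y) (a b : Fin 3) :
    ContinuousOn (fun z ↦ Q z a b) Ω :=
  fun _ hx ↦ (h.differentiableAt hx a b).continuousAt.continuousWithinAt

/-- `(det Q)² = det G` never vanishes, so `det Q` keeps its sign on the connected set. -/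
lemma IsDevelopment.det_pos (hΩ : IsOpen Ω) (hc : IsPreconnected Ω) (hG : IsPlateMetric Ω G)
    (h : IsDevelopment Ω G Q y) {x₀ : Plane} (hx₀ : x₀ ∈ Ω) (h₀ : (Q x₀)ᵀ * Q x₀ = G x₀)
    (hd₀ : 0 < (Q x₀).det) {x : Plane} (hx : x ∈ Ω) : 0 < (Q x).det := by
  have hcont : ContinuousOn (fun z ↦ (Q z).det) Ω := by
    have := h.continuousOn
    simp only [Matrix.det_fin_three]
    fun_prop
  by_contra! hneg
  obtain ⟨z, hz, hz0⟩ := hc.intermediate_value hx hx₀ hcont ⟨hneg, hd₀.le⟩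
  have h1 := (hG.posDef z (subset_closure hz)).det_pos
  dsimp only at hz0
  rw [← h.gram hΩ hc hG hx₀ h₀ hz, Matrix.det_mul, hz0, mul_zero] at h1
  exact lt_irrefl _ h1

/-- In odd dimension a change of sign flips the determinant and leaves the Gram matrix alone. -/
lemma exists_gram_root {P : Matrix (Fin 3) (Fin 3) ℝ} (hP : P.PosDef) :
    ∃ Q₀ : Matrix (Fin 3) (Fin 3) ℝ, Q₀ᵀ * Q₀ = P ∧ 0 < Q₀.det := by
  obtain ⟨h1, h2, h3⟩ := matrixSqrt_spec hP
  rcases lt_or_gt_of_ne h3.ne_zero with h | h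
  · refine ⟨-matrixSqrt P, ?_, ?_⟩
    · rw [Matrix.transpose_neg, neg_mul_neg, h1, h2]
    · rw [Matrix.det_neg]; norm_num; exact h
  · exact ⟨matrixSqrt P, by rw [h1, h2], h⟩

lemma exists_bound_sum_mul {f g : Fin 3 → Plane → ℝ} (hf : ∀ m, ∃ C, ∀ x ∈ Ω, |f m x| ≤ C)
    (hg : ∀ m, ∃ C, ∀ x ∈ Ω, |g m x| ≤ C) : ∃ C, ∀ x ∈ Ω, |∑ m, f m x * g m x| ≤ C := by
  choose C hC using hf
  choose D hD using hg
  refine ⟨∑ m, C m * D m, fun x hx ↦ (Finset.abs_sum_le_sum_abs _ _).trans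
    (Finset.sum_le_sum fun m _ ↦ ?_)⟩
  rw [abs_mul]
  exact mul_le_mul (hC m x hx) (hD m x hx) (abs_nonneg _) ((abs_nonneg _).trans (hC m x hx))

/-- Flat metrics have an isometric immersion with parallel frame. -/
theorem exists_parallel_immersion (hΩ : IsMidplate Ω) (hG : IsPlateMetric Ω G)
    (hc : ∀ x ∈ Ω, curv G x = 0) :
    ∃ y, IsIsometricImmersion Ω G y ∧ IsParallel Ω G (frame Ω y (cosserat Ω G y)) := by
  have hO := hΩ.isOpen
  have hb := hΩ.isBounded
  have hsc := hΩ.simplyConnected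
  have hpc : IsPreconnected Ω := hsc.isPathConnected.isConnected.isPreconnected
  obtain ⟨x₀, hx₀⟩ := hsc.isPathConnected.nonempty
  obtain ⟨Q₀, hQ₀, hd₀⟩ := exists_gram_root (hG.posDef x₀ (subset_closure hx₀))
  obtain ⟨Q, y, rfl, h⟩ := exists_isDevelopment hO hsc hG hc hx₀ Q₀
  have hgram : ∀ x ∈ Ω, (Q x)ᵀ * Q x = G x := fun x hx ↦ h.gram hO hpc hG hx₀ hQ₀ hx
  have hdet : ∀ x ∈ Ω, 0 < (Q x).det := fun x hx ↦ h.det_pos hO hpc hG hx₀ hQ₀ hd₀ hx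
  have hQbd : ∀ a b, ∃ C, ∀ x ∈ Ω, |Q x a b| ≤ C := fun a b ↦ by
    obtain ⟨C, hC⟩ := hG.exists_bound_apply hb b b
    refine ⟨C, fun x hx ↦ (abs_apply_le_of_gram (A := Q x) a b).trans ?_⟩
    rw [hgram x hx]
    exact hC x hx
  have hQw : ∀ a b, HasBddW12 Ω (fun x ↦ Q x a b) fun i x ↦ (Q x * conn G i x) a b :=
    fun a b ↦ by
    choose! L hL hLe using fun x hx ↦ h.frame x hx a b
    have hc' : ∀ i, ContinuousOn (fun x ↦ (Q x * conn G i x) a b) Ω := fun i ↦ by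
      have h1 := h.continuousOn
      have h2 := hG.continuousOn_conn hO
      simp only [Matrix.mul_apply]
      fun_prop
    have hbd : ∀ i, ∃ C, ∀ x ∈ Ω, |(Q x * conn G i x) a b| ≤ C := fun i ↦ by
      simp only [Matrix.mul_apply]
      exact exists_bound_sum_mul (fun m ↦ hQbd a m)
        fun m ↦ hG.exists_bound_christoffel hO hb m i.castSucc b
    have h3 := hasBddW12_of_hasFDerivAt hO hb hL
      (fun i ↦ (hc' i).congr fun x hx ↦ hLe x hx i) (hQbd a b)
      (fun i ↦ let ⟨C, hC⟩ := hbd i; ⟨C, fun x hx ↦ by rw [hLe x hx i]; exact hC x hx⟩)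
    have h4 : ∀ i, (fun x ↦ L x (e i)) =ᵐ[volume.restrict Ω]
        fun x ↦ (Q x * conn G i x) a b := fun i ↦ by
      filter_upwards [ae_mem hO] with x hx using hLe x hx i
    exact ⟨h3.bdd, fun i ↦ (h3.weak i).congr .rfl (h4 i), fun i ↦ (h3.l2 i).ae_eq (h4 i)⟩
  have hyw : ∀ a, MemLp (fun x ↦ y x a) 2 (volume.restrict Ω) ∧
      ∀ i : Fin 2, IsWeakPartial Ω i (fun x ↦ y x a) fun x ↦ Q x a i.castSucc := fun a ↦ by
    choose! L hL hLe using fun x hx ↦ h.point x hx a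
    choose C hC using fun i : Fin 2 ↦ hQbd a i.castSucc
    -- The gradient of `y` is bounded by the frame; the smooth boundary turns this into a bound on
    -- `y` itself, hence `y ∈ L²`.
    have hyb : ∃ D, ∀ x ∈ Ω, |y x a| ≤ D := by
      refine exists_bound_of_fderiv_bound hO hb hΩ.smooth
        (fun x hx ↦ (hL x hx).differentiableAt) (C := C 0 + C 1) fun x hx ↦ ?_
      rw [(hL x hx).fderiv]
      exact norm_le_of_abs_apply_e_le fun i ↦ by rw [hLe x hx i]; exact hC i x hx
    have h3 := hasBddW12_of_hasFDerivAt hO hb hL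
      (fun i ↦ (h.continuousOn a i.castSucc).congr fun x hx ↦ hLe x hx i) hyb
      (fun i ↦ ⟨C i, fun x hx ↦ by rw [hLe x hx i]; exact hC i x hx⟩)
    refine ⟨h3.memLp hb, fun i ↦ (h3.weak i).congr .rfl ?_⟩
    filter_upwards [ae_mem hO] with x hx using hLe x hx i
  have hgrad : ∀ᵐ x ∂volume.restrict Ω, ∀ a (i : Fin 2), grad Ω y x a i = Q x a i.castSucc := by
    simp only [ae_all_iff]
    exact fun a i ↦ ((hyw a).2 i).weakPartial_ae_eq hO
  have hiso : IsIsometricImmersion Ω G y := by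
    refine ⟨fun a ↦ ⟨(hyw a).1, fun i ↦ ⟨_, (hQw a i.castSucc).memW12 hb, (hyw a).2 i⟩⟩, ?_⟩
    filter_upwards [hgrad, ae_mem hO] with x h1 hx
    rw [← hgram x hx]
    ext i j
    simp only [minor22, Matrix.submatrix_apply, Matrix.mul_apply, Matrix.transpose_apply, h1]
  -- The third column of `Q` must be the Cosserat vector: both complete `∇y` to a frame with Gram
  -- matrix `G` and positive determinant.
  have hframe : frame Ω y (cosserat Ω G y) =ᵐ[volume.restrict Ω] Q := by
    filter_upwards [hgrad, hiso.cosserat_spec hO hG, ae_mem hO] with x h1 h2 hx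
    have hQ : Q x = colMatrix (grad Ω y x) ((Q x)ᵀ 2) := by
      ext a b
      induction b using Fin.lastCases with
      | last => rfl
      | cast b => rw [colMatrix_castSucc, h1]
    have hb : cosserat Ω G y x = (Q x)ᵀ 2 :=
      colMatrix_injective h2.1 (hQ ▸ hdet x hx) (h2.2.trans (hQ ▸ (hgram x hx).symm))
    rw [frame, hb, ← hQ]
  refine ⟨y, hiso, ?_⟩
  have hw : ∀ᵐ x ∂volume.restrict Ω, ∀ i a b, weakPartial Ω i (fun z ↦ Q z a b) x =
      (Q x * conn G i x) a b := by
    simp only [ae_all_iff]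
    exact fun i a b ↦ (hQw a b).weakPartial_ae_eq hO i
  filter_upwards [hframe, hw] with x h1 h2 i
  ext a b
  rw [h1, ← h2, wmat, Matrix.of_apply]
  exact congrFun (weakPartial_congr (hframe.mono fun z hz ↦ by simp only [hz])) x

end Realization

end PrestrainedPlate

theorem theorem5p5 (Ω : Set PrestrainedPlate.Plane) (hΩ : PrestrainedPlate.IsMidplate Ω)
    (G : PrestrainedPlate.Plane → Matrix (Fin 3) (Fin 3) ℝ)
    (hG : PrestrainedPlate.IsPlateMetric Ω G)
    (W : Matrix (Fin 3) (Fin 3) ℝ → ℝ≥0∞) (hW : PrestrainedPlate.IsEnergyDensity W) :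
    List.TFAE [
      PrestrainedPlate.MinBendingEnergyZero W Ω G,
      PrestrainedPlate.HasSymFreeImmersion Ω G,
      PrestrainedPlate.HasChristoffelImmersion Ω G,
      PrestrainedPlate.CurvaturesVanish Ω G] := by
  have hO := hΩ.isOpen
  have hb := hΩ.isBounded
  rw [PrestrainedPlate.minBendingEnergyZero_iff hO hb hG hW,
    PrestrainedPlate.hasSymFreeImmersion_iff hO hb hG,
    PrestrainedPlate.hasChristoffelImmersion_iff hO hb hG, hG.curvaturesVanish_iff hO]
  -- After the rewriting, the first three conditions are literally the same statement, the existence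
  -- of an isometric immersion with parallel frame.
  tfae_have 1 ↔ 2 := Iff.rfl
  tfae_have 2 ↔ 3 := Iff.rfl
  tfae_have 3 → 4 := fun ⟨_, hy, hp⟩ ↦ (hy.isFrame hO hb hG).curv_eq_zero hO hG hp
  tfae_have 4 → 3 := PrestrainedPlate.exists_parallel_immersion hΩ hG
  tfae_finish
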